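/- There is an algorithm on the real RAM (exact real memory cells with arithmetic and comparisons but no rounding to integers, together with random-access memory of $w$-bit words; every elementary operation costs one unit of time) and there are constants $\kappa, k\in\mathbb{N}$ and $C$ such that the following holds for every $n\ge 2$ and every word size $w\ge \kappa\lfloor\log_2 n\rfloor$. Given three finite families $P,Q,R$, each of at most $n$ closed axis-parallel rectangles in $\mathbb{R}^2$, the algorithm decides in time at most $C\,n^{7/4}(\log n)^{k}$, i.e. in $\tilde O(n^{7/4})$ time, whether for all $(p,r)\in P\times R$ there exists $q\in Q$ intersecting both $p$ and $r$. In particular, for a family $S$ of at most $n$ closed axis-parallel rectangles, the same algorithm on input $P=Q=R=S$ decides within the same time bound whether the intersection graph of $S$ has diameter at most $2$. On the other hand, the diameter-2 neighborhoods of rectangles have unbounded VC-dimension: for every $d\in\mathbb{N}$ there is a finite family of closed axis-parallel rectangles in $\mathbb{R}^2$ with intersection graph $G$ such that the set system $\{N^2[v] : v\in V(G)\}$, where $N^2[v]=\{u : d_G(u,v)\le 2\}$, has VC-dimension at least $d$. -/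

import Mathlib

/-! ## Axis-parallel rectangles and their intersection graphs -/

/-- A closed axis-parallel rectangle `[x₁, x₂] × [y₁, y₂]` in the plane. -/
structure Rect where
  x₁ : ℝ
  x₂ : ℝ
  y₁ : ℝ
  y₂ : ℝ
  hx : x₁ ≤ x₂
  hy : y₁ ≤ y₂

namespace Rect

/-- The set of points of a rectangle. -/
def toSet (p : Rect) : Set (ℝ × ℝ) := Set.Icc p.x₁ p.x₂ ×ˢ Set.Icc p.y₁ p.y₂

/-- Two rectangles intersect if they have a point in common. -/
def Intersects (p q : Rect) : Prop := (p.toSet ∩ q.toSet).Nonempty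

/-- The four coordinates in the order in which they are given to a program. -/
def coord (p : Rect) : Fin 4 → ℝ := ![p.x₁, p.x₂, p.y₁, p.y₂]

end Rect

/-- The intersection graph of a finite family of rectangles: the vertices are the members of the
family, and two different vertices are adjacent if their rectangles intersect. -/
def intersectionGraph {m : ℕ} (S : Fin m → Rect) : SimpleGraph (Fin m) :=
  SimpleGraph.fromRel fun i j => (S i).Intersects (S j)

open Classical in
/-- The family of the `r`-neighborhood balls `N^r[v] = {u | d(u, v) ≤ r}` of a finite graph. -/
noncomputable def neighborhoodBalls {m : ℕ} (G : SimpleGraph (Fin m)) (r : ℕ) :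
    Finset (Finset (Fin m)) :=
  Finset.univ.image fun v => Finset.univ.filter fun u => G.edist u v ≤ r

/-! ## The real RAM

Programs of a structured real RAM.  The memory has integer cells, which hold `w`-bit words, and
real cells, which hold exact real numbers.  A program uses finitely many registers and finitely many
arrays of either kind; arrays are random-access memories addressed by words.  The operations on
words are `+, -, *, /, mod` and comparison, those on reals are `+, -, *, /` and comparison; a word
can be converted to a real, but there is no rounding of reals to words.  Every elementary
operation, memory access and test costs one unit of time. -/

namespace RealRAM

/-- A memory configuration. -/
structure State where
  /-- word registers -/
  nreg : ℕ → ℕ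
  /-- real registers -/
  rreg : ℕ → ℝ
  /-- word arrays -/
  narr : ℕ → ℕ → ℕ
  /-- real arrays -/
  rarr : ℕ → ℕ → ℝ

/-- Word-valued expressions. -/
inductive NExpr where
  | const (k : ℕ)
  | reg (x : ℕ)
  | get (a : ℕ) (i : NExpr)
  | add (e f : NExpr)
  | sub (e f : NExpr)
  | mul (e f : NExpr)
  | div (e f : NExpr)
  | mod (e f : NExpr)

namespace NExpr

/-- Value of a word expression for word size `w`: results are reduced modulo `2 ^ w`; subtraction is
truncated at `0`. -/
def eval (w : ℕ) (s : State) : NExpr → ℕ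
  | const k => k % 2 ^ w
  | reg x => s.nreg x
  | get a i => s.narr a (i.eval w s)
  | add e f => (e.eval w s + f.eval w s) % 2 ^ w
  | sub e f => e.eval w s - f.eval w s
  | mul e f => (e.eval w s * f.eval w s) % 2 ^ w
  | div e f => e.eval w s / f.eval w s
  | mod e f => e.eval w s % f.eval w s

/-- Time to evaluate a word expression. -/
def cost : NExpr → ℕ
  | const _ => 1
  | reg _ => 1
  | get _ i => i.cost + 1
  | add e f => e.cost + f.cost + 1
  | sub e f => e.cost + f.cost + 1
  | mul e f => e.cost + f.cost + 1
  | div e f => e.cost + f.cost + 1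
  | mod e f => e.cost + f.cost + 1

end NExpr

/-- Real-valued expressions. -/
inductive RExpr where
  | ofWord (e : NExpr)
  | reg (x : ℕ)
  | get (a : ℕ) (i : NExpr)
  | add (e f : RExpr)
  | sub (e f : RExpr)
  | mul (e f : RExpr)
  | div (e f : RExpr)

namespace RExpr

/-- Value of a real expression. -/
noncomputable def eval (w : ℕ) (s : State) : RExpr → ℝ
  | ofWord e => (e.eval w s : ℝ)
  | reg x => s.rreg x
  | get a i => s.rarr a (i.eval w s)
  | add e f => e.eval w s + f.eval w s
  | sub e f => e.eval w s - f.eval w s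
  | mul e f => e.eval w s * f.eval w s
  | div e f => e.eval w s / f.eval w s

/-- Time to evaluate a real expression. -/
def cost : RExpr → ℕ
  | ofWord e => e.cost + 1
  | reg _ => 1
  | get _ i => i.cost + 1
  | add e f => e.cost + f.cost + 1
  | sub e f => e.cost + f.cost + 1
  | mul e f => e.cost + f.cost + 1
  | div e f => e.cost + f.cost + 1

end RExpr

/-- Tests. -/
inductive BExpr where
  | nlt (e f : NExpr)
  | neq (e f : NExpr)
  | rlt (e f : RExpr)
  | not (b : BExpr)
  | and (b c : BExpr)
  | or (b c : BExpr)

namespace BExpr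

/-- Truth of a test. -/
def Holds (w : ℕ) (s : State) : BExpr → Prop
  | nlt e f => e.eval w s < f.eval w s
  | neq e f => e.eval w s = f.eval w s
  | rlt e f => e.eval w s < f.eval w s
  | not b => ¬ b.Holds w s
  | and b c => b.Holds w s ∧ c.Holds w s
  | or b c => b.Holds w s ∨ c.Holds w s

/-- Time to evaluate a test. -/
def cost : BExpr → ℕ
  | nlt e f => e.cost + f.cost + 1
  | neq e f => e.cost + f.cost + 1
  | rlt e f => e.cost + f.cost + 1
  | not b => b.cost + 1
  | and b c => b.cost + c.cost + 1
  | or b c => b.cost + c.cost + 1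

end BExpr

/-- Programs. -/
inductive Prog where
  | skip
  /-- word register `x` receives `e` -/
  | nset (x : ℕ) (e : NExpr)
  /-- real register `x` receives `e` -/
  | rset (x : ℕ) (e : RExpr)
  /-- cell `i` of word array `a` receives `e` -/
  | nstore (a : ℕ) (i e : NExpr)
  /-- cell `i` of real array `a` receives `e` -/
  | rstore (a : ℕ) (i : NExpr) (e : RExpr)
  | seq (p q : Prog)
  | ite (b : BExpr) (p q : Prog)
  | loop (b : BExpr) (p : Prog)

/-- `Exec w p s s' t`: with word size `w`, the program `p` started in the memory configuration `s`
halts after exactly `t` units of time in the configuration `s'`.  Here `loop b p` is the loop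
`while b do p`. -/
inductive Exec (w : ℕ) : Prog → State → State → ℕ → Prop
  | skip (s : State) : Exec w .skip s s 1
  | nset (x : ℕ) (e : NExpr) (s : State) :
      Exec w (.nset x e) s
        { s with nreg := Function.update s.nreg x (e.eval w s) } (e.cost + 1)
  | rset (x : ℕ) (e : RExpr) (s : State) :
      Exec w (.rset x e) s
        { s with rreg := Function.update s.rreg x (e.eval w s) } (e.cost + 1)
  | nstore (a : ℕ) (i e : NExpr) (s : State) :
      Exec w (.nstore a i e) s
        { s with
          narr := Function.update s.narr a
            (Function.update (s.narr a) (i.eval w s) (e.eval w s)) }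
        (i.cost + e.cost + 1)
  | rstore (a : ℕ) (i : NExpr) (e : RExpr) (s : State) :
      Exec w (.rstore a i e) s
        { s with
          rarr := Function.update s.rarr a
            (Function.update (s.rarr a) (i.eval w s) (e.eval w s)) }
        (i.cost + e.cost + 1)
  | seq {p q : Prog} {s₁ s₂ s₃ : State} {t₁ t₂ : ℕ} :
      Exec w p s₁ s₂ t₁ → Exec w q s₂ s₃ t₂ → Exec w (.seq p q) s₁ s₃ (t₁ + t₂)
  | ite_true {b : BExpr} {p q : Prog} {s s' : State} {t : ℕ} :
      b.Holds w s → Exec w p s s' t → Exec w (.ite b p q) s s' (b.cost + 1 + t)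
  | ite_false {b : BExpr} {p q : Prog} {s s' : State} {t : ℕ} :
      ¬ b.Holds w s → Exec w q s s' t → Exec w (.ite b p q) s s' (b.cost + 1 + t)
  | loop_false {b : BExpr} {p : Prog} {s : State} :
      ¬ b.Holds w s → Exec w (.loop b p) s s (b.cost + 1)
  | loop_true {b : BExpr} {p : Prog} {s₁ s₂ s₃ : State} {t₁ t₂ : ℕ} :
      b.Holds w s₁ → Exec w p s₁ s₂ t₁ → Exec w (.loop b p) s₂ s₃ t₂ →
      Exec w (.loop b p) s₁ s₃ (b.cost + 1 + t₁ + t₂)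

/-- With word size `w`, the program `p` started in `s` halts within time `T` and reports the truth
value of `A` in word register `0` (`1` for true, `0` for false). -/
def DecidesWithin (w : ℕ) (p : Prog) (s : State) (T : ℝ) (A : Prop) : Prop :=
  ∃ (s' : State) (t : ℕ), Exec w p s s' t ∧ (t : ℝ) ≤ T ∧
    (A → s'.nreg 0 = 1) ∧ (¬ A → s'.nreg 0 = 0)

/-- The initial configuration that represents an input of three families of rectangles.  The word
registers `0, 1, 2` hold the sizes of `P, Q, R`; coordinate `j` of the `i`-th member of `P`, of `Q`,
of `R` is in cell `i` of the real array `j`, `4 + j`, `8 + j` respectively (`j < 4`); everything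
else is `0`. -/
noncomputable def input {a b c : ℕ} (P : Fin a → Rect) (Q : Fin b → Rect) (R : Fin c → Rect) :
    State where
  nreg x := if x = 0 then a else if x = 1 then b else if x = 2 then c else 0
  rreg _ := 0
  narr _ _ := 0
  rarr k i :=
    if hP : k < 4 ∧ i < a then (P ⟨i, hP.2⟩).coord ⟨k, hP.1⟩
    else if hQ : 4 ≤ k ∧ k < 8 ∧ i < b then (Q ⟨i, hQ.2.2⟩).coord ⟨k - 4, by omega⟩
    else if hR : 8 ≤ k ∧ k < 12 ∧ i < c then (R ⟨i, hR.2.2⟩).coord ⟨k - 8, by omega⟩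
    else 0

end RealRAM

/-!
A rectangle `q` intersects a rectangle `p` if and only if `q` is below `p` in four coordinates,
which are `x₁, -x₂, y₁, -y₂` for `q` and `x₂, -x₁, y₂, -y₁` for `p` (`Rect.intersects_iff_key`).
So the question is whether for all `p` and `r` some `q` is below the coordinatewise minimum of `p`
and `r`.  This minimum is one of the 16 mixtures that take each coordinate from `p` or from `r`,
and all mixtures are above it.  Hence the answer is positive if and only if, for each fixed choice
of the coordinates, every pair has a `q` below its mixture (`forall_exists_below_iff`), and the
choices can be tested one by one.

The algorithm sorts all `M ≤ 3 * n` elements in each of the four coordinates (`runs_sort`, a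
tournament sort with ties broken by the numbering, which puts the members of `Q` first) and works
with ranks only.  The ranks are divided into `g` blocks of length `B = g ^ 3`, where `g` is the
least number with `M ≤ g ^ 4`.  Each test takes time of order `g * B ^ 2 = g ^ 7`, that is
`n ^ (7 / 4)`; no logarithmic factor is needed.

* If at most one coordinate comes from `r`, only the least such coordinate among all `r` matters,
  and the condition concerns single elements `p` (`DomCond`, `runs_domTest`).  A witness `q` that
  shares with `p` the block of the third or of the fourth coordinate is found by inspection of
  these blocks, in time `B` for each `p`.  For a witness in smaller blocks in both of these
  coordinates, there is a sweep in the first coordinate, which maintains a minimum of the second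
  one, for each of the `g ^ 2` pairs of blocks.
* If two coordinates come from either side, the family of the `p` can be replaced by a staircase
  in its two coordinates, and likewise that of the `r`.  Then the pairs `(p, r)` that have a given
  `q` below their mixture form a rectangle in the grid of ranks, and these rectangles have to
  cover all pairs (`PairCond`, `pairCond_iff_cover`).  This is tested by a sweep over the rows for
  each block of columns (`runs_pairTest`).  A rectangle whose interval of columns contains the
  block or is disjoint from it takes constant time, and the time `B` has to be spent only for the
  two blocks in which the interval ends.

Running times are bounded in a small program logic, with the judgement `Runs` of total correctness
within a time bound and the frame condition `Same`.  The programs use registers `0` to `7` for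
sizes (`1` for the size `b` of `Q`, `4` for `b + a`, `5` for `M`, `6` for `g`, `7` for `B`), `12`
to `15` for the two sides of a test, `20` for its outcome and the higher ones as scratch; word
arrays `0` to `7` for ranks and their inverses, `8` to `12` as scratch; and real arrays `12` to
`15` for the keys.

For the VC-dimension, two classes of points on antidiagonals of opposite quadrants can be joined
in pairs by rectangles that reach exactly one point of each class.  So any bipartite relation
arises as being at distance at most two (`connectorFamily_spec`), in particular the membership
relation of all subsets of a set with `d` elements.
-/

/-! ### Running programs -/

namespace RealRAM

/-- The configuration after word register `x` has received `v`. -/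
def State.setReg (s : State) (x v : ℕ) : State :=
  { s with nreg := Function.update s.nreg x v }

/-- The configuration after cell `i` of word array `a` has received `v`. -/
def State.store (s : State) (a i v : ℕ) : State :=
  { s with narr := Function.update s.narr a (Function.update (s.narr a) i v) }

/-- The configuration after cell `i` of real array `a` has received `v`. -/
def State.storeReal (s : State) (a i : ℕ) (v : ℝ) : State :=
  { s with rarr := Function.update s.rarr a (Function.update (s.rarr a) i v) }

section State
variable (s : State) (a i v x y : ℕ) (z : ℝ)

@[simp] theorem State.setReg_nreg : (s.setReg x v).nreg y = if y = x then v else s.nreg y := by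
  simp [State.setReg, Function.update_apply]

@[simp] theorem State.setReg_narr : (s.setReg x v).narr = s.narr := rfl

@[simp] theorem State.setReg_rarr : (s.setReg x v).rarr = s.rarr := rfl

@[simp] theorem State.store_nreg : (s.store a i v).nreg = s.nreg := rfl

@[simp] theorem State.store_rarr : (s.store a i v).rarr = s.rarr := rfl

@[simp] theorem State.store_narr :
    (s.store a i v).narr x y = if x = a ∧ y = i then v else s.narr x y := by
  by_cases hx : x = a
  · subst hx
    simp [State.store, Function.update_apply]
  · simp [State.store, hx]

@[simp] theorem State.storeReal_nreg : (s.storeReal a i z).nreg = s.nreg := rfl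

@[simp] theorem State.storeReal_narr : (s.storeReal a i z).narr = s.narr := rfl

@[simp] theorem State.storeReal_rarr :
    (s.storeReal a i z).rarr x y = if x = a ∧ y = i then z else s.rarr x y := by
  by_cases hx : x = a
  · subst hx
    simp [State.storeReal, Function.update_apply]
  · simp [State.storeReal, hx]

end State

namespace Prog

/-- `p.WritesReg x`: the text of `p` has an assignment to word register `x`. -/
def WritesReg : Prog → ℕ → Prop
  | skip, _ => False
  | nset x _, y => y = x
  | rset _ _, _ => False
  | nstore _ _ _, _ => False
  | rstore _ _ _, _ => False
  | seq p q, y => p.WritesReg y ∨ q.WritesReg y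
  | ite _ p q, y => p.WritesReg y ∨ q.WritesReg y
  | loop _ p, y => p.WritesReg y

/-- `p.WritesArr a`: the text of `p` has an assignment to a cell of word array `a`. -/
def WritesArr : Prog → ℕ → Prop
  | skip, _ => False
  | nset _ _, _ => False
  | rset _ _, _ => False
  | nstore a _ _, b => b = a
  | rstore _ _ _, _ => False
  | seq p q, y => p.WritesArr y ∨ q.WritesArr y
  | ite _ p q, y => p.WritesArr y ∨ q.WritesArr y
  | loop _ p, y => p.WritesArr y

/-- `p.WritesReal a`: the text of `p` has an assignment to a cell of real array `a`. -/
def WritesReal : Prog → ℕ → Prop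
  | skip, _ => False
  | nset _ _, _ => False
  | rset _ _, _ => False
  | nstore _ _ _, _ => False
  | rstore a _ _, b => b = a
  | seq p q, y => p.WritesReal y ∨ q.WritesReal y
  | ite _ p q, y => p.WritesReal y ∨ q.WritesReal y
  | loop _ p, y => p.WritesReal y

end Prog

/-- `s'` agrees with `s` on all registers and arrays to which the text of `p` does not assign. -/
structure Same (p : Prog) (s s' : State) : Prop where
  reg : ∀ x, ¬ p.WritesReg x → s'.nreg x = s.nreg x
  arr : ∀ a, ¬ p.WritesArr a → s'.narr a = s.narr a
  real : ∀ a, ¬ p.WritesReal a → s'.rarr a = s.rarr a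

theorem Same.refl (p : Prog) (s : State) : Same p s s :=
  ⟨fun _ _ => rfl, fun _ _ => rfl, fun _ _ => rfl⟩

theorem Same.trans {p : Prog} {s s' s'' : State} (h : Same p s s') (h' : Same p s' s'') :
    Same p s s'' :=
  ⟨fun x hx => (h'.reg x hx).trans (h.reg x hx), fun x hx => (h'.arr x hx).trans (h.arr x hx),
    fun x hx => (h'.real x hx).trans (h.real x hx)⟩

theorem Same.mono {p q : Prog} {s s' : State} (h : Same p s s')
    (h1 : ∀ x, p.WritesReg x → q.WritesReg x) (h2 : ∀ x, p.WritesArr x → q.WritesArr x)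
    (h3 : ∀ x, p.WritesReal x → q.WritesReal x) : Same q s s' :=
  ⟨fun x hx => h.reg x fun h => hx (h1 x h), fun x hx => h.arr x fun h => hx (h2 x h),
    fun x hx => h.real x fun h => hx (h3 x h)⟩

theorem Exec.same {w : ℕ} {p : Prog} {s s' : State} {t : ℕ} (h : Exec w p s s' t) :
    Same p s s' := by
  induction h with
  | skip s => exact Same.refl _ _
  | nset x e s =>
    exact ⟨fun y hy => Function.update_of_ne (by simpa [Prog.WritesReg] using hy) _ _,
      fun _ _ => rfl, fun _ _ => rfl⟩
  | rset x e s => exact ⟨fun _ _ => rfl, fun _ _ => rfl, fun _ _ => rfl⟩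
  | nstore a i e s =>
    exact ⟨fun _ _ => rfl, fun y hy => Function.update_of_ne
        (by simpa [Prog.WritesArr] using hy) _ _,
      fun _ _ => rfl⟩
  | rstore a i e s =>
    exact ⟨fun _ _ => rfl, fun _ _ => rfl,
      fun y hy => Function.update_of_ne (by simpa [Prog.WritesReal] using hy) _ _⟩
  | seq _ _ h1 h2 =>
    exact (h1.mono (fun _ => Or.inl) (fun _ => Or.inl) fun _ => Or.inl).trans
      (h2.mono (fun _ => Or.inr) (fun _ => Or.inr) fun _ => Or.inr)
  | ite_true _ _ h => exact h.mono (fun _ => Or.inl) (fun _ => Or.inl) fun _ => Or.inl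
  | ite_false _ _ h => exact h.mono (fun _ => Or.inr) (fun _ => Or.inr) fun _ => Or.inr
  | loop_false _ => exact Same.refl _ _
  | loop_true _ _ _ h1 h2 =>
    refine Same.trans ?_ h2
    exact h1.mono (fun _ => id) (fun _ => id) fun _ => id

/-- Total correctness with a time bound: with word size `w`, the program `p` started in `s` halts
within time `T` in a configuration that satisfies `Q`. -/
def Runs (w : ℕ) (p : Prog) (s : State) (T : ℕ) (Q : State → Prop) : Prop :=
  ∃ (s' : State) (t : ℕ), Exec w p s s' t ∧ t ≤ T ∧ Q s'

section Rules
variable {w : ℕ} {p q : Prog} {b : BExpr} {s : State} {T T' T₁ T₂ : ℕ} {Q R : State → Prop}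

theorem Runs.mono (h : Runs w p s T R) (hT : T ≤ T') (hQ : ∀ s', Same p s s' → R s' → Q s') :
    Runs w p s T' Q := by
  obtain ⟨s', t, h1, h2, h3⟩ := h
  exact ⟨s', t, h1, h2.trans hT, hQ _ h1.same h3⟩

theorem Runs.seq (h : Runs w p s T₁ R) (h' : ∀ s', Same p s s' → R s' → Runs w q s' T₂ Q)
    (hT : T₁ + T₂ ≤ T) : Runs w (.seq p q) s T Q := by
  obtain ⟨s', t, h1, h2, h3⟩ := h
  obtain ⟨s'', t', h4, h5, h6⟩ := h' s' h1.same h3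
  exact ⟨s'', t + t', .seq h1 h4, by omega, h6⟩

theorem Runs.ite (h : b.Holds w s → Runs w p s T Q) (h' : ¬ b.Holds w s → Runs w q s T Q)
    (hT : b.cost + 1 + T ≤ T') : Runs w (.ite b p q) s T' Q := by
  by_cases hb : b.Holds w s
  · obtain ⟨s', t, h1, h2, h3⟩ := h hb
    exact ⟨s', _, .ite_true hb h1, by omega, h3⟩
  · obtain ⟨s', t, h1, h2, h3⟩ := h' hb
    exact ⟨s', _, .ite_false hb h1, by omega, h3⟩

/-- The rule for loops.  The invariant `I k` holds when at most `k` iterations are left. -/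
theorem Runs.loop (I : ℕ → State → Prop) {N : ℕ} (h0 : I N s)
    (hstep : ∀ k s', Same p s s' → I (k + 1) s' → b.Holds w s' → Runs w p s' T (I k))
    (hend : ∀ s', Same p s s' → I 0 s' → ¬ b.Holds w s')
    (hQ : ∀ k s', Same p s s' → I k s' → ¬ b.Holds w s' → Q s')
    (hT : N * (T + b.cost + 1) + b.cost + 1 ≤ T') : Runs w (.loop b p) s T' Q := by
  suffices H : ∀ N s', Same p s s' → I N s' →
      Runs w (.loop b p) s' (N * (T + b.cost + 1) + b.cost + 1) Q from
    (H N s (Same.refl _ _) h0).mono hT fun _ _ h => h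
  intro N
  induction N with
  | zero =>
    intro s' hs hI
    have hb := hend s' hs hI
    exact ⟨s', _, .loop_false hb, by omega, hQ _ _ hs hI hb⟩
  | succ k ih =>
    intro s' hs hI
    by_cases hb : b.Holds w s'
    · obtain ⟨s₁, t₁, h1, h2, h3⟩ := hstep k s' hs hI hb
      obtain ⟨s₂, t₂, h4, h5, h6⟩ := ih s₁ (hs.trans h1.same) h3
      refine ⟨s₂, _, .loop_true hb h1 h4, ?_, h6⟩
      rw [Nat.succ_mul]
      omega
    · exact ⟨s', _, .loop_false hb, by omega, hQ _ _ hs hI hb⟩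

end Rules

/-! #### Programs without loops -/

namespace Prog

/-- The program has no loops. -/
def LoopFree : Prog → Prop
  | seq p q => p.LoopFree ∧ q.LoopFree
  | ite _ p q => p.LoopFree ∧ q.LoopFree
  | loop _ _ => False
  | _ => True

/-- An upper bound for the running time of a program without loops; the value at a loop is
arbitrary. -/
def time : Prog → ℕ
  | skip => 1
  | nset _ e => e.cost + 1
  | rset _ e => e.cost + 1
  | nstore _ i e => i.cost + e.cost + 1
  | rstore _ i e => i.cost + e.cost + 1
  | seq p q => p.time + q.time
  | ite b p q => b.cost + 1 + max p.time q.time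
  | loop _ _ => 0

open Classical in
/-- The configuration that a program without loops reaches from `s`; the value at a loop is
arbitrary. -/
noncomputable def run (w : ℕ) : Prog → State → State
  | skip, s => s
  | nset x e, s => s.setReg x (e.eval w s)
  | rset x e, s => { s with rreg := Function.update s.rreg x (e.eval w s) }
  | nstore a i e, s => s.store a (i.eval w s) (e.eval w s)
  | rstore a i e, s => s.storeReal a (i.eval w s) (e.eval w s)
  | seq p q, s => q.run w (p.run w s)
  | ite b p q, s => if b.Holds w s then p.run w s else q.run w s
  | loop _ _, s => s

theorem LoopFree.exec {w : ℕ} {p : Prog} (h : p.LoopFree) (s : State) :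
    ∃ t ≤ p.time, Exec w p s (p.run w s) t := by
  induction p generalizing s with
  | skip => exact ⟨_, le_rfl, .skip s⟩
  | nset x e => exact ⟨_, le_rfl, .nset x e s⟩
  | rset x e => exact ⟨_, le_rfl, .rset x e s⟩
  | nstore a i e => exact ⟨_, le_rfl, .nstore a i e s⟩
  | rstore a i e => exact ⟨_, le_rfl, .rstore a i e s⟩
  | seq p q hp hq =>
    obtain ⟨t, ht, h1⟩ := hp h.1 s
    obtain ⟨t', ht', h2⟩ := hq h.2 (p.run w s)
    exact ⟨_, Nat.add_le_add ht ht', .seq h1 h2⟩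
  | ite b p q hp hq =>
    by_cases hb : b.Holds w s
    · obtain ⟨t, ht, h1⟩ := hp h.1 s
      refine ⟨_, Nat.add_le_add_left (ht.trans (le_max_left _ _)) _, ?_⟩
      · rw [run, if_pos hb]
        exact .ite_true hb h1
    · obtain ⟨t, ht, h1⟩ := hq h.2 s
      refine ⟨_, Nat.add_le_add_left (ht.trans (le_max_right _ _)) _, ?_⟩
      · rw [run, if_neg hb]
        exact .ite_false hb h1
  | loop b p _ => exact h.elim

end Prog

theorem Runs.of_loopFree {w : ℕ} {p : Prog} {s : State} {T : ℕ} {Q : State → Prop}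
    (h : p.LoopFree) (hQ : Q (p.run w s)) (hT : p.time ≤ T) : Runs w p s T Q := by
  obtain ⟨t, ht, h1⟩ := h.exec (w := w) s
  exact ⟨_, t, h1, ht.trans hT, hQ⟩

section Step
variable {w x a v k T : ℕ} {z : ℝ} {e i : NExpr} {f : RExpr} {b : BExpr} {p q : Prog} {s : State}
  {Q : State → Prop}

theorem Runs.skip (h : Q s) (hT : 1 ≤ T) : Runs w .skip s T Q := ⟨s, 1, .skip s, hT, h⟩

theorem Runs.nset (hv : e.eval w s = v) (h : Q (s.setReg x v)) (hT : e.cost + 1 ≤ T) :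
    Runs w (.nset x e) s T Q := by
  subst hv
  exact ⟨_, _, .nset x e s, hT, h⟩

theorem Runs.nstore (hk : i.eval w s = k) (hv : e.eval w s = v) (h : Q (s.store a k v))
    (hT : i.cost + e.cost + 1 ≤ T) : Runs w (.nstore a i e) s T Q := by
  subst hv hk
  exact ⟨_, _, .nstore a i e s, hT, h⟩

theorem Runs.rstore (hk : i.eval w s = k) (hz : f.eval w s = z) (h : Q (s.storeReal a k z))
    (hT : i.cost + f.cost + 1 ≤ T) : Runs w (.rstore a i f) s T Q := by
  subst hz hk
  exact ⟨_, _, .rstore a i f s, hT, h⟩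

theorem Runs.nset_seq (hv : e.eval w s = v) (hT : e.cost + 1 ≤ T)
    (h : Runs w q (s.setReg x v) (T - (e.cost + 1)) Q) : Runs w (.seq (.nset x e) q) s T Q :=
  Runs.seq (Runs.nset (Q := fun s' => s' = s.setReg x v) hv rfl le_rfl)
    (fun _ _ hs => hs ▸ h) (by omega)

theorem Runs.nstore_seq (hk : i.eval w s = k) (hv : e.eval w s = v) (hT : i.cost + e.cost + 1 ≤ T)
    (h : Runs w q (s.store a k v) (T - (i.cost + e.cost + 1)) Q) :
    Runs w (.seq (.nstore a i e) q) s T Q :=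
  Runs.seq (Runs.nstore (Q := fun s' => s' = s.store a k v) hk hv rfl le_rfl)
    (fun _ _ hs => hs ▸ h) (by omega)

theorem Runs.rstore_seq (hk : i.eval w s = k) (hz : f.eval w s = z) (hT : i.cost + f.cost + 1 ≤ T)
    (h : Runs w q (s.storeReal a k z) (T - (i.cost + f.cost + 1)) Q) :
    Runs w (.seq (.rstore a i f) q) s T Q :=
  Runs.seq (Runs.rstore (Q := fun s' => s' = s.storeReal a k z) hk hz rfl le_rfl)
    (fun _ _ hs => hs ▸ h) (by omega)

theorem Runs.cond (hT : b.cost + 1 ≤ T) (h : b.Holds w s → Runs w p s (T - (b.cost + 1)) Q)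
    (h' : ¬ b.Holds w s → Runs w q s (T - (b.cost + 1)) Q) : Runs w (.ite b p q) s T Q :=
  Runs.ite h h' (by omega)

end Step

/-! #### Counting loops -/

/-- `for x = lo, …, hi - 1 do p`. -/
def Prog.for (x : ℕ) (lo hi : NExpr) (p : Prog) : Prog :=
  .seq (.nset x lo) (.loop (.nlt (.reg x) hi) (.seq p (.nset x (.add (.reg x) (.const 1)))))

/-- The rule for counting loops.  The invariant `I k` holds when the counter is `k`; the body may
take a time `T k` that depends on the counter.  As `N` is a word, the counter does not overflow. -/
theorem Runs.for {w x : ℕ} {lo hi : NExpr} {p : Prog} {s : State} {l N T₀ : ℕ} {Q : State → Prop}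
    (I : ℕ → State → Prop) (T : ℕ → ℕ) (hl : lo.eval w s = l) (hlN : l ≤ N) (hN : N < 2 ^ w)
    (hx : ¬ p.WritesReg x)
    (hhi : ∀ s', Same (Prog.for x lo hi p) s s' → hi.eval w s' = N)
    (h0 : I l (s.setReg x l))
    (hstep : ∀ k, l ≤ k → k < N → ∀ s', Same (Prog.for x lo hi p) s s' → s'.nreg x = k → I k s' →
      Runs w p s' (T k) fun s'' => I (k + 1) (s''.setReg x (k + 1)))
    (hQ : ∀ s', Same (Prog.for x lo hi p) s s' → I N s' → Q s')
    (hT : lo.cost + hi.cost + 4 + ∑ k ∈ Finset.Ico l N, (T k + hi.cost + 7) ≤ T₀) :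
    Runs w (Prog.for x lo hi p) s T₀ Q := by
  have hS0 : Same (Prog.for x lo hi p) s (s.setReg x l) := by
    refine Same.mono (p := .nset x lo) ?_ (fun _ => Or.inl) (fun _ => Or.inl) fun _ => Or.inl
    have := (Exec.nset (w := w) x lo s).same
    rwa [hl] at this
  suffices H : ∀ m k s', N - k = m → l ≤ k → k ≤ N → Same (Prog.for x lo hi p) s s' →
      s'.nreg x = k → I k s' →
      Runs w (.loop (.nlt (.reg x) hi) (.seq p (.nset x (.add (.reg x) (.const 1))))) s'
        (hi.cost + 3 + ∑ k ∈ Finset.Ico k N, (T k + hi.cost + 7)) Q by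
    refine Runs.seq (T₁ := lo.cost + 1) (R := fun s' => s' = s.setReg x l)
      (Runs.of_loopFree trivial (by simp [Prog.run, hl]) le_rfl) ?_
      (T₂ := hi.cost + 3 + ∑ k ∈ Finset.Ico l N, (T k + hi.cost + 7)) (by omega)
    rintro s' _ rfl
    exact H _ l _ rfl le_rfl hlN hS0 (by simp) h0
  intro m
  induction m with
  | zero =>
    intro k s' hm _ hk hS hsx hI
    obtain rfl : k = N := by omega
    refine ⟨s', _, .loop_false ?_, ?_, hQ _ hS hI⟩
    · simp [BExpr.Holds, NExpr.eval, hsx, hhi _ hS]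
    · simp only [BExpr.cost, NExpr.cost]
      omega
  | succ m ih =>
    intro k s' hm hlk hk hS hsx hI
    obtain ⟨s₁, t₁, h1, h2, h3⟩ := hstep k hlk (by omega) s' hS hsx hI
    have hS1 : Same (Prog.for x lo hi p) s s₁ := hS.trans
      (h1.same.mono (fun _ h => Or.inr (Or.inl h)) (fun _ h => Or.inr (Or.inl h))
        fun _ h => Or.inr (Or.inl h))
    have hx1 : s₁.nreg x = k := (h1.same.reg x hx).trans hsx
    have h1lt : 1 < 2 ^ w := by omega
    have hev : (NExpr.add (.reg x) (.const 1)).eval w s₁ = k + 1 := by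
      simp only [NExpr.eval, hx1, Nat.mod_eq_of_lt h1lt]
      exact Nat.mod_eq_of_lt (by omega)
    have h5 := Exec.nset (w := w) x (.add (.reg x) (.const 1)) s₁
    have hS2 := hS1.trans (h5.same.mono (q := Prog.for x lo hi p) (fun _ h => Or.inl h)
      (fun _ h => Or.inl h) fun _ h => Or.inl h)
    rw [hev] at h5 hS2
    obtain ⟨s₂, t₂, h6, h7, h8⟩ := ih (k + 1) (s₁.setReg x (k + 1)) (by omega) (by omega) (by omega)
      hS2 (by simp) h3
    refine ⟨s₂, _, .loop_true ?_ (.seq h1 h5) h6, ?_, h8⟩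
    · simp only [BExpr.Holds, NExpr.eval, hsx, hhi _ hS]
      omega
    · rw [Finset.sum_eq_sum_Ico_succ_bot (by omega : k < N)]
      simp only [BExpr.cost, NExpr.cost]
      omega

/-- The rule for counting loops whose body has a running time independent of the counter. -/
theorem Runs.for_const {w x : ℕ} {lo hi : NExpr} {p : Prog} {s : State} {l N T T₀ : ℕ}
    {Q : State → Prop} (I : ℕ → State → Prop) (hl : lo.eval w s = l) (hlN : l ≤ N) (hN : N < 2 ^ w)
    (hx : ¬ p.WritesReg x)
    (hhi : ∀ s', Same (Prog.for x lo hi p) s s' → hi.eval w s' = N)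
    (h0 : I l (s.setReg x l))
    (hstep : ∀ k, l ≤ k → k < N → ∀ s', Same (Prog.for x lo hi p) s s' → s'.nreg x = k → I k s' →
      Runs w p s' T fun s'' => I (k + 1) (s''.setReg x (k + 1)))
    (hQ : ∀ s', Same (Prog.for x lo hi p) s s' → I N s' → Q s')
    (hT : lo.cost + hi.cost + 4 + (N - l) * (T + hi.cost + 7) ≤ T₀) :
    Runs w (Prog.for x lo hi p) s T₀ Q :=
  Runs.for I (fun _ => T) hl hlN hN hx hhi h0 hstep hQ (by simpa using hT)

end RealRAM

/-! ### Rectangles as points of a four-dimensional dominance order -/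

/-- The coordinates by which a rectangle is compared when it is the lower one. -/
def Rect.lowerKey (q : Rect) : ℕ → ℝ
  | 0 => q.x₁
  | 1 => -q.x₂
  | 2 => q.y₁
  | _ => -q.y₂

/-- The coordinates by which a rectangle is compared when it is the upper one. -/
def Rect.upperKey (p : Rect) : ℕ → ℝ
  | 0 => p.x₂
  | 1 => -p.x₁
  | 2 => p.y₂
  | _ => -p.y₁

theorem Rect.intersects_iff_key (q p : Rect) :
    q.Intersects p ↔ ∀ i < 4, q.lowerKey i ≤ p.upperKey i := by
  have h4 : (∀ i < 4, q.lowerKey i ≤ p.upperKey i) ↔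
      q.x₁ ≤ p.x₂ ∧ p.x₁ ≤ q.x₂ ∧ q.y₁ ≤ p.y₂ ∧ p.y₁ ≤ q.y₂ := by
    constructor
    · intro h
      have h0 := h 0 (by norm_num)
      have h1 := h 1 (by norm_num)
      have h2 := h 2 (by norm_num)
      have h3 := h 3 (by norm_num)
      simp only [Rect.lowerKey, Rect.upperKey] at h0 h1 h2 h3
      refine ⟨h0, ?_, h2, ?_⟩ <;> linarith
    · rintro ⟨h0, h1, h2, h3⟩ i hi
      interval_cases i <;> simp only [Rect.lowerKey, Rect.upperKey] <;> linarith
  rw [h4]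
  have hq := q.hx
  have hq' := q.hy
  have hp := p.hx
  have hp' := p.hy
  constructor
  · rintro ⟨⟨x, y⟩, ⟨hx, hy⟩, hx', hy'⟩
    simp only [Set.mem_Icc] at hx hy hx' hy'
    exact ⟨hx.1.trans hx'.2, hx'.1.trans hx.2, hy.1.trans hy'.2, hy'.1.trans hy.2⟩
  · rintro ⟨h0, h1, h2, h3⟩
    exact ⟨(max q.x₁ p.x₁, max q.y₁ p.y₁),
      ⟨⟨le_max_left _ _, max_le hq h1⟩, ⟨le_max_left _ _, max_le hq' h3⟩⟩,
      ⟨⟨le_max_right _ _, max_le h0 hp⟩, ⟨le_max_right _ _, max_le h2 hp'⟩⟩⟩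

theorem Rect.intersects_self (p : Rect) : p.Intersects p :=
  ⟨(p.x₁, p.y₁), ⟨⟨le_rfl, p.hx⟩, le_rfl, p.hy⟩, ⟨le_rfl, p.hx⟩, le_rfl, p.hy⟩

theorem Rect.intersects_comm {p q : Rect} : p.Intersects q ↔ q.Intersects p := by
  rw [Rect.Intersects, Set.inter_comm, ← Rect.Intersects]

/-! ### Splitting the dominance condition -/

section Dominance
variable (rk : ℕ → ℕ → ℕ) (b i j i' j' lo hi lo' hi' M : ℕ)

/-- Every upper element `p` of the interval `[lo, hi)` has a lower element `q < b` that is below `p`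
in all coordinates and below all elements of `[lo', hi')` in coordinate `i`. -/
def DomCond : Prop :=
  ∀ p, lo ≤ p → p < hi → ∃ q < b, (∀ j < 4, rk j q < rk j p) ∧
    ∀ r, lo' ≤ r → r < hi' → rk i q < rk i r

/-- For all `p` in `[lo, hi)` and `r` in `[lo', hi')` there is a lower element `q < b` that is below
`p` in the coordinates `i, j` and below `r` in the coordinates `i', j'`. -/
def PairCond : Prop :=
  ∀ p, lo ≤ p → p < hi → ∀ r, lo' ≤ r → r < hi' →
    ∃ q < b, rk i q < rk i p ∧ rk j q < rk j p ∧ rk i' q < rk i' r ∧ rk j' q < rk j' r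

variable {rk b i j i' j' lo hi lo' hi' M}

theorem forall_lt_four {p : ℕ → Prop} : (∀ j < 4, p j) ↔ p 0 ∧ p 1 ∧ p 2 ∧ p 3 := by
  constructor
  · intro h
    exact ⟨h 0 (by omega), h 1 (by omega), h 2 (by omega), h 3 (by omega)⟩
  · rintro ⟨h0, h1, h2, h3⟩ j hj
    interval_cases j <;> assumption

/-- The coordinatewise minimum of `p` and `r` takes each coordinate from `p` or from `r`, and every
such mixture is above the minimum.  Hence a common lower bound in the family exists for all pairs
as soon as, for each of the mixtures, all pairs have a lower bound of their mixture. -/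
theorem forall_exists_below_iff (hP : lo < hi) (hR : lo' < hi') :
    (∀ p, lo ≤ p → p < hi → ∀ r, lo' ≤ r → r < hi' →
      ∃ q < b, ∀ j < 4, rk j q < rk j p ∧ rk j q < rk j r) ↔
    (∀ i < 4, DomCond rk b i lo hi lo' hi') ∧ (∀ i < 4, DomCond rk b i lo' hi' lo hi) ∧
      PairCond rk b 0 1 2 3 lo hi lo' hi' ∧ PairCond rk b 2 3 0 1 lo hi lo' hi' ∧
      PairCond rk b 0 2 1 3 lo hi lo' hi' ∧ PairCond rk b 1 3 0 2 lo hi lo' hi' ∧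
      PairCond rk b 0 3 1 2 lo hi lo' hi' ∧ PairCond rk b 1 2 0 3 lo hi lo' hi' := by
  have least : ∀ i lo hi, lo < hi → ∃ m, lo ≤ m ∧ m < hi ∧ ∀ r, lo ≤ r → r < hi →
      rk i m ≤ rk i r := by
    intro i lo hi h
    obtain ⟨m, hm, hmin⟩ := Finset.exists_min_image (Finset.Ico lo hi) (rk i) ⟨lo, by simp [h]⟩
    rw [Finset.mem_Ico] at hm
    exact ⟨m, hm.1, hm.2, fun r h1 h2 => hmin r (by simp [h1, h2])⟩
  constructor
  · intro H
    refine ⟨?_, ?_, ?_⟩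
    · intro i hi4 p hp hp'
      obtain ⟨m, hm, hm', hmin⟩ := least i lo' hi' hR
      obtain ⟨q, hq, h⟩ := H p hp hp' m hm hm'
      exact ⟨q, hq, fun j hj => (h j hj).1, fun r hr hr' => (h i hi4).2.trans_le (hmin r hr hr')⟩
    · intro i hi4 r hr hr'
      obtain ⟨m, hm, hm', hmin⟩ := least i lo hi hP
      obtain ⟨q, hq, h⟩ := H m hm hm' r hr hr'
      exact ⟨q, hq, fun j hj => (h j hj).2, fun p hp hp' => (h i hi4).1.trans_le (hmin p hp hp')⟩
    · refine ⟨?_, ?_, ?_, ?_, ?_, ?_⟩ <;> intro p hp hp' r hr hr' <;>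
        obtain ⟨q, hq, h⟩ := H p hp hp' r hr hr' <;> rw [forall_lt_four] at h <;>
        exact ⟨q, hq, by omega, by omega, by omega, by omega⟩
  · rintro ⟨HP, HR, h1, h2, h3, h4, h5, h6⟩ p hp hp' r hr hr'
    simp only [forall_lt_four]
    by_cases c0 : rk 0 p < rk 0 r <;> by_cases c1 : rk 1 p < rk 1 r <;>
      by_cases c2 : rk 2 p < rk 2 r <;> by_cases c3 : rk 3 p < rk 3 r
    · obtain ⟨q, hq, h, -⟩ := HP 0 (by omega) p hp hp'
      rw [forall_lt_four] at h
      exact ⟨q, hq, by omega⟩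
    · obtain ⟨q, hq, h, h'⟩ := HP 3 (by omega) p hp hp'
      rw [forall_lt_four] at h
      have := h' r hr hr'
      exact ⟨q, hq, by omega⟩
    · obtain ⟨q, hq, h, h'⟩ := HP 2 (by omega) p hp hp'
      rw [forall_lt_four] at h
      have := h' r hr hr'
      exact ⟨q, hq, by omega⟩
    · obtain ⟨q, hq, h⟩ := h1 p hp hp' r hr hr'
      exact ⟨q, hq, by omega⟩
    · obtain ⟨q, hq, h, h'⟩ := HP 1 (by omega) p hp hp'
      rw [forall_lt_four] at h
      have := h' r hr hr'
      exact ⟨q, hq, by omega⟩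
    · obtain ⟨q, hq, h⟩ := h3 p hp hp' r hr hr'
      exact ⟨q, hq, by omega⟩
    · obtain ⟨q, hq, h⟩ := h5 p hp hp' r hr hr'
      exact ⟨q, hq, by omega⟩
    · obtain ⟨q, hq, h, h'⟩ := HR 0 (by omega) r hr hr'
      rw [forall_lt_four] at h
      have := h' p hp hp'
      exact ⟨q, hq, by omega⟩
    · obtain ⟨q, hq, h, h'⟩ := HP 0 (by omega) p hp hp'
      rw [forall_lt_four] at h
      have := h' r hr hr'
      exact ⟨q, hq, by omega⟩
    · obtain ⟨q, hq, h⟩ := h6 p hp hp' r hr hr'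
      exact ⟨q, hq, by omega⟩
    · obtain ⟨q, hq, h⟩ := h4 p hp hp' r hr hr'
      exact ⟨q, hq, by omega⟩
    · obtain ⟨q, hq, h, h'⟩ := HR 1 (by omega) r hr hr'
      rw [forall_lt_four] at h
      have := h' p hp hp'
      exact ⟨q, hq, by omega⟩
    · obtain ⟨q, hq, h⟩ := h2 p hp hp' r hr hr'
      exact ⟨q, hq, by omega⟩
    · obtain ⟨q, hq, h, h'⟩ := HR 2 (by omega) r hr hr'
      rw [forall_lt_four] at h
      have := h' p hp hp'
      exact ⟨q, hq, by omega⟩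
    · obtain ⟨q, hq, h, h'⟩ := HR 3 (by omega) r hr hr'
      rw [forall_lt_four] at h
      have := h' p hp hp'
      exact ⟨q, hq, by omega⟩
    · obtain ⟨q, hq, h, -⟩ := HR 0 (by omega) r hr hr'
      rw [forall_lt_four] at h
      exact ⟨q, hq, by omega⟩

variable (rk i j lo hi M) in
/-- `exit q` is the least rank in coordinate `i` of an element of `[lo, hi)` that is below `q` in
coordinate `j`, and `M` if there is none. -/
def IsExit (exit : ℕ → ℕ) : Prop :=
  ∀ q < M, ∀ x, x < exit q ↔ x < M ∧ ∀ p, lo ≤ p → p < hi → rk j p < rk j q → x < rk i p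

/-- A pair of coordinates of an upper family can be replaced by a staircase; then the set of pairs
above a lower element becomes a rectangle in the grid of ranks, and the condition says that these
rectangles cover the grid. -/
theorem pairCond_iff_cover {β δ : ℕ → ℕ} (hβ : IsExit rk i j lo hi M β)
    (hδ : IsExit rk i' j' lo' hi' M δ) (hb : b ≤ lo) (hb' : b ≤ lo') (hM : hi ≤ M) (hM' : hi' ≤ M)
    (hrk : ∀ j < 4, ∀ e < M, rk j e < M)
    (hinj : ∀ j < 4, ∀ e < M, ∀ f < M, rk j e = rk j f → e = f)
    (hi4 : i < 4) (hj4 : j < 4) (hi4' : i' < 4) (hj4' : j' < 4) :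
    PairCond rk b i j i' j' lo hi lo' hi' ↔
    ∀ p, lo ≤ p → p < hi → ∀ r, lo' ≤ r → r < hi' →
      ∃ q < b, rk i q < rk i p ∧ rk i p < β q ∧ rk i' q < rk i' r ∧ rk i' r < δ q := by
  have least : ∀ i j lo hi p, lo ≤ p → p < hi → ∃ m, lo ≤ m ∧ m < hi ∧ rk i m ≤ rk i p ∧
      ∀ p', lo ≤ p' → p' < hi → rk i p' ≤ rk i p → rk j m ≤ rk j p' := by
    intro i j lo hi p hp hp'
    obtain ⟨m, hm, hmin⟩ := Finset.exists_min_image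
      ((Finset.Ico lo hi).filter fun m => rk i m ≤ rk i p) (rk j) ⟨p, by simp [hp, hp']⟩
    simp only [Finset.mem_filter, Finset.mem_Ico] at hm hmin
    exact ⟨m, hm.1.1, hm.1.2, hm.2, fun p' h1 h2 h3 => hmin p' ⟨⟨h1, h2⟩, h3⟩⟩
  constructor
  · intro H p hp hp' r hr hr'
    obtain ⟨m, hm, hm', h1, h2⟩ := least i j lo hi p hp hp'
    obtain ⟨n, hn, hn', h3, h4⟩ := least i' j' lo' hi' r hr hr'
    obtain ⟨q, hq, h5, h6, h7, h8⟩ := H m hm hm' n hn hn'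
    refine ⟨q, hq, by omega, (hβ q (by omega) _).2 ⟨hrk i hi4 p (by omega), ?_⟩, by omega,
      (hδ q (by omega) _).2 ⟨hrk i' hi4' r (by omega), ?_⟩⟩
    · intro p' h h' h''
      by_contra hlt
      have := h2 p' h h' (by omega)
      omega
    · intro p' h h' h''
      by_contra hlt
      have := h4 p' h h' (by omega)
      omega
  · intro H p hp hp' r hr hr'
    obtain ⟨q, hq, h1, h2, h3, h4⟩ := H p hp hp' r hr hr'
    refine ⟨q, hq, h1, ?_, h3, ?_⟩
    · have h5 := mt (((hβ q (by omega) _).1 h2).2 p hp hp') (lt_irrefl _)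
      have h6 := mt (hinj j hj4 q (by omega) p (by omega)) (by omega)
      omega
    · have h5 := mt (((hδ q (by omega) _).1 h4).2 r hr hr') (lt_irrefl _)
      have h6 := mt (hinj j' hj4' q (by omega) r (by omega)) (by omega)
      omega

end Dominance

/-! ### Distance two in the intersection graph -/

theorem intersectionGraph_adj {m : ℕ} {S : Fin m → Rect} {i j : Fin m} :
    (intersectionGraph S).Adj i j ↔ i ≠ j ∧ (S i).Intersects (S j) := by
  rw [intersectionGraph, SimpleGraph.fromRel_adj, Rect.intersects_comm (p := S j), or_self]

theorem edist_intersectionGraph_le_two {m : ℕ} {S : Fin m → Rect} {i j : Fin m} :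
    (intersectionGraph S).edist i j ≤ 2 ↔ ∃ l, (S l).Intersects (S i) ∧ (S l).Intersects (S j) := by
  constructor
  · intro h
    have hne : (intersectionGraph S).edist i j ≠ ⊤ := fun h' => by simp [h'] at h
    obtain ⟨p, hp⟩ := (intersectionGraph S).exists_walk_of_edist_ne_top hne
    rw [← hp] at h
    have hlen : p.length ≤ 2 := by exact_mod_cast h
    match p, hlen with
    | .nil, _ => exact ⟨i, (S i).intersects_self, (S i).intersects_self⟩
    | .cons h₁ .nil, _ =>
      exact ⟨i, (S i).intersects_self, (intersectionGraph_adj.1 h₁).2⟩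
    | .cons (v := v) h₁ (.cons h₂ .nil), _ =>
      exact ⟨v, Rect.intersects_comm.1 (intersectionGraph_adj.1 h₁).2,
          (intersectionGraph_adj.1 h₂).2⟩
    | .cons h₁ (.cons h₂ (.cons h₃ p)), h => simp at h
  · rintro ⟨l, h1, h2⟩
    have hle : ∀ k, (S l).Intersects (S k) → (intersectionGraph S).edist l k ≤ 1 := by
      intro k hk
      by_cases hlk : l = k
      · simp [hlk]
      · exact (SimpleGraph.edist_eq_one_iff_adj.2 (intersectionGraph_adj.2 ⟨hlk, hk⟩)).le
    calc (intersectionGraph S).edist i j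
        ≤ (intersectionGraph S).edist i l + (intersectionGraph S).edist l j :=
          SimpleGraph.edist_triangle
      _ ≤ 1 + 1 := add_le_add (by rw [SimpleGraph.edist_comm]; exact hle i h1) (hle j h2)
      _ = 2 := by norm_num

theorem ediam_intersectionGraph_le_two {m : ℕ} {S : Fin m → Rect} :
    (intersectionGraph S).ediam ≤ 2 ↔
      ∀ i j, ∃ l, (S l).Intersects (S i) ∧ (S l).Intersects (S j) := by
  simp only [SimpleGraph.ediam_le_iff, edist_intersectionGraph_le_two]

/-! ### Neighborhood balls of unbounded VC-dimension -/

/-- The degenerate rectangle `{(x, y)}`. -/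
def Rect.point (x y : ℝ) : Rect := ⟨x, x, y, y, le_rfl, le_rfl⟩

/-- Two classes of points, indexed by `Fin N` and `Fin d`, lie on antidiagonals in opposite
quadrants.  A rectangle that has a point of each class as opposite corners contains no further point
of the two classes.  Such a connecting rectangle is present for the pairs `(k, i)` in the relation
`A`, and it is a common neighbor of their points; for the other pairs, a copy of the point `k` stands
in its place. -/
noncomputable def connectorFamily {N d : ℕ} (A : Fin N → Fin d → Prop) :
    Fin N ⊕ Fin d ⊕ Fin N × Fin d → Rect
  | .inl k => .point (-k) (N - k)
  | .inr (.inl i) => .point i (-(d - i))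
  | .inr (.inr (k, i)) =>
    open Classical in
    if A k i then ⟨-k, i, -(d - i), N - k, by
        have : (0 : ℝ) ≤ (k : ℕ) := Nat.cast_nonneg _
        have : (0 : ℝ) ≤ (i : ℕ) := Nat.cast_nonneg _
        linarith, by
        have : ((k : ℕ) : ℝ) ≤ N := by exact_mod_cast k.2.le
        have : ((i : ℕ) : ℝ) ≤ d := by exact_mod_cast i.2.le
        linarith⟩
    else .point (-k) (N - k)

theorem connectorFamily_spec {N d : ℕ} (A : Fin N → Fin d → Prop) (k : Fin N) (i : Fin d) :
    (∃ l, (connectorFamily A l).Intersects (connectorFamily A (.inr (.inl i))) ∧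
      (connectorFamily A l).Intersects (connectorFamily A (.inl k))) ↔ A k i := by
  simp only [Rect.intersects_iff_key, forall_lt_four, Rect.lowerKey, Rect.upperKey]
  have hN : ∀ k : Fin N, (0 : ℝ) ≤ (k : ℕ) ∧ ((k : ℕ) : ℝ) < N := fun k =>
    ⟨Nat.cast_nonneg _, by exact_mod_cast k.2⟩
  have hd : ∀ i : Fin d, (0 : ℝ) ≤ (i : ℕ) ∧ ((i : ℕ) : ℝ) < d := fun i =>
    ⟨Nat.cast_nonneg _, by exact_mod_cast i.2⟩
  have hk := hN k
  have hi := hd i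
  constructor
  · rintro ⟨l, h1, h2⟩
    match l with
    | .inl k' =>
      have := hN k'
      simp only [connectorFamily, Rect.point] at h1
      linarith
    | .inr (.inl i') =>
      have := hd i'
      simp only [connectorFamily, Rect.point] at h2
      linarith
    | .inr (.inr (k', i')) =>
      have hk' := hN k'
      have hi' := hd i'
      by_cases hA : A k' i'
      · simp only [connectorFamily, if_pos hA, Rect.point] at h1 h2
        have e1 : k = k' := Fin.ext (by
          have : ((k : ℕ) : ℝ) = (k' : ℕ) := by linarith
          exact_mod_cast this)
        have e2 : i = i' := Fin.ext (by
          have : ((i : ℕ) : ℝ) = (i' : ℕ) := by linarith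
          exact_mod_cast this)
        rwa [e1, e2]
      · simp only [connectorFamily, if_neg hA, Rect.point] at h1
        linarith
  · intro hA
    refine ⟨.inr (.inr (k, i)), ?_⟩
    simp only [connectorFamily, if_pos hA, Rect.point]
    refine ⟨⟨?_, ?_, ?_, ?_⟩, ?_, ?_, ?_, ?_⟩ <;> linarith

theorem exists_le_vcDim_neighborhoodBalls (d : ℕ) :
    ∃ (m : ℕ) (S : Fin m → Rect), d ≤ (neighborhoodBalls (intersectionGraph S) 2).vcDim := by
  classical
  let N := Fintype.card (Finset (Fin d))
  let e : Finset (Fin d) ≃ Fin N := Fintype.equivFin _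
  let A : Fin N → Fin d → Prop := fun k i => i ∈ e.symm k
  let f := Fintype.equivFin (Fin N ⊕ Fin d ⊕ Fin N × Fin d)
  let u : Fin d ↪ Fin (Fintype.card (Fin N ⊕ Fin d ⊕ Fin N × Fin d)) :=
    ⟨fun i => f (.inr (.inl i)), fun i j h => by simpa using h⟩
  refine ⟨_, fun x => connectorFamily A (f.symm x), ?_⟩
  suffices h : (neighborhoodBalls (intersectionGraph fun x => connectorFamily A
      (f.symm x)) 2).Shatters
      (Finset.univ.map u) by simpa using h.card_le_vcDim
  intro t ht
  refine ⟨_, Finset.mem_image_of_mem _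
    (Finset.mem_univ (f (.inl (e (Finset.univ.filter fun i => u i ∈ t))))), ?_⟩
  have key : ∀ i, (intersectionGraph fun x => connectorFamily A (f.symm x)).edist (u i)
      (f (.inl (e (Finset.univ.filter fun i => u i ∈ t)))) ≤ 2 ↔ u i ∈ t := by
    intro i
    rw [edist_intersectionGraph_le_two]
    have := connectorFamily_spec A (e (Finset.univ.filter fun i => u i ∈ t)) i
    have hA : A (e (Finset.univ.filter fun i => u i ∈ t)) i ↔ u i ∈ t := by simp [A]
    have hu : f.symm (u i) = .inr (.inl i) := f.symm_apply_apply _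
    rw [← hA, ← this, hu, Equiv.symm_apply_apply]
    constructor
    · rintro ⟨l, h1, h2⟩
      exact ⟨f.symm l, h1, h2⟩
    · rintro ⟨l, h1, h2⟩
      exact ⟨f l, by rwa [Equiv.symm_apply_apply], by rwa [Equiv.symm_apply_apply]⟩
  ext x
  simp only [Finset.mem_inter, Finset.mem_map, Finset.mem_univ, true_and, Finset.mem_filter]
  constructor
  · rintro ⟨⟨i, rfl⟩, h⟩
    exact (key i).1 (by simpa using h)
  · intro hx
    obtain ⟨i, -, rfl⟩ := Finset.mem_map.1 (ht hx)
    exact ⟨⟨i, rfl⟩, by simpa using (key i).2 hx⟩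

namespace RealRAM

/-! ### Ranked elements in memory -/

/-- The numerical data on which the two tests of the algorithm work.  There are `M` elements, of
which those below `b` are lower ones, and two intervals `[lo, hi)` and `[lo', hi')` of upper ones;
`rk j e` is the rank of `e` in coordinate `j`, and `ord j` is the inverse of `rk j`.  The ranks are
divided into `g` blocks of length `B`.  All numbers that occur are below `2 ^ w`. -/
structure Ranking (w : ℕ) where
  M : ℕ
  b : ℕ
  g : ℕ
  B : ℕ
  lo : ℕ
  hi : ℕ
  lo' : ℕ
  hi' : ℕ
  rk : ℕ → ℕ → ℕ
  ord : ℕ → ℕ → ℕ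
  B_pos : 0 < B
  g_pos : 0 < g
  sq_le : g * g ≤ B
  M_le : M ≤ g * B
  word : 8 * (g * B) + 64 ≤ 2 ^ w
  b_le : b ≤ lo
  b_le' : b ≤ lo'
  lo_le : lo ≤ hi
  lo_le' : lo' ≤ hi'
  hi_le : hi ≤ M
  hi_le' : hi' ≤ M
  rk_lt : ∀ j < 4, ∀ e < M, rk j e < M
  ord_lt : ∀ j < 4, ∀ t < M, ord j t < M
  ord_rk : ∀ j < 4, ∀ e < M, ord j (rk j e) = e
  rk_ord : ∀ j < 4, ∀ t < M, rk j (ord j t) = t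

/-- The program changes neither the registers below `20` nor the word arrays below `8`. -/
def Prog.Local : Prog → Prop
  | .skip => True
  | .nset x _ => 20 ≤ x
  | .rset _ _ => True
  | .nstore a _ _ => 8 ≤ a
  | .rstore _ _ _ => True
  | .seq p q => p.Local ∧ q.Local
  | .ite _ p q => p.Local ∧ q.Local
  | .loop _ p => p.Local

theorem Prog.Local.reg {p : Prog} (h : p.Local) {x : ℕ} (hx : x < 20) : ¬ p.WritesReg x := by
  induction p with
  | nset y e =>
    simp only [Prog.Local, Prog.WritesReg] at *
    omega
  | seq p q hp hq | ite b p q hp hq => exact not_or.2 ⟨hp h.1, hq h.2⟩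
  | loop b p hp => exact hp h
  | _ => exact id

theorem Prog.Local.arr {p : Prog} (h : p.Local) {x : ℕ} (hx : x < 8) : ¬ p.WritesArr x := by
  induction p with
  | nstore a i e =>
    simp only [Prog.Local, Prog.WritesArr] at *
    omega
  | seq p q hp hq | ite b p q hp hq => exact not_or.2 ⟨hp h.1, hq h.2⟩
  | loop b p hp => exact hp h
  | _ => exact id

namespace Ranking

/-- The ranking `D` is stored in the memory: `rk j` in word array `j`, `ord j` in word array
`4 + j`, and the numbers in registers below `20`. -/
structure Stored {w : ℕ} (D : Ranking w) (s : State) : Prop where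
  reg_b : s.nreg 1 = D.b
  reg_M : s.nreg 5 = D.M
  reg_g : s.nreg 6 = D.g
  reg_B : s.nreg 7 = D.B
  reg_lo : s.nreg 12 = D.lo
  reg_hi : s.nreg 13 = D.hi
  reg_lo' : s.nreg 14 = D.lo'
  reg_hi' : s.nreg 15 = D.hi'
  arr_rk : ∀ j < 4, s.narr j = D.rk j
  arr_ord : ∀ j < 4, s.narr (4 + j) = D.ord j

variable {w : ℕ} {D : Ranking w}

theorem Stored.of_same {s s' : State} (h : D.Stored s) {p : Prog} (hS : Same p s s')
    (hp : p.Local) : D.Stored s' where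
  reg_b := (hS.reg _ (hp.reg (by norm_num))).trans h.reg_b
  reg_M := (hS.reg _ (hp.reg (by norm_num))).trans h.reg_M
  reg_g := (hS.reg _ (hp.reg (by norm_num))).trans h.reg_g
  reg_B := (hS.reg _ (hp.reg (by norm_num))).trans h.reg_B
  reg_lo := (hS.reg _ (hp.reg (by norm_num))).trans h.reg_lo
  reg_hi := (hS.reg _ (hp.reg (by norm_num))).trans h.reg_hi
  reg_lo' := (hS.reg _ (hp.reg (by norm_num))).trans h.reg_lo'
  reg_hi' := (hS.reg _ (hp.reg (by norm_num))).trans h.reg_hi'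
  arr_rk j hj := (hS.arr _ (hp.arr (by omega))).trans (h.arr_rk j hj)
  arr_ord j hj := (hS.arr _ (hp.arr (by omega))).trans (h.arr_ord j hj)

theorem Stored.setReg {s : State} (h : D.Stored s) {x : ℕ} (hx : 20 ≤ x) (v : ℕ) :
    D.Stored (s.setReg x v) :=
  h.of_same (p := .nset x (.const 0))
    ⟨fun _ hy => Function.update_of_ne hy _ _, fun _ _ => rfl, fun _ _ => rfl⟩ hx

theorem Stored.store {s : State} (h : D.Stored s) {a : ℕ} (ha : 8 ≤ a) (i v : ℕ) :
    D.Stored (s.store a i v) :=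
  h.of_same (p := .nstore a (.const 0) (.const 0))
    ⟨fun _ _ => rfl, fun _ hy => Function.update_of_ne hy _ _, fun _ _ => rfl⟩ ha

theorem rk_inj (D : Ranking w) {j e f : ℕ} (hj : j < 4) (he : e < D.M) (hf : f < D.M)
    (h : D.rk j e = D.rk j f) : e = f := by
  rw [← D.ord_rk j hj e he, h, D.ord_rk j hj f hf]

theorem b_le_M (D : Ranking w) : D.b ≤ D.M := D.b_le.trans (D.lo_le.trans D.hi_le)

theorem B_le (D : Ranking w) : D.B ≤ D.g * D.B := Nat.le_mul_of_pos_left _ D.g_pos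

theorem g_le (D : Ranking w) : D.g ≤ D.g * D.B := Nat.le_mul_of_pos_right _ D.B_pos

theorem mul_B_le (D : Ranking w) {k : ℕ} (hk : k ≤ D.g) : k * D.B ≤ D.g * D.B :=
  Nat.mul_le_mul_right _ hk

theorem div_B_lt (D : Ranking w) {x : ℕ} (hx : x < D.M) : x / D.B < D.g :=
  Nat.div_lt_of_lt_mul (by rw [mul_comm]; exact hx.trans_le D.M_le)

theorem div_B_mul_le (D : Ranking w) (x : ℕ) : x / D.B * D.B ≤ x := Nat.div_mul_le_self _ _

theorem lt_div_B_mul (D : Ranking w) (x : ℕ) : x < x / D.B * D.B + D.B := by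
  have := Nat.lt_div_mul_add D.B_pos (a := x)
  omega

theorem div_B_eq_iff (D : Ranking w) {x k : ℕ} :
    x / D.B = k ↔ k * D.B ≤ x ∧ x < k * D.B + D.B := by
  rw [Nat.div_eq_iff D.B_pos]
  have := D.B_pos
  omega

theorem lt_mul_B_iff (D : Ranking w) {x k : ℕ} : x < k * D.B ↔ x / D.B < k :=
  (Nat.div_lt_iff_lt_mul D.B_pos).symm

end Ranking

/-! ### The test for the mixtures with at least three coordinates from one rectangle -/

/-- Register `21` receives the least rank in coordinate `i` of an element of `[lo', hi')`. -/
def leastRank (i : ℕ) : Prog :=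
  .seq (.nset 21 (.reg 5)) (.for 22 (.reg 14) (.reg 15)
    (.ite (.nlt (.get i (.reg 22)) (.reg 21)) (.nset 21 (.get i (.reg 22))) .skip))

/-- The element in register `24` is a lower one, its rank in coordinate `i` is less than register
`21`, and it is below the element in register `22` in all coordinates. -/
def witnessTest (i : ℕ) : BExpr :=
  .and (.nlt (.reg 24) (.reg 1)) (.and (.nlt (.get i (.reg 24)) (.reg 21))
    (.and (.nlt (.get 0 (.reg 24)) (.get 0 (.reg 22)))
    (.and (.nlt (.get 1 (.reg 24)) (.get 1 (.reg 22)))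
    (.and (.nlt (.get 2 (.reg 24)) (.get 2 (.reg 22)))
    (.nlt (.get 3 (.reg 24)) (.get 3 (.reg 22)))))))

/-- The cell of array `9` of the element in register `22` is set to `1` if there is a witness in the
same block of coordinate `c`. -/
def scanBlock (i c : ℕ) : Prog :=
  .for 23 (.mul (.div (.get c (.reg 22)) (.reg 7)) (.reg 7)) (.get c (.reg 22))
    (.seq (.nset 24 (.get (4 + c) (.reg 23)))
      (.ite (witnessTest i) (.nstore 9 (.reg 22) (.const 1)) .skip))

section Dom
variable {w : ℕ} {D : Ranking w} {i c : ℕ} {s : State}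

namespace Ranking

/-- The lower element `q` is below `p` in all coordinates, and below `ρ` in coordinate `i`. -/
def Witness (D : Ranking w) (i ρ p q : ℕ) : Prop :=
  q < D.b ∧ D.rk i q < ρ ∧ ∀ j < 4, D.rk j q < D.rk j p

end Ranking

theorem holds_witnessTest (hs : D.Stored s) (hi4 : i < 4) {ρ p q : ℕ}
    (h21 : s.nreg 21 = ρ) (h22 : s.nreg 22 = p) (h24 : s.nreg 24 = q) :
    (witnessTest i).Holds w s ↔ D.Witness i ρ p q := by
  simp only [witnessTest, BExpr.Holds, NExpr.eval, Ranking.Witness, forall_lt_four, h21, h22, h24,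
    hs.reg_b, hs.arr_rk i hi4, hs.arr_rk 0 (by norm_num), hs.arr_rk 1 (by norm_num),
    hs.arr_rk 2 (by norm_num), hs.arr_rk 3 (by norm_num)]

/-- The minimum is described by the numbers below it; over an empty interval it is `M`. -/
theorem runs_leastRank (hs : D.Stored s) (hi4 : i < 4) :
    Runs w (leastRank i) s (40 * D.M + 20) fun s' =>
      ∀ x, x < s'.nreg 21 ↔ x < D.M ∧ ∀ r, D.lo' ≤ r → r < D.hi' → x < D.rk i r := by
  have hW := D.word
  have hM := D.M_le
  refine Runs.seq (T₁ := 2) (R := fun s' => s'.nreg 21 = D.M)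
    (Runs.of_loopFree trivial (by simp [Prog.run, NExpr.eval, hs.reg_M]) le_rfl) ?_
    (T₂ := 40 * D.M + 18) (by omega)
  intro s₁ hS h21
  have hs1 := hs.of_same hS (by simp [Prog.Local])
  refine Runs.for_const (l := D.lo') (N := D.hi') (T := 12)
      (fun k s' => ∀ x, x < s'.nreg 21 ↔ x < D.M ∧
      ∀ r, D.lo' ≤ r → r < k → x < D.rk i r) hs1.reg_lo' D.lo_le' (by have := D.hi_le'; omega)
    (by simp [Prog.WritesReg])
    (fun s' hS => (hs1.of_same hS (by simp [Prog.Local, Prog.for])).reg_hi') ?_ ?_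
    (fun s' _ h => h) ?_
  · intro x
    simp [h21]
    omega
  · intro k hk hk' s' hS' h22 hI
    have hs' := hs1.of_same hS' (by simp [Prog.Local, Prog.for])
    refine Runs.of_loopFree (by simp [Prog.LoopFree]) ?_
        (by simp [Prog.time, NExpr.cost, BExpr.cost])
    intro x
    have : (∀ r, D.lo' ≤ r → r < k + 1 → x < D.rk i r) ↔
        (∀ r, D.lo' ≤ r → r < k → x < D.rk i r) ∧ x < D.rk i k := by
      constructor
      · intro h
        exact ⟨fun r h1 h2 => h r h1 (by omega), h k hk (by omega)⟩
      · rintro ⟨h, h'⟩ r h1 h2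
        obtain h3 | rfl : r < k ∨ r = k := by omega
        exacts [h r h1 h3, h']
    rw [this, ← and_assoc, ← hI]
    simp only [Prog.run, BExpr.Holds, NExpr.eval, h22, hs'.arr_rk i hi4]
    split_ifs with h
    · simp
      omega
    · simp
      omega
  · have := D.hi_le'
    simp only [NExpr.cost]
    omega

theorem runs_scanBlock (hs : D.Stored s) (hi4 : i < 4) (hc : c < 4) {p ρ : ℕ}
    (hp' : p < D.hi) (h21 : s.nreg 21 = ρ) (h22 : s.nreg 22 = p) :
    Runs w (scanBlock i c) s (80 * D.B + 20) fun s' =>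
      (∀ x, x ≠ p → s'.narr 9 x = s.narr 9 x) ∧
      (s'.narr 9 p ≠ 0 ↔ s.narr 9 p ≠ 0 ∨
        ∃ q, D.Witness i ρ p q ∧ D.rk c q / D.B = D.rk c p / D.B) := by
  have hW := D.word
  have hM := D.M_le
  have hpM : p < D.M := hp'.trans_le D.hi_le
  have hrk := D.rk_lt c hc p hpM
  have hle := D.div_B_mul_le (D.rk c p)
  have hlt := D.lt_div_B_mul (D.rk c p)
  have h1W : 1 % 2 ^ w = 1 := Nat.mod_eq_of_lt (by omega)
  refine Runs.for_const (l := D.rk c p / D.B * D.B) (N := D.rk c p) (T := 40) (fun k s' =>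
      (∀ x, x ≠ p → s'.narr 9 x = s.narr 9 x) ∧
      (s'.narr 9 p ≠ 0 ↔ s.narr 9 p ≠ 0 ∨
        ∃ q, D.Witness i ρ p q ∧ D.rk c p / D.B * D.B ≤ D.rk c q ∧ D.rk c q < k)) ?_ hle (by omega)
    (by simp [Prog.WritesReg]) ?_ ?_ ?_ ?_ ?_
  · simp only [NExpr.eval, h22, hs.arr_rk c hc, hs.reg_B]
    exact Nat.mod_eq_of_lt (by omega)
  · intro s' hS
    have hs' := hs.of_same hS (by simp [Prog.Local, Prog.for])
    simp only [NExpr.eval, hs'.arr_rk c hc, hS.reg 22 (by simp [Prog.WritesReg, Prog.for]), h22]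
  · refine ⟨fun x _ => rfl, ?_⟩
    simp only [State.setReg_narr]
    constructor
    · exact Or.inl
    · rintro (h | ⟨q, -, h1, h2⟩)
      · exact h
      · omega
  · intro k hk hk' s' hS h23 ⟨hI1, hI2⟩
    have hs' := hs.of_same hS (by simp [Prog.Local, Prog.for])
    have h21' := (hS.reg 21 (by simp [Prog.WritesReg, Prog.for])).trans h21
    have h22' := (hS.reg 22 (by simp [Prog.WritesReg, Prog.for])).trans h22
    refine Runs.nset_seq (v := D.ord c k) (by simp [NExpr.eval, hs'.arr_ord c hc, h23])
      (by simp [NExpr.cost]) ?_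
    have htest := holds_witnessTest (hs'.setReg (x := 24) (by norm_num) (D.ord c k)) hi4 (ρ := ρ)
      (p := p) (q := D.ord c k) (by simp [h21']) (by simp [h22']) (by simp)
    have hstep : (∃ q, D.Witness i ρ p q ∧ D.rk c p / D.B * D.B ≤ D.rk c q ∧ D.rk c q < k + 1) ↔
        (∃ q, D.Witness i ρ p q ∧ D.rk c p / D.B * D.B ≤ D.rk c q ∧ D.rk c q < k) ∨
          D.Witness i ρ p (D.ord c k) := by
      have hrko := D.rk_ord c hc k (by omega)
      constructor
      · rintro ⟨q, h1, h2, h3⟩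
        obtain h4 | h4 : D.rk c q < k ∨ D.rk c q = k := by omega
        · exact .inl ⟨q, h1, h2, h4⟩
        · rw [← h4, D.ord_rk c hc q (h1.1.trans_le D.b_le_M)]
          exact .inr h1
      · rintro (⟨q, h1, h2, h3⟩ | h1)
        · exact ⟨q, h1, h2, by omega⟩
        · exact ⟨_, h1, by omega, by omega⟩
    rw [hstep, ← or_assoc, ← hI2]
    refine Runs.cond (by simp [BExpr.cost, NExpr.cost, witnessTest]) (fun h => ?_) fun h => ?_
    · rw [htest] at h
      refine Runs.nstore (k := p) (v := 1) (by simp [NExpr.eval, h22']) h1W ?_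
        (by simp [BExpr.cost, NExpr.cost, witnessTest])
      refine ⟨fun x hx => ?_, by simp [h]⟩
      simp [hx, hI1 x hx]
    · rw [htest] at h
      refine Runs.skip ?_ (by simp [BExpr.cost, NExpr.cost, witnessTest])
      simp only [State.setReg_narr, h, or_false]
      exact ⟨hI1, trivial⟩
  · rintro s' hS ⟨h1, h2⟩
    refine ⟨h1, h2.trans (or_congr_right ?_)⟩
    constructor
    · rintro ⟨q, h3, h4, h5⟩
      exact ⟨q, h3, D.div_B_eq_iff.2 ⟨h4, by omega⟩⟩
    · rintro ⟨q, h3, h4⟩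
      exact ⟨q, h3, (D.div_B_eq_iff.1 h4).1, h3.2.2 c hc⟩
  · simp only [NExpr.cost]
    omega

end Dom

namespace Ranking

/-- The unit in which running times are measured. -/
def cost {w : ℕ} (D : Ranking w) : ℕ := D.g * D.B * D.B

variable {w : ℕ} (D : Ranking w)

theorem M_mul_B_le : D.M * D.B ≤ D.cost := Nat.mul_le_mul_right _ D.M_le

theorem g_mul_B_le : D.g * D.B ≤ D.cost := Nat.le_mul_of_pos_right _ D.B_pos

theorem M_mul_sq_le : D.M * (D.g * D.g) ≤ D.cost :=
  (Nat.mul_le_mul_left _ D.sq_le).trans D.M_mul_B_le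

theorem M_le_cost : D.M ≤ D.cost := D.M_le.trans D.g_mul_B_le

theorem B_le_cost : D.B ≤ D.cost := D.B_le.trans D.g_mul_B_le

theorem cost_pos : 0 < D.cost := D.B_pos.trans_le D.B_le_cost

theorem g_mul_g_le_cost : D.g * D.g ≤ D.cost := D.sq_le.trans D.B_le_cost

end Ranking

/-- For the interval `[lo, hi)`, each cell of array `9` tells whether there is a witness in the same
block of coordinate `2` or in the same block of coordinate `3`. -/
def scanBlocks (i : ℕ) : Prog :=
  .for 22 (.reg 12) (.reg 13) (.seq (.nstore 9 (.reg 22) (.const 0))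
    (.seq (scanBlock i 2) (scanBlock i 3)))

/-- The element in register `24` has rank below register `21` in coordinate `i`, it lies in smaller
blocks than those numbered by registers `25` and `26` in the coordinates `2` and `3`, and its rank
in coordinate `1` is smaller than register `27`. -/
def updateTest (i : ℕ) : BExpr :=
  .and (.nlt (.get i (.reg 24)) (.reg 21))
    (.and (.nlt (.get 2 (.reg 24)) (.mul (.reg 25) (.reg 7)))
    (.and (.nlt (.get 3 (.reg 24)) (.mul (.reg 26) (.reg 7)))
    (.nlt (.get 1 (.reg 24)) (.reg 27))))

/-- The element in register `24` belongs to `[lo, hi)`, it lies in the blocks numbered by registers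
`25` and `26` in the coordinates `2` and `3`, and its rank in coordinate `1` exceeds register
`27`. -/
def queryTest : BExpr :=
  .and (.not (.nlt (.reg 24) (.reg 12))) (.and (.nlt (.reg 24) (.reg 13))
    (.and (.neq (.div (.get 2 (.reg 24)) (.reg 7)) (.reg 25))
    (.and (.neq (.div (.get 3 (.reg 24)) (.reg 7)) (.reg 26))
    (.nlt (.reg 27) (.get 1 (.reg 24))))))

/-- One sweep in coordinate `0`, which finds the witnesses in smaller blocks for the elements of the
blocks numbered by registers `25` and `26` in the coordinates `2` and `3`. -/
def sweepCell (i : ℕ) : Prog :=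
  .seq (.nset 27 (.reg 5)) (.for 22 (.const 0) (.reg 5)
    (.seq (.nset 24 (.get 4 (.reg 22)))
      (.ite (.nlt (.reg 24) (.reg 1))
        (.ite (updateTest i) (.nset 27 (.get 1 (.reg 24))) .skip)
        (.ite queryTest (.nstore 9 (.reg 24) (.const 1)) .skip))))

/-- The sweeps for all pairs of blocks. -/
def sweepCells (i : ℕ) : Prog :=
  .for 25 (.const 0) (.reg 6) (.for 26 (.const 0) (.reg 6) (sweepCell i))

/-- Register `20` is cleared if a cell of array `9` in the interval `[lo, hi)` is `0`. -/
def conclude : Prog :=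
  .for 22 (.reg 12) (.reg 13)
    (.ite (.neq (.get 9 (.reg 22)) (.const 0)) (.nset 20 (.const 0)) .skip)

/-- The test of `DomCond`. -/
def domTest (i : ℕ) : Prog :=
  .seq (leastRank i) (.seq (scanBlocks i) (.seq (sweepCells i) conclude))

/-- The outcome of a test of `A`: register `20` is left as it is if `A` is true, and cleared
otherwise. -/
def Verdict (A : Prop) (s s' : State) : Prop :=
  (A → s'.nreg 20 = s.nreg 20) ∧ (¬ A → s'.nreg 20 = 0)

section Dom
variable {w : ℕ} {D : Ranking w} {i : ℕ} {s : State} {ρ : ℕ}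

/-- Every element is compared with the at most `2 * B` elements in its blocks, which takes time of
order `M * B`. -/
theorem runs_scanBlocks (hs : D.Stored s) (hi4 : i < 4) (h21 : s.nreg 21 = ρ) :
    Runs w (scanBlocks i) s (300 * D.cost) fun s' =>
      ∀ p, D.lo ≤ p → p < D.hi → (s'.narr 9 p ≠ 0 ↔ ∃ q, D.Witness i ρ p q ∧
        (D.rk 2 q / D.B = D.rk 2 p / D.B ∨ D.rk 3 q / D.B = D.rk 3 p / D.B)) := by
  have hW := D.word
  have hM := D.M_le
  have hhi := D.hi_le
  refine Runs.for_const (l := D.lo) (N := D.hi) (T := 160 * D.B + 43)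
      (fun k s' => ∀ p, D.lo ≤ p → p < k →
      (s'.narr 9 p ≠ 0 ↔ ∃ q, D.Witness i ρ p q ∧
        (D.rk 2 q / D.B = D.rk 2 p / D.B ∨ D.rk 3 q / D.B = D.rk 3 p / D.B)))
    hs.reg_lo D.lo_le (by omega)
    (by simp [Prog.WritesReg, scanBlock, Prog.for])
    (fun s' hS => (hs.of_same hS (by simp [Prog.Local, Prog.for, scanBlock])).reg_hi) (by omega) ?_
    (fun _ _ h => h) ?_
  · intro k hk hk' s' hS h22 hI
    have hs' := hs.of_same hS (by simp [Prog.Local, Prog.for, scanBlock])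
    have h21' : s'.nreg 21 = ρ :=
      (hS.reg 21 (by simp [Prog.WritesReg, Prog.for, scanBlock])).trans h21
    refine Runs.nstore_seq (k := k) (v := 0) (by simp [NExpr.eval, h22]) (by simp [NExpr.eval])
      (by simp [NExpr.cost]) ?_
    refine Runs.seq (runs_scanBlock (p := k) (hs'.store (by norm_num) k 0) hi4 (by norm_num : 2 < 4)
      hk' h21' h22) (T₂ := 80 * D.B + 20) ?_
      (by simp only [NExpr.cost]; omega)
    intro s₁ hS₁ ⟨h1, h2⟩
    have hs₁ := (hs'.store (a := 9) (by norm_num) k 0).of_same hS₁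
      (by simp [Prog.Local, Prog.for, scanBlock])
    refine (runs_scanBlock (p := k) (ρ := ρ) hs₁ hi4 (by norm_num : 3 < 4) hk' ?_ ?_).mono le_rfl ?_
    · exact (hS₁.reg 21 (by simp [Prog.WritesReg, Prog.for, scanBlock])).trans h21'
    · exact (hS₁.reg 22 (by simp [Prog.WritesReg, Prog.for, scanBlock])).trans h22
    · rintro s₂ - ⟨h3, h4⟩ p hp hp'
      simp only [State.setReg_narr]
      by_cases hpk : p = k
      · subst hpk
        rw [h4, h2]
        simp [and_or_left, exists_or]
      · rw [h3 p hpk, h1 p hpk]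
        simpa [hpk] using hI p hp (by omega)
  · have h1 : (D.hi - D.lo) * (160 * D.B + 43 + 1 + 7) ≤ D.M * (211 * D.B) :=
      Nat.mul_le_mul (by omega) (by have := D.B_pos; omega)
    have h2 := D.M_mul_B_le
    have h3 := D.cost_pos
    simp only [NExpr.cost]
    nlinarith

/-- For an element `p` of the given pair of blocks, smaller blocks mean smaller ranks in the
coordinates `2` and `3`, and the sweep reaches exactly the elements of smaller rank in coordinate
`0` before `p`.  So `p` has a witness in smaller blocks if and only if its rank in coordinate `1`
exceeds the least such rank among the suitable lower elements met so far, which register `27`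
maintains. -/
theorem runs_sweepCell (hs : D.Stored s) (hi4 : i < 4) (h21 : s.nreg 21 = ρ) {J J' : ℕ}
    (h25 : s.nreg 25 = J) (h26 : s.nreg 26 = J') (hJ : J < D.g) (hJ' : J' < D.g) :
    Runs w (sweepCell i) s (50 * D.M + 20) fun s' =>
      ∀ p, D.lo ≤ p → p < D.hi → (s'.narr 9 p ≠ 0 ↔ s.narr 9 p ≠ 0 ∨
        D.rk 2 p / D.B = J ∧ D.rk 3 p / D.B = J' ∧
          ∃ q, D.Witness i ρ p q ∧ D.rk 2 q / D.B < J ∧ D.rk 3 q / D.B < J') := by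
  have hW := D.word
  have hM := D.M_le
  have hhi := D.hi_le
  have hb := D.b_le
  have hbM := D.b_le_M
  have hJB := D.mul_B_le hJ.le
  have hJB' := D.mul_B_le hJ'.le
  have h1W : 1 % 2 ^ w = 1 := Nat.mod_eq_of_lt (by omega)
  have hr0 := hs.arr_rk 0 (by norm_num)
  refine Runs.nset_seq (v := D.M) hs.reg_M (by simp [NExpr.cost]) ?_
  have hs₀ := hs.setReg (x := 27) (by norm_num) D.M
  refine Runs.for_const (l := 0) (N := D.M) (T := 42) (fun k s' =>
      (∀ z, s'.nreg 27 < z ↔ D.M < z ∨ ∃ q < D.b, (D.rk i q < ρ ∧ D.rk 2 q / D.B < J ∧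
        D.rk 3 q / D.B < J') ∧ D.rk 0 q < k ∧ D.rk 1 q < z) ∧
      ∀ p, D.lo ≤ p → p < D.hi → (s'.narr 9 p ≠ 0 ↔ s.narr 9 p ≠ 0 ∨ D.rk 0 p < k ∧
        D.rk 2 p / D.B = J ∧ D.rk 3 p / D.B = J' ∧
          ∃ q, D.Witness i ρ p q ∧ D.rk 2 q / D.B < J ∧ D.rk 3 q / D.B < J'))
    (by simp [NExpr.eval]) (Nat.zero_le _) (by omega) (by simp [Prog.WritesReg])
    (fun s' hS => (hs₀.of_same hS (by simp [Prog.Local, Prog.for])).reg_M) (by simp) ?_ ?_ ?_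
  · rintro k - hk s' hS h22 ⟨hI1, hI2⟩
    have hs' := hs₀.of_same hS (by simp [Prog.Local, Prog.for])
    have h21' : s'.nreg 21 = ρ := (hS.reg 21 (by simp [Prog.WritesReg, Prog.for])).trans h21
    have h25' : s'.nreg 25 = J := (hS.reg 25 (by simp [Prog.WritesReg, Prog.for])).trans h25
    have h26' : s'.nreg 26 = J' := (hS.reg 26 (by simp [Prog.WritesReg, Prog.for])).trans h26
    have ho := hs'.arr_ord 0 (by norm_num)
    have hrko := D.rk_ord 0 (by norm_num) k hk
    have heM := D.ord_lt 0 (by norm_num) k hk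
    refine Runs.nset_seq (v := D.ord 0 k) (by simp only [NExpr.eval, h22, ← ho])
      (by simp [NExpr.cost]) ?_
    generalize hs₁ : s'.setReg 24 (D.ord 0 k) = s₁
    have hst : D.Stored s₁ := hs₁ ▸ hs'.setReg (by norm_num) _
    have e24 : s₁.nreg 24 = D.ord 0 k := by simp [← hs₁]
    have e21 : s₁.nreg 21 = ρ := by simp [← hs₁, h21']
    have e25 : s₁.nreg 25 = J := by simp [← hs₁, h25']
    have e26 : s₁.nreg 26 = J' := by simp [← hs₁, h26']
    have e27 : s₁.nreg 27 = s'.nreg 27 := by simp [← hs₁]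
    have e9 : s₁.narr 9 = s'.narr 9 := by simp [← hs₁]
    rw [← e27] at hI1
    rw [← e9] at hI2
    generalize hee : D.ord 0 k = e at *
    have hne : ∀ x, x < D.M → x ≠ e → (D.rk 0 x < k + 1 ↔ D.rk 0 x < k) := by
      intro x hx hxe
      have := mt (D.rk_inj (by norm_num : 0 < 4) hx heM) hxe
      omega
    have hr1 := hst.arr_rk 1 (by norm_num)
    have hr2 := hst.arr_rk 2 (by norm_num)
    have hr3 := hst.arr_rk 3 (by norm_num)
    refine Runs.cond (by simp [BExpr.cost, NExpr.cost]) (fun h => ?_) fun h => ?_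
    · have heb : e < D.b := by simpa [BExpr.Holds, NExpr.eval, e24, hst.reg_b] using h
      have hup : ∀ p, D.lo ≤ p → p < D.hi → (D.rk 0 p < k + 1 ↔ D.rk 0 p < k) :=
        fun p hp hp' => hne p (by omega) (by omega)
      have htest : (updateTest i).Holds w s₁ ↔
          (D.rk i e < ρ ∧ D.rk 2 e / D.B < J ∧ D.rk 3 e / D.B < J') ∧ D.rk 1 e < s₁.nreg 27 := by
        simp only [updateTest, BExpr.Holds, NExpr.eval, e24, hst.arr_rk i hi4, e21, hr2, e25, hr3,
          e26, hr1, hst.reg_B, Nat.mod_eq_of_lt (show J * D.B < 2 ^ w by omega),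
          Nat.mod_eq_of_lt (show J' * D.B < 2 ^ w by omega), D.lt_mul_B_iff, and_assoc]
      have hsplit : ∀ z, (∃ q < D.b, (D.rk i q < ρ ∧ D.rk 2 q / D.B < J ∧
          D.rk 3 q / D.B < J') ∧ D.rk 0 q < k + 1 ∧ D.rk 1 q < z) ↔
          (∃ q < D.b, (D.rk i q < ρ ∧ D.rk 2 q / D.B < J ∧
          D.rk 3 q / D.B < J') ∧ D.rk 0 q < k ∧ D.rk 1 q < z) ∨
          (D.rk i e < ρ ∧ D.rk 2 e / D.B < J ∧ D.rk 3 e / D.B < J') ∧ D.rk 1 e < z := by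
        intro z
        constructor
        · rintro ⟨q, hq, h1, h2, h3⟩
          by_cases hqe : q = e
          · exact .inr (hqe ▸ ⟨h1, h3⟩)
          · exact .inl ⟨q, hq, h1, (hne q (by omega) hqe).1 h2, h3⟩
        · rintro (⟨q, hq, h1, h2, h3⟩ | ⟨h1, h2⟩)
          · exact ⟨q, hq, h1, by omega, h3⟩
          · exact ⟨e, heb, h1, by omega, h2⟩
      refine Runs.cond (by simp [BExpr.cost, NExpr.cost, updateTest]) (fun h => ?_) fun h => ?_
      · rw [htest] at h
        refine Runs.nset (v := D.rk 1 e) (by simp [NExpr.eval, e24, hr1]) ?_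
          (by simp [BExpr.cost, NExpr.cost, updateTest])
        refine ⟨fun z => ?_, fun p hp hp' => ?_⟩
        · rw [hsplit, ← or_assoc, ← hI1]
          simp only [State.setReg_nreg]
          simp [h.1]
          omega
        · rw [hup p hp hp', ← hI2 p hp hp']
          simp
      · rw [htest] at h
        refine Runs.skip ?_ (by simp [BExpr.cost, NExpr.cost, updateTest])
        refine ⟨fun z => ?_, fun p hp hp' => ?_⟩
        · rw [hsplit, ← or_assoc, ← hI1]
          simp only [State.setReg_nreg]
          constructor
          · exact .inl
          · rintro (h1 | ⟨h1, h2⟩)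
            · exact h1
            · have := mt (fun h' => (⟨h1, h'⟩ : _ ∧ _)) h
              simp
              omega
        · rw [hup p hp hp', ← hI2 p hp hp']
          simp
    · have heb : ¬ e < D.b := by simpa [BExpr.Holds, NExpr.eval, e24, hst.reg_b] using h
      have hlow : ∀ q < D.b, (D.rk 0 q < k + 1 ↔ D.rk 0 q < k) :=
        fun q hq => hne q (by omega) (by omega)
      have hcongr : ∀ z, (∃ q < D.b, (D.rk i q < ρ ∧ D.rk 2 q / D.B < J ∧
          D.rk 3 q / D.B < J') ∧ D.rk 0 q < k + 1 ∧ D.rk 1 q < z) ↔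
          ∃ q < D.b, (D.rk i q < ρ ∧ D.rk 2 q / D.B < J ∧
          D.rk 3 q / D.B < J') ∧ D.rk 0 q < k ∧ D.rk 1 q < z := by
        intro z
        refine exists_congr fun q => and_congr_right fun hq => ?_
        rw [hlow q hq]
      have htest : queryTest.Holds w s₁ ↔ (D.lo ≤ e ∧ e < D.hi) ∧
          (D.rk 2 e / D.B = J ∧ D.rk 3 e / D.B = J') ∧ s₁.nreg 27 < D.rk 1 e := by
        simp only [queryTest, BExpr.Holds, NExpr.eval, e24, hr2, e25, hr3, e26, hr1, hst.reg_B,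
          hst.reg_lo, hst.reg_hi, not_lt, and_assoc]
      -- the running minimum decides whether there is a witness in smaller blocks
      have hwit : e < D.hi → D.rk 2 e / D.B = J → D.rk 3 e / D.B = J' →
          (s₁.nreg 27 < D.rk 1 e ↔
            ∃ q, D.Witness i ρ e q ∧ D.rk 2 q / D.B < J ∧ D.rk 3 q / D.B < J') := by
        intro _ h2 h3
        rw [hI1]
        have := D.rk_lt 1 (by norm_num) e heM
        constructor
        · rintro (h4 | ⟨q, hq, ⟨h4, h5, h6⟩, h7, h8⟩)
          · omega
          · refine ⟨q, ⟨hq, h4, forall_lt_four.2 ⟨by omega, h8, ?_, ?_⟩⟩, h5, h6⟩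
            · exact lt_of_not_ge fun h => absurd (Nat.div_le_div_right (c := D.B) h) (by omega)
            · exact lt_of_not_ge fun h => absurd (Nat.div_le_div_right (c := D.B) h) (by omega)
        · rintro ⟨q, ⟨hq, h4, h5⟩, h6, h7⟩
          rw [forall_lt_four] at h5
          exact .inr ⟨q, hq, ⟨h4, h6, h7⟩, by omega, h5.2.1⟩
      refine Runs.cond (by simp [BExpr.cost, NExpr.cost, queryTest]) (fun h => ?_) fun h => ?_
      · rw [htest] at h
        obtain ⟨⟨h1, h2⟩, ⟨h3, h4⟩, h5⟩ := h
        refine Runs.nstore (k := e) (v := 1) (by simp [NExpr.eval, e24]) h1W ?_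
          (by simp [BExpr.cost, NExpr.cost, queryTest])
        refine ⟨fun z => ?_, fun p hp hp' => ?_⟩
        · rw [hcongr, ← hI1]
          simp
        · by_cases hpe : p = e
          · subst hpe
            simp [h3, h4, hrko, (hwit h2 h3 h4).1 h5]
          · rw [hne p (by omega) hpe, ← hI2 p hp hp']
            simp [hpe]
      · rw [htest] at h
        refine Runs.skip ?_ (by simp [BExpr.cost, NExpr.cost, queryTest])
        refine ⟨fun z => ?_, fun p hp hp' => ?_⟩
        · rw [hcongr, ← hI1]
          simp
        · by_cases hpe : p = e
          · subst hpe
            simp only [State.setReg_narr]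
            rw [hI2 p hp hp']
            refine or_congr_right ⟨fun h' => absurd h'.1 (by omega), fun h' => ?_⟩
            exact absurd ⟨⟨hp, hp'⟩, ⟨h'.2.1, h'.2.2.1⟩,
              (hwit hp' h'.2.1 h'.2.2.1).2 h'.2.2.2⟩ h
          · rw [hne p (by omega) hpe, ← hI2 p hp hp']
            simp
  · rintro s' hS ⟨-, h⟩ p hp hp'
    rw [h p hp hp']
    refine or_congr_right ⟨fun h => h.2, fun h => ⟨D.rk_lt 0 (by norm_num) p (by omega), h⟩⟩
  · simp only [NExpr.cost]
    omega

/-- There are `g * g ≤ B` sweeps, of time of order `M` each. -/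
theorem runs_sweepCells (hs : D.Stored s) (hi4 : i < 4) (h21 : s.nreg 21 = ρ) :
    Runs w (sweepCells i) s (200 * D.cost) fun s' =>
      ∀ p, D.lo ≤ p → p < D.hi → (s'.narr 9 p ≠ 0 ↔ s.narr 9 p ≠ 0 ∨
        ∃ q, D.Witness i ρ p q ∧ D.rk 2 q / D.B < D.rk 2 p / D.B ∧
          D.rk 3 q / D.B < D.rk 3 p / D.B) := by
  have hW := D.word
  have hg := D.g_le
  have hhi := D.hi_le
  refine Runs.for_const (l := 0) (N := D.g) (T := D.g * (50 * D.M + 30) + 10) (fun k s' =>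
      ∀ p, D.lo ≤ p → p < D.hi → (s'.narr 9 p ≠ 0 ↔ s.narr 9 p ≠ 0 ∨ D.rk 2 p / D.B < k ∧
        ∃ q, D.Witness i ρ p q ∧ D.rk 2 q / D.B < D.rk 2 p / D.B ∧
          D.rk 3 q / D.B < D.rk 3 p / D.B))
    (by simp [NExpr.eval]) (Nat.zero_le _) (by omega)
    (by simp [Prog.WritesReg, Prog.for, sweepCell])
    (fun s' hS => (hs.of_same hS (by simp [Prog.Local, Prog.for, sweepCell])).reg_g) (by simp) ?_ ?_
    ?_
  · rintro J - hJ s₁ hS₁ h25 hI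
    have hs₁ := hs.of_same hS₁ (by simp [Prog.Local, Prog.for, sweepCell])
    refine Runs.for_const (l := 0) (N := D.g) (T := 50 * D.M + 20) (fun k s' =>
      ∀ p, D.lo ≤ p → p < D.hi → (s'.narr 9 p ≠ 0 ↔ s.narr 9 p ≠ 0 ∨
        (D.rk 2 p / D.B < J ∨ D.rk 2 p / D.B = J ∧ D.rk 3 p / D.B < k) ∧
        ∃ q, D.Witness i ρ p q ∧ D.rk 2 q / D.B < D.rk 2 p / D.B ∧
          D.rk 3 q / D.B < D.rk 3 p / D.B))
      (by simp [NExpr.eval]) (Nat.zero_le _) (by omega)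
      (by simp [Prog.WritesReg, Prog.for, sweepCell])
      (fun s' hS => (hs₁.of_same hS (by simp [Prog.Local, Prog.for, sweepCell])).reg_g)
      (by simpa using hI) ?_ ?_ ?_
    · rintro J' - hJ' s₂ hS₂ h26 hI'
      have hs₂ := hs₁.of_same hS₂ (by simp [Prog.Local, Prog.for, sweepCell])
      refine (runs_sweepCell (ρ := ρ) hs₂ hi4 ?_ ?_ h26 hJ hJ').mono le_rfl ?_
      · rw [hS₂.reg 21 (by simp [Prog.WritesReg, Prog.for, sweepCell]),
          hS₁.reg 21 (by simp [Prog.WritesReg, Prog.for, sweepCell]), h21]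
      · exact (hS₂.reg 25 (by simp [Prog.WritesReg, Prog.for, sweepCell])).trans h25
      · intro s₃ _ h p hp hp'
        simp only [State.setReg_narr]
        rw [h p hp hp', hI' p hp hp', or_assoc]
        refine or_congr_right ?_
        constructor
        · rintro (⟨h1, h2⟩ | ⟨h1, h2, h3⟩)
          · exact ⟨by omega, h2⟩
          · exact ⟨by omega, by rwa [h1, h2]⟩
        · rintro ⟨h1, h2⟩
          by_cases h3 : D.rk 2 p / D.B = J ∧ D.rk 3 p / D.B = J'
          · exact .inr ⟨h3.1, h3.2, by rwa [h3.1, h3.2] at h2⟩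
          · exact .inl ⟨by omega, h2⟩
    · intro s₂ _ h p hp hp'
      simp only [State.setReg_narr]
      have := D.div_B_lt (D.rk_lt 3 (by norm_num) p (by omega))
      rw [h p hp hp', Nat.lt_succ_iff_lt_or_eq]
      simp [this]
    · simp only [NExpr.cost, Nat.sub_zero]
      ring_nf
      omega
  · intro s' _ h p hp hp'
    rw [h p hp hp']
    have := D.div_B_lt (D.rk_lt 2 (by norm_num) p (by omega))
    simp [this]
  · simp only [NExpr.cost, Nat.sub_zero]
    have h1 := D.M_mul_sq_le
    have h2 := D.g_mul_g_le_cost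
    have h3 := D.cost_pos
    have h4 : D.g ≤ D.cost := D.g_le.trans D.g_mul_B_le
    nlinarith

theorem runs_conclude (hs : D.Stored s) :
    Runs w conclude s (40 * D.cost) (Verdict (∀ p, D.lo ≤ p → p < D.hi → s.narr 9 p ≠ 0) s) := by
  have hW := D.word
  have hM := D.M_le
  have hhi := D.hi_le
  refine Runs.for_const (l := D.lo) (N := D.hi) (T := 20)
    (fun k => Verdict (∀ p, D.lo ≤ p → p < k → s.narr 9 p ≠ 0) s) hs.reg_lo D.lo_le (by omega)
    (by simp [Prog.WritesReg])
    (fun s' hS => (hs.of_same hS (by simp [Prog.Local, Prog.for])).reg_hi) ?_ ?_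
    (fun _ _ h => h) ?_
  · refine ⟨fun _ => by simp, fun h => absurd (fun p hp hp' => ?_) h⟩
    omega
  · intro k hk hk' s' hS h22 ⟨hI1, hI2⟩
    have h9 := hS.arr 9 (by simp [Prog.WritesArr, Prog.for])
    have hstep : (∀ p, D.lo ≤ p → p < k + 1 → s.narr 9 p ≠ 0) ↔
        (∀ p, D.lo ≤ p → p < k → s.narr 9 p ≠ 0) ∧ s.narr 9 k ≠ 0 := by
      constructor
      · intro h
        exact ⟨fun p h1 h2 => h p h1 (by omega), h k hk (by omega)⟩
      · rintro ⟨h, h'⟩ p h1 h2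
        obtain h3 | rfl : p < k ∨ p = k := by omega
        exacts [h p h1 h3, h']
    have htest : (BExpr.neq (.get 9 (.reg 22)) (.const 0)).Holds w s' ↔ s.narr 9 k = 0 := by
      simp [BExpr.Holds, NExpr.eval, h22, h9]
    refine Runs.cond (by simp [BExpr.cost, NExpr.cost]) (fun h => ?_) fun h => ?_
    · rw [htest] at h
      refine Runs.nset (v := 0) (by simp [NExpr.eval]) ?_ (by simp [BExpr.cost, NExpr.cost])
      rw [hstep]
      exact ⟨fun h' => absurd h h'.2, fun _ => by simp⟩
    · rw [htest] at h
      refine Runs.skip ?_ (by simp [BExpr.cost, NExpr.cost])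
      rw [hstep]
      exact ⟨fun h' => by simpa using hI1 h'.1,
        fun h' => by simpa using hI2 fun h'' => h' ⟨h'', h⟩⟩
  · simp only [NExpr.cost]
    have := D.M_le_cost
    have := D.cost_pos
    omega

theorem runs_domTest (hs : D.Stored s) (hi4 : i < 4) :
    Runs w (domTest i) s (700 * D.cost)
      (Verdict (DomCond D.rk D.b i D.lo D.hi D.lo' D.hi') s) := by
  have hbM := D.b_le_M
  have hhi := D.hi_le
  refine Runs.seq (runs_leastRank hs hi4) (T₂ := 540 * D.cost) ?_
    (by have := D.M_le_cost; have := D.cost_pos; omega)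
  intro s₁ hS₁ hρ
  have hs₁ := hs.of_same hS₁ (by simp [Prog.Local, Prog.for, leastRank])
  have e20₁ : s₁.nreg 20 = s.nreg 20 := hS₁.reg 20 (by simp [Prog.WritesReg, Prog.for, leastRank])
  refine Runs.seq (runs_scanBlocks hs₁ hi4 rfl) (T₂ := 240 * D.cost) ?_ (by omega)
  intro s₂ hS₂ h2
  have hs₂ := hs₁.of_same hS₂ (by simp [Prog.Local, Prog.for, scanBlocks, scanBlock])
  have e20₂ : s₂.nreg 20 = s₁.nreg 20 :=
    hS₂.reg 20 (by simp [Prog.WritesReg, Prog.for, scanBlocks, scanBlock])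
  have e21 : s₂.nreg 21 = s₁.nreg 21 :=
    hS₂.reg 21 (by simp [Prog.WritesReg, Prog.for, scanBlocks, scanBlock])
  refine Runs.seq (runs_sweepCells hs₂ hi4 e21) (T₂ := 40 * D.cost) ?_ (by omega)
  intro s₃ hS₃ h3
  have hs₃ := hs₂.of_same hS₃ (by simp [Prog.Local, Prog.for, sweepCells, sweepCell])
  have e20₃ : s₃.nreg 20 = s₂.nreg 20 :=
    hS₃.reg 20 (by simp [Prog.WritesReg, Prog.for, sweepCells, sweepCell])
  refine (runs_conclude hs₃).mono le_rfl fun s₄ _ h4 => ?_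
  have hiff : (∀ p, D.lo ≤ p → p < D.hi → s₃.narr 9 p ≠ 0) ↔
      DomCond D.rk D.b i D.lo D.hi D.lo' D.hi' := by
    refine forall_congr' fun p => forall_congr' fun hp => forall_congr' fun hp' => ?_
    rw [h3 p hp hp', h2 p hp hp', ← exists_or]
    refine exists_congr fun q => ?_
    rw [← and_or_left, Ranking.Witness, hρ]
    constructor
    · rintro ⟨⟨hq, h5, h6⟩, -⟩
      exact ⟨hq, h6, h5.2⟩
    · rintro ⟨hq, h6, h5⟩
      refine ⟨⟨hq, ⟨D.rk_lt i hi4 q (by omega), h5⟩, h6⟩, ?_⟩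
      have h7 := Nat.div_le_div_right (c := D.B) (h6 2 (by norm_num)).le
      have h8 := Nat.div_le_div_right (c := D.B) (h6 3 (by norm_num)).le
      omega
  rw [hiff] at h4
  rwa [Verdict, e20₃, e20₂, e20₁] at h4

end Dom

/-! ### The test for the mixtures with two coordinates from each rectangle -/

/-- For the elements `p` of the interval given by the registers `l` and `h`, the function of
`IsExit` is written to array `out`. -/
def exits (i j l h out : ℕ) : Prog :=
  .seq (.nset 27 (.reg 5)) (.for 22 (.const 0) (.reg 5)
    (.seq (.nset 24 (.get (4 + j) (.reg 22)))
    (.seq (.nstore out (.reg 24) (.reg 27))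
      (.ite (.and (.not (.nlt (.reg 24) (.reg l))) (.and (.nlt (.reg 24) (.reg h))
          (.nlt (.get i (.reg 24)) (.reg 27))))
        (.nset 27 (.get i (.reg 24))) .skip))))

/-- Array `12`, indexed by the ranks in coordinate `i'`, receives `0` at the elements of
`[lo', hi')` and `M` elsewhere.  In the sequel, the cell of a column exceeds the rows in which the
column is covered; the ranks that do not belong to `[lo', hi')` need not be covered and so count as
covered in all rows. -/
def initColumns (i' : ℕ) : Prog :=
  .seq (.for 22 (.const 0) (.mul (.reg 6) (.reg 7)) (.nstore 12 (.reg 22) (.reg 5)))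
    (.for 22 (.reg 14) (.reg 15) (.nstore 12 (.get i' (.reg 22)) (.const 0)))

/-- The cells of array `12` whose index lies in the block between registers `28` and `29` and in the
interval between registers `30` and `31` are raised to at least register `32`; register `27`
receives the minimum over the block. -/
def refresh : Prog :=
  .seq (.nset 27 (.reg 5)) (.for 23 (.reg 28) (.reg 29)
    (.seq (.ite (.and (.not (.nlt (.reg 23) (.reg 30))) (.and (.nlt (.reg 23) (.reg 31))
        (.nlt (.get 12 (.reg 23)) (.reg 32)))) (.nstore 12 (.reg 23) (.reg 32)) .skip)
      (.ite (.nlt (.get 12 (.reg 23)) (.reg 27)) (.nset 27 (.get 12 (.reg 23))) .skip)))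

/-- The element in register `24` belongs to `[lo, hi)`, and the row in register `22` is covered in
the current block neither by a rectangle across the block nor by the other rectangles. -/
def gapTest : BExpr :=
  .and (.not (.nlt (.reg 24) (.reg 12))) (.and (.nlt (.reg 24) (.reg 13))
    (.and (.not (.nlt (.reg 22) (.reg 26))) (.not (.nlt (.reg 22) (.reg 27)))))

/-- The rectangle given by registers `30`, `31`, `32` is added to the block. -/
def addRectangle : Prog :=
  .ite (.or (.neq (.div (.reg 30) (.reg 7)) (.reg 25)) (.neq (.div (.reg 31) (.reg 7)) (.reg 25)))
    refresh
    (.ite (.and (.nlt (.div (.reg 30) (.reg 7)) (.reg 25))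
        (.and (.nlt (.reg 25) (.div (.reg 31) (.reg 7))) (.nlt (.reg 26) (.reg 32))))
      (.nset 26 (.reg 32)) .skip)

/-- The treatment of the row in register `22` in the block of columns in register `25`. -/
def coverRow (i i' : ℕ) : Prog :=
  .seq (.nset 24 (.get (4 + i) (.reg 22)))
    (.ite (.nlt (.reg 24) (.reg 1))
      (.seq (.nset 30 (.get i' (.reg 24))) (.seq (.nset 31 (.get 11 (.reg 24)))
        (.seq (.nset 32 (.get 10 (.reg 24))) addRectangle)))
      (.ite gapTest (.nset 20 (.const 0)) .skip))

/-- The sweep over the rows of the block of columns in register `25`. -/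
def coverBlock (i i' : ℕ) : Prog :=
  .seq (.nset 26 (.const 0)) (.seq (.nset 28 (.mul (.reg 25) (.reg 7)))
    (.seq (.nset 29 (.add (.reg 28) (.reg 7))) (.seq (.nset 32 (.const 0))
    (.seq refresh (.for 22 (.const 0) (.reg 5) (coverRow i i'))))))

/-- The test of `PairCond`. -/
def pairTest (i j i' j' : ℕ) : Prog :=
  .seq (exits i j 12 13 10) (.seq (exits i' j' 14 15 11) (.seq (initColumns i')
    (.for 25 (.const 0) (.reg 6) (coverBlock i i'))))

theorem Verdict.and {A B : Prop} {s s' s'' : State} (h : Verdict A s s') (h' : Verdict B s' s'') :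
    Verdict (A ∧ B) s s'' := by
  refine ⟨fun hAB => (h'.1 hAB.2).trans (h.1 hAB.1), fun hAB => ?_⟩
  by_cases hB : B
  · exact (h'.1 hB).trans (h.2 fun hA => hAB ⟨hA, hB⟩)
  · exact h'.2 hB

theorem Verdict.congr {A B : Prop} {s s' : State} (h : Verdict A s s') (hAB : A ↔ B) :
    Verdict B s s' := by rwa [← propext hAB]

section Cover
variable {w : ℕ} {D : Ranking w} {i j i' j' : ℕ} {s : State}

/-- The elements are met in the order of coordinate `j`, while register `27` maintains the least
rank in coordinate `i` of the elements of the interval met so far. -/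
theorem runs_exits (hs : D.Stored s) (hi4 : i < 4) (hj4 : j < 4) {l h out lo hi : ℕ} (hl : l < 20)
    (hh : h < 20) (hout : 8 ≤ out) (hlo : s.nreg l = lo) (hhi : s.nreg h = hi) (hM : hi ≤ D.M) :
    Runs w (exits i j l h out) s (60 * D.cost) fun s' =>
      IsExit D.rk i j lo hi D.M (s'.narr out) := by
  have hW := D.word
  have hMB := D.M_le
  have hloc : (exits i j l h out).Local := by simp [Prog.Local, exits, Prog.for, hout]
  refine Runs.nset_seq (v := D.M) hs.reg_M (by simp [NExpr.cost]; have := D.cost_pos; omega) ?_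
  have hs₀ := hs.setReg (x := 27) (by norm_num) D.M
  refine Runs.for_const (l := 0) (N := D.M) (T := 25) (fun k s' =>
      (∀ z, z < s'.nreg 27 ↔ z < D.M ∧ ∀ p, lo ≤ p → p < hi → D.rk j p < k → z < D.rk i p) ∧
      ∀ q < D.M, D.rk j q < k → ∀ z, z < s'.narr out q ↔
        z < D.M ∧ ∀ p, lo ≤ p → p < hi → D.rk j p < D.rk j q → z < D.rk i p)
    (by simp [NExpr.eval]) (Nat.zero_le _) (by omega) (by simp [Prog.WritesReg])
    (fun s' hS => (hs₀.of_same hS hloc.2).reg_M) (by simp) ?_ ?_ ?_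
  · rintro k - hk s' hS h22 ⟨hI1, hI2⟩
    have hs' := hs₀.of_same hS hloc.2
    have hlo' : s'.nreg l = lo := by
      rw [hS.reg l (hloc.2.reg hl), State.setReg_nreg, if_neg (by omega), hlo]
    have hhi' : s'.nreg h = hi := by
      rw [hS.reg h (hloc.2.reg hh), State.setReg_nreg, if_neg (by omega), hhi]
    have hrko := D.rk_ord j hj4 k hk
    have heM := D.ord_lt j hj4 k hk
    refine Runs.nset_seq (v := D.ord j k) (by simp only [NExpr.eval, h22, hs'.arr_ord j hj4])
      (by simp [NExpr.cost]) ?_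
    generalize hee : D.ord j k = e at *
    have hne : ∀ x, x < D.M → x ≠ e → (D.rk j x < k + 1 ↔ D.rk j x < k) := by
      intro x hx hxe
      have := mt (D.rk_inj hj4 hx heM) hxe
      omega
    refine Runs.nstore_seq (k := e) (v := s'.nreg 27) (by simp [NExpr.eval]) (by simp [NExpr.eval])
      (by simp [NExpr.cost]) ?_
    generalize hs₁ : (s'.setReg 24 e).store out e (s'.nreg 27) = s₁
    have hst : D.Stored s₁ := hs₁ ▸ (hs'.setReg (by norm_num) _).store hout _ _
    have e24 : s₁.nreg 24 = e := by simp [← hs₁]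
    have el : s₁.nreg l = lo := by simp [← hs₁, hlo', show l ≠ 24 by omega]
    have eh : s₁.nreg h = hi := by simp [← hs₁, hhi', show h ≠ 24 by omega]
    have e27 : s₁.nreg 27 = s'.nreg 27 := by simp [← hs₁]
    have hI3 : ∀ q < D.M, D.rk j q < k + 1 → ∀ z, z < s₁.narr out q ↔
        z < D.M ∧ ∀ p, lo ≤ p → p < hi → D.rk j p < D.rk j q → z < D.rk i p := by
      intro q hq hqk z
      by_cases hqe : q = e
      · subst hqe
        simp only [← hs₁, State.store_narr, and_self, if_true]
        rw [hI1, hrko]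
      · simp only [← hs₁, State.store_narr, hqe, and_false, if_false, State.setReg_narr]
        exact hI2 q hq ((hne q hq hqe).1 hqk) z
    have htest : BExpr.Holds w s₁ (.and (.not (.nlt (.reg 24) (.reg l)))
        (.and (.nlt (.reg 24) (.reg h)) (.nlt (.get i (.reg 24)) (.reg 27)))) ↔
        (lo ≤ e ∧ e < hi) ∧ D.rk i e < s'.nreg 27 := by
      simp only [BExpr.Holds, NExpr.eval, e24, el, eh, hst.arr_rk i hi4, e27, not_lt, and_assoc]
    have hsplit : ∀ z, (∀ p, lo ≤ p → p < hi → D.rk j p < k + 1 → z < D.rk i p) ↔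
        (∀ p, lo ≤ p → p < hi → D.rk j p < k → z < D.rk i p) ∧
          (lo ≤ e ∧ e < hi → z < D.rk i e) := by
      intro z
      constructor
      · intro h
        exact ⟨fun p h1 h2 h3 => h p h1 h2 (by omega), fun h1 => h e h1.1 h1.2 (by omega)⟩
      · rintro ⟨h1, h2⟩ p h3 h4 h5
        by_cases hpe : p = e
        · subst hpe
          exact h2 ⟨h3, h4⟩
        · exact h1 p h3 h4 ((hne p (by omega) hpe).1 h5)
    refine Runs.cond (by simp [BExpr.cost, NExpr.cost]) (fun h => ?_) fun h => ?_
    · rw [htest] at h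
      refine Runs.nset (v := D.rk i e) (by simp [NExpr.eval, e24, hst.arr_rk i hi4]) ?_
        (by simp [BExpr.cost, NExpr.cost])
      refine ⟨fun z => ?_, by simpa using hI3⟩
      rw [hsplit, ← and_assoc, ← hI1]
      simp [h.1]
      omega
    · rw [htest] at h
      refine Runs.skip ?_ (by simp [BExpr.cost, NExpr.cost])
      refine ⟨fun z => ?_, by simpa using hI3⟩
      rw [hsplit, ← and_assoc, ← hI1]
      simp [e27]
      intro h1 h2 h3
      have := mt (fun h' => (⟨⟨h2, h3⟩, h'⟩ : _ ∧ _)) h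
      omega
  · rintro s' - ⟨-, h⟩ q hq
    exact h q hq (D.rk_lt j hj4 q hq)
  · simp only [NExpr.cost]
    have := D.M_le_cost
    have := D.cost_pos
    omega

theorem runs_initColumns (hs : D.Stored s) (hi4' : i' < 4) :
    Runs w (initColumns i') s (50 * D.cost) fun s' =>
      ∀ x < D.g * D.B, ∀ z < D.M, z < s'.narr 12 x ↔
        ¬ ∃ r, D.lo' ≤ r ∧ r < D.hi' ∧ D.rk i' r = x := by
  have hW := D.word
  have hM := D.M_le
  have hhi := D.hi_le'
  refine Runs.seq (T₁ := 30 * D.cost) (T₂ := 20 * D.cost)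
    (R := fun s' => ∀ x < D.g * D.B, s'.narr 12 x = D.M) ?_ ?_ (by omega)
  · refine Runs.for_const (l := 0) (N := D.g * D.B) (T := 3)
      (fun k s' => ∀ x < k, s'.narr 12 x = D.M)
      (by simp [NExpr.eval]) (Nat.zero_le _) (by omega) (by simp [Prog.WritesReg]) ?_ (by simp) ?_
      (fun _ _ h => h) ?_
    · intro s' hS
      have hs' := hs.of_same hS (by simp [Prog.Local, Prog.for])
      simp only [NExpr.eval, hs'.reg_g, hs'.reg_B]
      exact Nat.mod_eq_of_lt (by omega)
    · rintro k - hk s' hS h22 hI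
      have hs' := hs.of_same hS (by simp [Prog.Local, Prog.for])
      refine Runs.nstore (k := k) (v := D.M) (by simp [NExpr.eval, h22])
        (by simp [NExpr.eval, hs'.reg_M]) ?_ (by simp [NExpr.cost])
      intro x hx
      by_cases hxk : x = k
      · simp [hxk]
      · simpa [hxk] using hI x (by omega)
    · simp only [NExpr.cost]
      have := D.g_mul_B_le
      have := D.cost_pos
      omega
  · intro s₁ hS₁ h1
    have hs₁ := hs.of_same hS₁ (by simp [Prog.Local, Prog.for])
    refine Runs.for_const (l := D.lo') (N := D.hi') (T := 4)
      (fun k s' => ∀ x < D.g * D.B, ∀ z < D.M, z < s'.narr 12 x ↔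
        ¬ ∃ r, D.lo' ≤ r ∧ r < k ∧ D.rk i' r = x)
      hs₁.reg_lo' D.lo_le' (by omega) (by simp [Prog.WritesReg])
      (fun s' hS => (hs₁.of_same hS (by simp [Prog.Local, Prog.for])).reg_hi') ?_ ?_
      (fun _ _ h => h) ?_
    · intro x hx z hz
      simp only [State.setReg_narr, h1 x hx, hz, true_iff]
      rintro ⟨r, h2, h3, -⟩
      omega
    · intro k hk hk' s' hS h22 hI
      have hs' := hs₁.of_same hS (by simp [Prog.Local, Prog.for])
      refine Runs.nstore (k := D.rk i' k) (v := 0) (by simp [NExpr.eval, h22, hs'.arr_rk i' hi4'])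
        (by simp [NExpr.eval]) ?_ (by simp [NExpr.cost])
      intro x hx z hz
      by_cases hxk : x = D.rk i' k
      · simp only [State.setReg_narr, State.store_narr, hxk, and_self, if_true, Nat.not_lt_zero,
          false_iff, not_not]
        exact ⟨k, hk, by omega, rfl⟩
      · simp only [State.setReg_narr, State.store_narr, hxk, and_false, if_false, hI x hx z hz]
        refine not_congr (exists_congr fun r => and_congr_right fun _ => ?_)
        constructor
        · rintro ⟨h2, h3⟩
          exact ⟨by omega, h3⟩
        · rintro ⟨h2, h3⟩
          refine ⟨?_, h3⟩
          by_contra h4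
          obtain rfl : r = k := by omega
          exact hxk h3.symm
    · simp only [NExpr.cost]
      have := D.M_le_cost
      have := D.cost_pos
      omega

theorem runs_refresh (hs : D.Stored s) {blk γ δ β : ℕ} (hblk : blk < D.g)
    (h28 : s.nreg 28 = blk * D.B) (h29 : s.nreg 29 = blk * D.B + D.B) (h30 : s.nreg 30 = γ)
    (h31 : s.nreg 31 = δ) (h32 : s.nreg 32 = β) :
    Runs w refresh s (80 * D.B) fun s' =>
      (∀ x z, z < s'.narr 12 x ↔ z < s.narr 12 x ∨
        (blk * D.B ≤ x ∧ x < blk * D.B + D.B) ∧ (γ ≤ x ∧ x < δ) ∧ z < β) ∧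
      ∀ z, z < s'.nreg 27 ↔
        z < D.M ∧ ∀ x, blk * D.B ≤ x → x < blk * D.B + D.B → z < s'.narr 12 x := by
  have hW := D.word
  have hB := D.B_pos
  have hend : blk * D.B + D.B ≤ D.g * D.B := by
    rw [← Nat.succ_mul]
    exact D.mul_B_le hblk
  refine Runs.nset_seq (v := D.M) hs.reg_M (by simp [NExpr.cost]; omega) ?_
  refine Runs.for_const (l := blk * D.B) (N := blk * D.B + D.B) (T := 40)
    (fun k s' => (∀ x z, z < s'.narr 12 x ↔ z < s.narr 12 x ∨
        (blk * D.B ≤ x ∧ x < k) ∧ (γ ≤ x ∧ x < δ) ∧ z < β) ∧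
      ∀ z, z < s'.nreg 27 ↔ z < D.M ∧ ∀ x, blk * D.B ≤ x → x < k → z < s'.narr 12 x)
    (by simp [NExpr.eval, h28]) (by omega) (by omega) (by simp [Prog.WritesReg]) ?_ ?_ ?_
    (fun _ _ h => h) ?_
  · intro s' hS
    simp only [NExpr.eval]
    rw [hS.reg 29 (by simp [Prog.WritesReg, Prog.for]), State.setReg_nreg, if_neg
        (by norm_num), h29]
  · refine ⟨fun x z => ?_, fun z => ?_⟩
    · simp only [State.setReg_narr]
      omega
    · simp
      omega
  · rintro k hk hk' s' hS h23 ⟨hI1, hI2⟩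
    have e30 : s'.nreg 30 = γ := by
      rw [hS.reg 30 (by simp [Prog.WritesReg, Prog.for]), State.setReg_nreg, if_neg
          (by norm_num), h30]
    have e31 : s'.nreg 31 = δ := by
      rw [hS.reg 31 (by simp [Prog.WritesReg, Prog.for]), State.setReg_nreg, if_neg
          (by norm_num), h31]
    have e32 : s'.nreg 32 = β := by
      rw [hS.reg 32 (by simp [Prog.WritesReg, Prog.for]), State.setReg_nreg, if_neg
          (by norm_num), h32]
    refine Runs.seq (T₁ := 20) (T₂ := 20) (R := fun s'' => s''.nreg = s'.nreg ∧
      (∀ x, x ≠ k → s''.narr 12 x = s'.narr 12 x) ∧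
      ∀ z, z < s''.narr 12 k ↔ z < s'.narr 12 k ∨ (γ ≤ k ∧ k < δ) ∧ z < β) ?_ ?_ (by norm_num)
    · refine Runs.cond (by simp [BExpr.cost, NExpr.cost]) (fun h => ?_) fun h => ?_
      · simp only [BExpr.Holds, NExpr.eval, h23, e30, e31, e32, not_lt] at h
        refine Runs.nstore (k := k) (v := β) (by simp [NExpr.eval, h23]) (by simp [NExpr.eval, e32])
          ?_ (by simp [BExpr.cost, NExpr.cost])
        refine ⟨rfl, fun x hx => by simp [hx], fun z => ?_⟩
        simp
        omega
      · simp only [BExpr.Holds, NExpr.eval, h23, e30, e31, e32, not_lt] at h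
        refine Runs.skip ⟨rfl, fun _ _ => rfl, fun z => ?_⟩ (by simp [BExpr.cost, NExpr.cost])
        omega
    · rintro s₁ - ⟨hr, h1, h2⟩
      have h3 : ∀ x z, z < s₁.narr 12 x ↔ z < s.narr 12 x ∨
          (blk * D.B ≤ x ∧ x < k + 1) ∧ (γ ≤ x ∧ x < δ) ∧ z < β := by
        intro x z
        by_cases hxk : x = k
        · subst hxk
          rw [h2, hI1]
          omega
        · rw [h1 x hxk, hI1]
          omega
      have h4 : ∀ z, (z < s₁.nreg 27 ∧ z < s₁.narr 12 k) ↔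
          z < D.M ∧ ∀ x, blk * D.B ≤ x → x < k + 1 → z < s₁.narr 12 x := by
        intro z
        rw [hr, hI2, and_assoc]
        refine and_congr_right fun _ => ⟨?_, fun h => ⟨fun x h5 h6 => ?_, h k hk (by omega)⟩⟩
        · rintro ⟨h5, h6⟩ x h7 h8
          by_cases hxk : x = k
          · rwa [hxk]
          · rw [h1 x hxk]
            exact h5 x h7 (by omega)
        · rw [← h1 x (by omega)]
          exact h x h5 (by omega)
      have hk23 : s₁.nreg 23 = k := by rw [hr, h23]
      refine Runs.cond (by simp [BExpr.cost, NExpr.cost]) (fun h => ?_) fun h => ?_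
      · simp only [BExpr.Holds, NExpr.eval, hk23] at h
        refine Runs.nset (v := s₁.narr 12 k) (by simp [NExpr.eval, hk23]) ?_
          (by simp [BExpr.cost, NExpr.cost])
        refine ⟨by simpa using h3, fun z => ?_⟩
        have := h4 z
        simp only [State.setReg_narr, ← this]
        simp
        omega
      · simp only [BExpr.Holds, NExpr.eval, hk23] at h
        refine Runs.skip ?_ (by simp [BExpr.cost, NExpr.cost])
        refine ⟨by simpa using h3, fun z => ?_⟩
        have := h4 z
        simp only [State.setReg_narr, ← this]
        simp
        omega
  · simp only [NExpr.cost]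
    omega

/-- An interval of columns that has no end in the block is either disjoint from the block or
contains it; so the running time is large only for the two blocks in which the interval ends. -/
theorem runs_addRectangle (hs : D.Stored s) {blk γ δ β : ℕ} (hblk : blk < D.g)
    (h25 : s.nreg 25 = blk) (h28 : s.nreg 28 = blk * D.B) (h29 : s.nreg 29 = blk * D.B + D.B)
    (h30 : s.nreg 30 = γ) (h31 : s.nreg 31 = δ) (h32 : s.nreg 32 = β)
    (hmin : ∀ z, z < s.nreg 27 ↔
      z < D.M ∧ ∀ x, blk * D.B ≤ x → x < blk * D.B + D.B → z < s.narr 12 x) :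
    Runs w addRectangle s (60 + ((if γ / D.B = blk then 80 * D.B else 0) +
        if δ / D.B = blk then 80 * D.B else 0)) fun s' =>
      (∀ x, ¬ (blk * D.B ≤ x ∧ x < blk * D.B + D.B) → s'.narr 12 x = s.narr 12 x) ∧
      (∀ x z, blk * D.B ≤ x ∧ x < blk * D.B + D.B → ((z < s'.nreg 26 ∨ z < s'.narr 12 x) ↔
        (z < s.nreg 26 ∨ z < s.narr 12 x) ∨ (γ ≤ x ∧ x < δ) ∧ z < β)) ∧
      ∀ z, z < s'.nreg 27 ↔
        z < D.M ∧ ∀ x, blk * D.B ≤ x → x < blk * D.B + D.B → z < s'.narr 12 x := by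
  refine Runs.cond (by simp [BExpr.cost, NExpr.cost]; omega) (fun h => ?_) fun h => ?_
  · simp only [BExpr.Holds, NExpr.eval, h30, h31, h25, hs.reg_B] at h
    refine (runs_refresh hs hblk h28 h29 h30 h31 h32).mono ?_ ?_
    · simp only [BExpr.cost, NExpr.cost]
      split_ifs <;> omega
    · rintro s' hS ⟨h1, h2⟩
      have e26 := hS.reg 26 (by simp [Prog.WritesReg, refresh, Prog.for])
      refine ⟨fun x hx => ?_, fun x z hx => ?_, h2⟩
      · refine eq_of_forall_lt_iff fun z => ?_
        rw [h1]
        tauto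
      · rw [h1, e26]
        tauto
  · simp only [BExpr.Holds, NExpr.eval, h30, h31, h25, hs.reg_B, not_or] at h
    have hγ := D.lt_div_B_mul γ
    have hγ' := D.div_B_mul_le γ
    have hδ := D.lt_div_B_mul δ
    have hδ' := D.div_B_mul_le δ
    have mono : ∀ {m n : ℕ}, m < n → m * D.B + D.B ≤ n * D.B := fun {m n} hmn => by
      rw [← Nat.succ_mul]
      exact Nat.mul_le_mul_right _ hmn
    have htest : BExpr.Holds w s (.and (.nlt (.div (.reg 30) (.reg 7)) (.reg 25))
        (.and (.nlt (.reg 25) (.div (.reg 31) (.reg 7))) (.nlt (.reg 26) (.reg 32)))) ↔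
        (γ / D.B < blk ∧ blk < δ / D.B) ∧ s.nreg 26 < β := by
      simp only [BExpr.Holds, NExpr.eval, h30, h31, h25, h32, hs.reg_B, and_assoc]
    refine Runs.cond (by simp [BExpr.cost, NExpr.cost]; omega) (fun h' => ?_) fun h' => ?_
    · rw [htest] at h'
      refine Runs.nset (v := β) (by simp [NExpr.eval, h32]) ?_
        (by simp [BExpr.cost, NExpr.cost]; omega)
      refine ⟨fun x hx => rfl, fun x z hx => ?_, fun z => ?_⟩
      · have h3 := mono h'.1.1
        have h4 := mono h'.1.2
        simp
        omega
      · simpa using hmin z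
    · rw [htest] at h'
      refine Runs.skip ?_ (by simp [BExpr.cost, NExpr.cost]; omega)
      refine ⟨fun x hx => rfl, fun x z hx => ?_, hmin⟩
      refine ⟨Or.inl, ?_⟩
      rintro (h1 | ⟨h1, h2⟩)
      · exact h1
      · -- the interval meets the block, so it contains the block
        have h3 : γ / D.B < blk := by
          by_contra hlt
          have := mono (show blk < γ / D.B by omega)
          omega
        have h4 : blk < δ / D.B := by
          by_contra hlt
          have := mono (show δ / D.B < blk by omega)
          omega
        have h5 := mt (fun h5 => (⟨⟨h3, h4⟩, h5⟩ : _ ∧ _)) h'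
        omega

/-- A column that is the rank in coordinate `i'` of an element of `[lo', hi')`. -/
def Ranking.Column (D : Ranking w) (i' x : ℕ) : Prop :=
  ∃ r, D.lo' ≤ r ∧ r < D.hi' ∧ D.rk i' r = x

/-- One of the rectangles that belong to lower elements of rank less than `k` in coordinate `i`
extends above row `z` and contains column `x`. -/
def Ranking.Covered (D : Ranking w) (i i' : ℕ) (β δ : ℕ → ℕ) (k z x : ℕ) : Prop :=
  ∃ q < D.b, D.rk i q < k ∧ z < β q ∧ D.rk i' q ≤ x ∧ x < δ q

set_option maxHeartbeats 800000 in
/-- The rows are met in increasing order.  A lower element covers the row only from its own rank on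
and up to its exit, so a column is covered in the current row if and only if the largest exit among
the rectangles met so far that contain the column exceeds the row.  Register `26` has the largest
exit of the rectangles across the whole block, array `12` those of the other rectangles for the
single columns, and register `27` the minimum of the latter. -/
theorem runs_coverBlock (hs : D.Stored s) (hi4 : i < 4) (hi4' : i' < 4) {blk : ℕ} {β δ : ℕ → ℕ}
    (hblk : blk < D.g) (h25 : s.nreg 25 = blk) (h10 : s.narr 10 = β) (h11 : s.narr 11 = δ)
    (h12 : ∀ x, blk * D.B ≤ x → x < blk * D.B + D.B →
      ∀ z < D.M, z < s.narr 12 x ↔ ¬ D.Column i' x) :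
    Runs w (coverBlock i i') s (120 * D.B + ∑ k ∈ Finset.range D.M, (150 +
        ((if D.rk i' (D.ord i k) / D.B = blk then 80 * D.B else 0) +
          if δ (D.ord i k) / D.B = blk then 80 * D.B else 0))) fun s' =>
      (∀ x, ¬ (blk * D.B ≤ x ∧ x < blk * D.B + D.B) → s'.narr 12 x = s.narr 12 x) ∧
      Verdict (∀ p, D.lo ≤ p → p < D.hi → ∀ x, blk * D.B ≤ x → x < blk * D.B + D.B → D.Column i' x →
        D.Covered i i' β δ (D.rk i p) (D.rk i p) x) s s' := by
  have hW := D.word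
  have hM := D.M_le
  have hhi := D.hi_le
  have hb := D.b_le
  have hbM := D.b_le_M
  have hB := D.B_pos
  have hend : blk * D.B + D.B ≤ D.g * D.B := by
    rw [← Nat.succ_mul]
    exact D.mul_B_le hblk
  have hloc : (Prog.for 22 (.const 0) (.reg 5) (coverRow i i')).Local := by
    simp [Prog.Local, Prog.for, coverRow, addRectangle, refresh]
  refine Runs.nset_seq (v := 0) (by simp [NExpr.eval]) (by simp [NExpr.cost]; omega) ?_
  refine Runs.nset_seq (v := blk * D.B) ?_ (by simp [NExpr.cost]; omega) ?_
  · simp only [NExpr.eval, State.setReg_nreg, h25, hs.reg_B]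
    simpa using Nat.mod_eq_of_lt (by omega)
  refine Runs.nset_seq (v := blk * D.B + D.B) ?_ (by simp [NExpr.cost]; omega) ?_
  · simp only [NExpr.eval, State.setReg_nreg, hs.reg_B]
    simpa using Nat.mod_eq_of_lt (by omega)
  refine Runs.nset_seq (v := 0) (by simp [NExpr.eval]) (by simp [NExpr.cost]; omega) ?_
  generalize hs₀ : (((s.setReg 26 0).setReg 28 (blk * D.B)).setReg 29 (blk * D.B + D.B)).setReg 32 0
    = s₀
  have hst₀ : D.Stored s₀ := hs₀ ▸ (((hs.setReg (by norm_num) _).setReg (by norm_num) _).setReg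
    (by norm_num) _).setReg (by norm_num) _
  have f28 : s₀.nreg 28 = blk * D.B := by simp [← hs₀]
  have f29 : s₀.nreg 29 = blk * D.B + D.B := by simp [← hs₀]
  have f32 : s₀.nreg 32 = 0 := by simp [← hs₀]
  have f25 : s₀.nreg 25 = blk := by simp [← hs₀, h25]
  have f26 : s₀.nreg 26 = 0 := by simp [← hs₀]
  have f20 : s₀.nreg 20 = s.nreg 20 := by simp [← hs₀]
  have farr : s₀.narr = s.narr := by simp [← hs₀]
  refine Runs.seq (runs_refresh hst₀ hblk f28 f29 rfl rfl f32) (T₂ := 10 +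
      ∑ k ∈ Finset.range D.M, (150 + ((if D.rk i' (D.ord i k) / D.B = blk then 80 * D.B else 0) +
          if δ (D.ord i k) / D.B = blk then 80 * D.B else 0))) ?_
    (by simp [NExpr.cost]; omega)
  rintro s₁ hS₁ ⟨hc, hmin⟩
  have hst₁ : D.Stored s₁ := hst₀.of_same hS₁ (by simp [Prog.Local, Prog.for, refresh])
  have hc' : ∀ x, s₁.narr 12 x = s.narr 12 x := by
    intro x
    refine eq_of_forall_lt_iff fun z => ?_
    rw [hc, farr]
    simp
  have g25 : s₁.nreg 25 = blk :=
    (hS₁.reg 25 (by simp [Prog.WritesReg, refresh, Prog.for])).trans f25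
  have g26 : s₁.nreg 26 = 0 :=
    (hS₁.reg 26 (by simp [Prog.WritesReg, refresh, Prog.for])).trans f26
  have g28 : s₁.nreg 28 = blk * D.B :=
    (hS₁.reg 28 (by simp [Prog.WritesReg, refresh, Prog.for])).trans f28
  have g29 : s₁.nreg 29 = blk * D.B + D.B :=
    (hS₁.reg 29 (by simp [Prog.WritesReg, refresh, Prog.for])).trans f29
  have g20 : s₁.nreg 20 = s.nreg 20 :=
    (hS₁.reg 20 (by simp [Prog.WritesReg, refresh, Prog.for])).trans f20
  have g10 : s₁.narr 10 = β := by
    rw [hS₁.arr 10 (by simp [Prog.WritesArr, refresh, Prog.for]), farr, h10]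
  have g11 : s₁.narr 11 = δ := by
    rw [hS₁.arr 11 (by simp [Prog.WritesArr, refresh, Prog.for]), farr, h11]
  refine Runs.for (l := 0) (N := D.M) (fun k s' =>
      (∀ x, ¬ (blk * D.B ≤ x ∧ x < blk * D.B + D.B) → s'.narr 12 x = s.narr 12 x) ∧
      (∀ x, blk * D.B ≤ x ∧ x < blk * D.B + D.B → ∀ z < D.M,
        ((z < s'.nreg 26 ∨ z < s'.narr 12 x) ↔ ¬ D.Column i' x ∨ D.Covered i i' β δ k z x)) ∧
      (∀ z, z < s'.nreg 27 ↔
        z < D.M ∧ ∀ x, blk * D.B ≤ x → x < blk * D.B + D.B → z < s'.narr 12 x) ∧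
      Verdict (∀ p, D.lo ≤ p → p < D.hi → D.rk i p < k → ∀ x, blk * D.B ≤ x →
        x < blk * D.B + D.B → D.Column i' x → D.Covered i i' β δ (D.rk i p) (D.rk i p) x) s s')
    (fun k => 100 + ((if D.rk i' (D.ord i k) / D.B = blk then 80 * D.B else 0) +
          if δ (D.ord i k) / D.B = blk then 80 * D.B else 0))
    (by simp [NExpr.eval]) (Nat.zero_le _) (by omega)
    (by simp [Prog.WritesReg, coverRow, addRectangle, refresh, Prog.for])
    (fun s' hS => (hst₁.of_same hS hloc).reg_M) ?_ ?_ ?_ ?_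
  · refine ⟨fun x _ => hc' x, fun x hx z hz => ?_, by simpa using hmin, fun _ => by simp [g20],
      fun h => absurd (fun p _ _ h' => ?_) h⟩
    · simp only [State.setReg_narr, hc', h12 x hx.1 hx.2 z hz]
      simp [g26, Ranking.Covered]
    · omega
  · rintro k - hk s' hS h22 ⟨hI1, hI2, hI3, hI4⟩
    have hs' := hst₁.of_same hS hloc
    have e25 : s'.nreg 25 = blk := (hS.reg 25
      (by simp [Prog.WritesReg, coverRow, addRectangle, refresh, Prog.for])).trans g25
    have e28 : s'.nreg 28 = blk * D.B := (hS.reg 28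
      (by simp [Prog.WritesReg, coverRow, addRectangle, refresh, Prog.for])).trans g28
    have e29 : s'.nreg 29 = blk * D.B + D.B := (hS.reg 29
      (by simp [Prog.WritesReg, coverRow, addRectangle, refresh, Prog.for])).trans g29
    have e10 : s'.narr 10 = β := (hS.arr 10
      (by simp [Prog.WritesArr, coverRow, addRectangle, refresh, Prog.for])).trans g10
    have e11 : s'.narr 11 = δ := (hS.arr 11
      (by simp [Prog.WritesArr, coverRow, addRectangle, refresh, Prog.for])).trans g11
    have hrko := D.rk_ord i hi4 k hk
    have heM := D.ord_lt i hi4 k hk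
    refine Runs.nset_seq (v := D.ord i k) (by simp only [NExpr.eval, h22, hs'.arr_ord i hi4])
      (by simp [NExpr.cost]; omega) ?_
    generalize hee : D.ord i k = e at *
    have hne : ∀ x, x < D.M → x ≠ e → (D.rk i x < k + 1 ↔ D.rk i x < k) := by
      intro x hx hxe
      have := mt (D.rk_inj hi4 hx heM) hxe
      omega
    refine Runs.cond (by simp [BExpr.cost, NExpr.cost]; omega) (fun h => ?_) fun h => ?_
    · have heb : e < D.b := by simpa [BExpr.Holds, NExpr.eval, hs'.reg_b] using h
      have hcov : ∀ z x, D.Covered i i' β δ (k + 1) z x ↔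
          D.Covered i i' β δ k z x ∨ (D.rk i' e ≤ x ∧ x < δ e) ∧ z < β e := by
        intro z x
        constructor
        · rintro ⟨q, hq, h1, h2, h3, h4⟩
          by_cases hqe : q = e
          · subst hqe
            exact .inr ⟨⟨h3, h4⟩, h2⟩
          · exact .inl ⟨q, hq, (hne q (by omega) hqe).1 h1, h2, h3, h4⟩
        · rintro (⟨q, hq, h1, h2⟩ | ⟨⟨h1, h2⟩, h3⟩)
          · exact ⟨q, hq, by omega, h2⟩
          · exact ⟨e, heb, by omega, h3, h1, h2⟩
      refine Runs.nset_seq (v := D.rk i' e) (by simp [NExpr.eval, hs'.arr_rk i' hi4'])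
        (by simp [BExpr.cost, NExpr.cost]; omega) ?_
      refine Runs.nset_seq (v := δ e) (by simp [NExpr.eval, e11])
        (by simp [BExpr.cost, NExpr.cost]; omega) ?_
      refine Runs.nset_seq (v := β e) (by simp [NExpr.eval, e10])
        (by simp [BExpr.cost, NExpr.cost]; omega) ?_
      refine (runs_addRectangle ((((hs'.setReg (x := 24) (by norm_num) _).setReg (x := 30)
        (by norm_num) _).setReg (x := 31) (by norm_num) _).setReg (x := 32) (by norm_num) _) hblk
        (γ := D.rk i' e) (δ := δ e) (β := β e)
        (by simp [e25]) (by simp [e28]) (by simp [e29]) (by simp) (by simp) (by simp)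
        (by simpa using hI3)).mono ?_ ?_
      · simp only [BExpr.cost, NExpr.cost]
        omega
      · rintro s₂ hS₂ ⟨h1, h2, h3⟩
        refine ⟨fun x hx => ?_, fun x hx z hz => ?_, by simpa using h3, ?_⟩
        · simpa [hI1 x hx] using h1 x hx
        · have h4 := h2 x z hx
          simp at h4
          have h5 := hI2 x hx z hz
          simp only [State.setReg_narr, State.setReg_nreg]
          rw [hcov, ← or_assoc, ← h5]
          simpa using h4
        · have e20 : s₂.nreg 20 = s'.nreg 20 := by
            rw [hS₂.reg 20 (by simp [Prog.WritesReg, addRectangle, refresh, Prog.for])]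
            simp
          have hup : (∀ p, D.lo ≤ p → p < D.hi → D.rk i p < k + 1 → ∀ x, blk * D.B ≤ x →
              x < blk * D.B + D.B → D.Column i' x →
              D.Covered i i' β δ (D.rk i p) (D.rk i p) x) ↔
              ∀ p, D.lo ≤ p → p < D.hi → D.rk i p < k → ∀ x, blk * D.B ≤ x →
              x < blk * D.B + D.B → D.Column i' x →
              D.Covered i i' β δ (D.rk i p) (D.rk i p) x := by
            refine forall_congr' fun p => forall_congr' fun hp => forall_congr' fun hp' => ?_
            rw [hne p (by omega) (by omega)]
          rw [hup]
          exact ⟨fun h => by simpa [e20] using hI4.1 h, fun h => by simpa [e20] using hI4.2 h⟩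
    · have heb : ¬ e < D.b := by simpa [BExpr.Holds, NExpr.eval, hs'.reg_b] using h
      have hcov : ∀ z x, D.Covered i i' β δ (k + 1) z x ↔ D.Covered i i' β δ k z x := by
        intro z x
        refine exists_congr fun q => and_congr_right fun hq => ?_
        rw [hne q (by omega) (by omega)]
      have hsplit : (∀ p, D.lo ≤ p → p < D.hi → D.rk i p < k + 1 → ∀ x, blk * D.B ≤ x →
          x < blk * D.B + D.B → D.Column i' x → D.Covered i i' β δ (D.rk i p) (D.rk i p) x) ↔
          (∀ p, D.lo ≤ p → p < D.hi → D.rk i p < k → ∀ x, blk * D.B ≤ x →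
          x < blk * D.B + D.B → D.Column i' x → D.Covered i i' β δ (D.rk i p) (D.rk i p) x) ∧
          (D.lo ≤ e ∧ e < D.hi → ∀ x, blk * D.B ≤ x →
          x < blk * D.B + D.B → D.Column i' x → D.Covered i i' β δ k k x) := by
        constructor
        · intro H
          refine ⟨fun p h1 h2 h3 => H p h1 h2 (by omega), fun h1 => ?_⟩
          have := H e h1.1 h1.2 (by omega)
          rwa [hrko] at this
        · rintro ⟨H1, H2⟩ p h1 h2 h3
          by_cases hpe : p = e
          · subst hpe
            rw [hrko]
            exact H2 ⟨h1, h2⟩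
          · exact H1 p h1 h2 ((hne p (by omega) hpe).1 h3)
      have htest : gapTest.Holds w (s'.setReg 24 e) ↔
          (D.lo ≤ e ∧ e < D.hi) ∧ ¬ k < s'.nreg 26 ∧ ¬ k < s'.nreg 27 := by
        simp only [gapTest, BExpr.Holds, NExpr.eval, State.setReg_nreg]
        simp only [Nat.reduceEqDiff, if_true, if_false, hs'.reg_lo, hs'.reg_hi, h22, not_lt,
          and_assoc]
      have hgap : (k < s'.nreg 26 ∨ k < s'.nreg 27) ↔
          ∀ x, blk * D.B ≤ x → x < blk * D.B + D.B → D.Column i' x → D.Covered i i' β δ k k x := by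
        constructor
        · intro h1 x hx hx' hxC
          refine ((hI2 x ⟨hx, hx'⟩ k hk).1 (h1.imp_right fun h2 => ?_)).resolve_left (not_not.2 hxC)
          exact ((hI3 k).1 h2).2 x hx hx'
        · intro H
          by_contra! h1
          refine absurd ((hI3 k).2 ⟨hk, fun x hx hx' => ?_⟩) (by omega)
          refine ((hI2 x ⟨hx, hx'⟩ k hk).2 ?_).resolve_left (by omega)
          rw [or_iff_not_imp_left, not_not]
          exact H x hx hx'
      refine Runs.cond (by simp [BExpr.cost, NExpr.cost, gapTest]; omega)
          (fun h' => ?_) fun h' => ?_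
      · rw [htest] at h'
        refine Runs.nset (v := 0) (by simp [NExpr.eval]) ?_
          (by simp [BExpr.cost, NExpr.cost, gapTest]; omega)
        refine ⟨by simpa using hI1, ?_, by simpa using hI3, ?_⟩
        · simpa [hcov] using hI2
        · rw [hsplit]
          refine ⟨fun h1 => absurd (hgap.2 (h1.2 h'.1)) (by tauto), fun _ => by simp⟩
      · rw [htest] at h'
        refine Runs.skip ?_ (by simp [BExpr.cost, NExpr.cost, gapTest]; omega)
        refine ⟨by simpa using hI1, ?_, by simpa using hI3, ?_⟩
        · simpa [hcov] using hI2
        · rw [hsplit]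
          have h1 : D.lo ≤ e ∧ e < D.hi → ∀ x, blk * D.B ≤ x →
              x < blk * D.B + D.B → D.Column i' x → D.Covered i i' β δ k k x :=
            fun h1 => hgap.1 (by tauto)
          exact ⟨fun h => by simpa using hI4.1 h.1,
            fun h => by simpa using hI4.2 fun h2 => h ⟨h2, h1⟩⟩
  · rintro s' - ⟨h1, -, -, h2⟩
    refine ⟨h1, h2.congr ?_⟩
    refine forall_congr' fun p => forall_congr' fun hp => forall_congr' fun hp' => ?_
    simp [D.rk_lt i hi4 p (by omega)]
  · simp only [NExpr.cost, ← Finset.range_eq_Ico]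
    refine Nat.add_le_add (by norm_num) (Finset.sum_le_sum fun k _ => ?_)
    omega

theorem runs_pairTest (hs : D.Stored s) (hi4 : i < 4) (hj4 : j < 4) (hi4' : i' < 4)
    (hj4' : j' < 4) :
    Runs w (pairTest i j i' j') s (1000 * D.cost)
      (Verdict (PairCond D.rk D.b i j i' j' D.lo D.hi D.lo' D.hi') s) := by
  have hW := D.word
  have hM := D.M_le
  have hg := D.g_le
  refine Runs.seq (runs_exits hs hi4 hj4 (by norm_num) (by norm_num)
      (by norm_num) hs.reg_lo hs.reg_hi
    D.hi_le) (T₂ := 940 * D.cost) ?_ (by omega)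
  intro s₁ hS₁ hβ
  have hs₁ := hs.of_same hS₁ (by simp [Prog.Local, Prog.for, exits])
  have a20 : s₁.nreg 20 = s.nreg 20 := hS₁.reg 20 (by simp [Prog.WritesReg, exits, Prog.for])
  refine Runs.seq (runs_exits hs₁ hi4' hj4' (by norm_num) (by norm_num) (by norm_num) hs₁.reg_lo'
    hs₁.reg_hi' D.hi_le') (T₂ := 880 * D.cost) ?_ (by omega)
  intro s₂ hS₂ hδ
  have hs₂ := hs₁.of_same hS₂ (by simp [Prog.Local, Prog.for, exits])
  have b20 : s₂.nreg 20 = s₁.nreg 20 := hS₂.reg 20 (by simp [Prog.WritesReg, exits, Prog.for])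
  have b10 : s₂.narr 10 = s₁.narr 10 := hS₂.arr 10 (by simp [Prog.WritesArr, exits, Prog.for])
  refine Runs.seq (runs_initColumns hs₂ hi4') (T₂ := 830 * D.cost) ?_ (by omega)
  intro s₃ hS₃ hcol
  have hs₃ := hs₂.of_same hS₃ (by simp [Prog.Local, Prog.for, initColumns])
  have c20 : s₃.nreg 20 = s₂.nreg 20 := hS₃.reg 20 (by simp [Prog.WritesReg, initColumns, Prog.for])
  have c10 : s₃.narr 10 = s₂.narr 10 := hS₃.arr 10 (by simp [Prog.WritesArr, initColumns, Prog.for])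
  have c11 : s₃.narr 11 = s₂.narr 11 := hS₃.arr 11 (by simp [Prog.WritesArr, initColumns, Prog.for])
  generalize hβ' : s₁.narr 10 = β at *
  generalize hδ' : s₂.narr 11 = δ at *
  have hloc : (Prog.for 25 (.const 0) (.reg 6) (coverBlock i i')).Local := by
    simp [Prog.Local, Prog.for, coverBlock, coverRow, addRectangle, refresh]
  refine Runs.for (l := 0) (N := D.g) (fun k s' =>
      (∀ x, k * D.B ≤ x → x < D.g * D.B → s'.narr 12 x = s₃.narr 12 x) ∧
      Verdict (∀ p, D.lo ≤ p → p < D.hi → ∀ x, x < k * D.B → D.Column i' x →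
        D.Covered i i' β δ (D.rk i p) (D.rk i p) x) s₃ s')
    (fun blk => 120 * D.B + ∑ k ∈ Finset.range D.M, (150 +
        ((if D.rk i' (D.ord i k) / D.B = blk then 80 * D.B else 0) +
          if δ (D.ord i k) / D.B = blk then 80 * D.B else 0)))
    (by simp [NExpr.eval]) (Nat.zero_le _) (by omega)
    (by simp [Prog.WritesReg, coverBlock, coverRow, addRectangle, refresh, Prog.for])
    (fun s' hS => (hs₃.of_same hS hloc).reg_g) ?_ ?_ ?_ ?_
  · exact ⟨fun _ _ _ => rfl, by simp [Verdict]⟩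
  · rintro blk - hblk s' hS h25 ⟨hI1, hI2⟩
    have hs' := hs₃.of_same hS hloc
    have hend : blk * D.B + D.B ≤ D.g * D.B := by
      rw [← Nat.succ_mul]
      exact D.mul_B_le hblk
    have hB := D.B_pos
    refine (runs_coverBlock (β := β) (δ := δ) hs' hi4 hi4' hblk h25 ?_ ?_ ?_).mono le_rfl ?_
    · rw [hS.arr 10 (by simp [Prog.WritesArr, coverBlock, coverRow, addRectangle, refresh,
        Prog.for]),
        c10, b10]
    · rw [hS.arr 11 (by simp [Prog.WritesArr, coverBlock, coverRow, addRectangle, refresh,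
        Prog.for]),
        c11]
    · intro x hx hx' z hz
      rw [hI1 x hx (by omega)]
      exact hcol x (by omega) z hz
    · rintro s₅ - ⟨h1, h2⟩
      rw [Nat.succ_mul]
      refine ⟨fun x hx hx' => ?_, ?_⟩
      · rw [State.setReg_narr, h1 x (by omega), hI1 x (by omega) hx']
      · have h3 := (hI2.and h2).congr (B := ∀ p, D.lo ≤ p → p < D.hi → ∀ x, x < blk * D.B + D.B →
            D.Column i' x → D.Covered i i' β δ (D.rk i p) (D.rk i p) x) ?_
        · exact ⟨fun h => by simpa using h3.1 h, fun h => by simpa using h3.2 h⟩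
        · constructor
          · rintro ⟨h4, h5⟩ p hp hp' x hx
            by_cases hxb : x < blk * D.B
            · exact h4 p hp hp' x hxb
            · exact h5 p hp hp' x (by omega) hx
          · intro h
            exact ⟨fun p hp hp' x hx => h p hp hp' x (by omega),
              fun p hp hp' x _ hx => h p hp hp' x hx⟩
  · rintro s' - ⟨-, h⟩
    have hiff : (∀ p, D.lo ≤ p → p < D.hi → ∀ x, x < D.g * D.B → D.Column i' x →
        D.Covered i i' β δ (D.rk i p) (D.rk i p) x) ↔
        PairCond D.rk D.b i j i' j' D.lo D.hi D.lo' D.hi' := by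
      rw [pairCond_iff_cover hβ hδ D.b_le D.b_le' D.hi_le D.hi_le' D.rk_lt
        (fun j hj e he f hf h => D.rk_inj hj he hf h) hi4 hj4 hi4' hj4']
      refine forall_congr' fun p => forall_congr' fun hp => forall_congr' fun hp' => ?_
      have hhi := D.hi_le'
      have hb := D.b_le'
      have hbM := D.b_le_M
      constructor
      · intro H r hr hr'
        have hrM := D.rk_lt i' hi4' r (by omega)
        obtain ⟨q, hq, h1, h2, h3, h4⟩ := H _ (by omega) ⟨r, hr, hr', rfl⟩
        have h5 := mt (D.rk_inj hi4' (e := q) (f := r) (by omega) (by omega)) (by omega)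
        exact ⟨q, hq, h1, h2, by omega, h4⟩
      · rintro H x - ⟨r, hr, hr', rfl⟩
        obtain ⟨q, hq, h1, h2, h3, h4⟩ := H r hr hr'
        exact ⟨q, hq, h1, h2, h3.le, h4⟩
    have h' := h.congr hiff
    rwa [Verdict, c20, b20, a20] at h'
  · -- every interval of columns ends in two blocks only
    have hinner : ∀ k ∈ Finset.range D.M, ∑ blk ∈ Finset.range D.g, (150 +
        ((if D.rk i' (D.ord i k) / D.B = blk then 80 * D.B else 0) +
          if δ (D.ord i k) / D.B = blk then 80 * D.B else 0)) ≤ 150 * D.g + 160 * D.B := by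
      intro k _
      rw [Finset.sum_add_distrib, Finset.sum_add_distrib, Finset.sum_ite_eq, Finset.sum_ite_eq]
      simp only [Finset.sum_const, Finset.card_range, smul_eq_mul]
      split_ifs <;> omega
    have hsum : ∑ blk ∈ Finset.Ico 0 D.g, (120 * D.B + ∑ k ∈ Finset.range D.M, (150 +
        ((if D.rk i' (D.ord i k) / D.B = blk then 80 * D.B else 0) +
          if δ (D.ord i k) / D.B = blk then 80 * D.B else 0)) + 1 + 7) ≤
        D.g * (120 * D.B) + D.M * (150 * D.g + 160 * D.B) + 8 * D.g := by
      rw [← Finset.range_eq_Ico]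
      rw [Finset.sum_add_distrib, Finset.sum_add_distrib, Finset.sum_add_distrib, Finset.sum_comm]
      have := Finset.sum_le_card_nsmul _ _ _ hinner
      simp only [Finset.sum_const, Finset.card_range, smul_eq_mul] at this ⊢
      omega
    have h1 := D.M_mul_B_le
    have h2 := D.g_mul_B_le
    have h3 : D.M * D.g ≤ D.M * D.B :=
      Nat.mul_le_mul_left _ ((Nat.le_mul_of_pos_left _ D.g_pos).trans D.sq_le)
    have h4 := D.cost_pos
    simp only [NExpr.cost]
    nlinarith

end Cover

/-! ### Sorting by a tournament tree -/

/-- The value by which the elements `x < M` are sorted: the key `K x`, ties being broken by the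
index; everything else counts as infinite. -/
noncomputable def rankValue (K : ℕ → ℝ) (M x : ℕ) : WithTop (ℝ ×ₗ ℕ) :=
  if x < M then ((toLex (K x, x) : ℝ ×ₗ ℕ) : WithTop (ℝ ×ₗ ℕ)) else ⊤

theorem rankValue_lt_iff {K : ℕ → ℝ} {M x y : ℕ} : rankValue K M y < rankValue K M x ↔
    y < M ∧ (¬ x < M ∨ K y < K x ∨ K y = K x ∧ y < x) := by
  unfold rankValue
  by_cases hx : x < M <;> by_cases hy : y < M <;> simp [hx, hy, Prod.Lex.toLex_lt_toLex]

theorem rankValue_injOn {K : ℕ → ℝ} {M x y : ℕ} (hx : x < M) (hy : y < M)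
    (h : rankValue K M x = rankValue K M y) : x = y := by
  have h1 := mt (rankValue_lt_iff (K := K) (M := M) (x := x) (y := y)).2
      (by rw [h]; exact lt_irrefl _)
  have h2 := mt (rankValue_lt_iff (K := K) (M := M) (x := y) (y := x)).2
      (by rw [h]; exact lt_irrefl _)
  simp only [hx, hy, not_true_eq_false, false_or, true_and, not_or, not_and] at h1 h2
  have h3 : K x = K y := le_antisymm (not_lt.1 h1.1) (not_lt.1 h2.1)
  have := h1.2 h3.symm
  have := h2.2 h3
  omega

/-- Node `j` of the tree holds the winner of its two children. -/
def Pulled (K : ℕ → ℝ) (M : ℕ) (T : ℕ → ℕ) (j : ℕ) : Prop :=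
  rankValue K M (T (2 * j + 1)) < rankValue K M (T (2 * j)) ∧ T j = T (2 * j + 1) ∨
    ¬ rankValue K M (T (2 * j + 1)) < rankValue K M (T (2 * j)) ∧ T j = T (2 * j)

theorem Pulled.le {K : ℕ → ℝ} {M : ℕ} {T : ℕ → ℕ} {j : ℕ} (h : Pulled K M T j) :
    rankValue K M (T j) ≤ rankValue K M (T (2 * j)) ∧
      rankValue K M (T j) ≤ rankValue K M (T (2 * j + 1)) := by
  rcases h with ⟨h1, h2⟩ | ⟨h1, h2⟩
  · rw [h2]
    exact ⟨h1.le, le_rfl⟩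
  · rw [h2]
    exact ⟨le_rfl, not_lt.1 h1⟩

theorem root_le {K : ℕ → ℝ} {M : ℕ} {T : ℕ → ℕ} (hT : ∀ j, 1 ≤ j → j < M → Pulled K M T j) (j : ℕ)
    (hj : 1 ≤ j) (hj' : j < 2 * M) : rankValue K M (T 1) ≤ rankValue K M (T j) := by
  induction j using Nat.strong_induction_on with
  | _ j ih =>
    by_cases h1 : j = 1
    · rw [h1]
    · refine (ih (j / 2) (by omega) (by omega) (by omega)).trans ?_
      have h2 := (hT (j / 2) (by omega) (by omega)).le
      obtain h3 | h3 : 2 * (j / 2) = j ∨ 2 * (j / 2) + 1 = j := by omega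
      · rw [h3] at h2
        exact h2.1
      · rw [h3] at h2
        exact h2.2

theorem exists_leaf_eq {K : ℕ → ℝ} {M : ℕ} {T : ℕ → ℕ}
    (hT : ∀ j, 1 ≤ j → j < M → Pulled K M T j) (m j : ℕ) (hm : 2 * M - j = m)
    (hj : 1 ≤ j) (hj' : j < 2 * M) : ∃ e < M, T j = T (M + e) := by
  induction m using Nat.strong_induction_on generalizing j with
  | _ m ih =>
    by_cases h1 : M ≤ j
    · exact ⟨j - M, by omega, by rw [Nat.add_sub_cancel' h1]⟩
    · obtain ⟨-, h2⟩ | ⟨-, h2⟩ := hT j hj (by omega)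
      · rw [h2]
        exact ih (2 * M - (2 * j + 1)) (by omega) _ rfl (by omega) (by omega)
      · rw [h2]
        exact ih (2 * M - 2 * j) (by omega) _ rfl (by omega) (by omega)

/-- The state of the tournament after `t` rounds: the winners so far are `ord 0, …, ord (t - 1)`,
and their leaves have been emptied. -/
structure Tournament (K : ℕ → ℝ) (M t : ℕ) (T rk ord : ℕ → ℕ) : Prop where
  pulled : ∀ j, 1 ≤ j → j < M → Pulled K M T j
  leaf : ∀ e < M, T (M + e) = e ∨ T (M + e) = M ∧ ∃ t' < t, ord t' = e
  done : ∀ t' < t, ord t' < M ∧ rk (ord t') = t' ∧ T (M + ord t') = M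
  sorted : ∀ t₁ t₂, t₁ < t₂ → t₂ < t → rankValue K M (ord t₁) < rankValue K M (ord t₂)
  below : ∀ t' < t, ∀ e < M, T (M + e) = e → rankValue K M (ord t') < rankValue K M e

/-- `rk` ranks the elements below `M` by their keys, and `ord` is its inverse. -/
structure Sorted (K : ℕ → ℝ) (M : ℕ) (rk ord : ℕ → ℕ) : Prop where
  rk_lt : ∀ e < M, rk e < M
  ord_lt : ∀ t < M, ord t < M
  ord_rk : ∀ e < M, ord (rk e) = e
  rk_ord : ∀ t < M, rk (ord t) = t
  lt_iff : ∀ e < M, ∀ f < M, rk e < rk f ↔ rankValue K M e < rankValue K M f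

section
variable {K : ℕ → ℝ} {M t : ℕ} {T rk ord : ℕ → ℕ}

/-- As long as a leaf is left, the root holds the least element whose leaf has not been emptied. -/
theorem Tournament.root (h : Tournament K M t T rk ord) (ht : t < M) :
    T 1 < M ∧ T (M + T 1) = T 1 ∧
      ∀ e < M, T (M + e) = e → rankValue K M (T 1) ≤ rankValue K M e := by
  have halive : ∃ e < M, T (M + e) = e := by
    by_contra! hno
    have hsub : Finset.range M ⊆ (Finset.range t).image ord := by
      intro e he
      rw [Finset.mem_range] at he
      obtain ⟨-, t', ht', h'⟩ := (h.leaf e he).resolve_left (hno e he)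
      exact Finset.mem_image.2 ⟨t', Finset.mem_range.2 ht', h'⟩
    have := (Finset.card_le_card hsub).trans Finset.card_image_le
    simp only [Finset.card_range] at this
    omega
  have hle : ∀ e < M, T (M + e) = e → rankValue K M (T 1) ≤ rankValue K M e := by
    intro e he he'
    have := root_le h.pulled (M + e) (by omega) (by omega)
    rwa [he'] at this
  obtain ⟨e, he, he'⟩ := halive
  have hlt : T 1 < M := by
    by_contra hM
    have h1 := hle e he he'
    rw [rankValue, if_neg hM, rankValue, if_pos he] at h1
    exact absurd h1 (by simp)
  obtain ⟨f, hf, hf'⟩ := exists_leaf_eq h.pulled _ 1 rfl le_rfl (by omega)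
  obtain h2 | ⟨h2, -⟩ := h.leaf f hf
  · have h3 : T 1 = f := hf'.trans h2
    exact ⟨hlt, by rw [h3, h2], hle⟩
  · omega

/-- One round: the winner receives the next rank and its leaf is emptied. -/
theorem Tournament.step (h : Tournament K M t T rk ord) (ht : t < M) {T' rk' ord' : ℕ → ℕ}
    (hpull : ∀ j, 1 ≤ j → j < M → Pulled K M T' j)
    (hT : ∀ e < M, T' (M + e) = if e = T 1 then M else T (M + e))
    (hrk : ∀ e, rk' e = if e = T 1 then t else rk e)
    (hord : ∀ x, ord' x = if x = t then T 1 else ord x) :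
    Tournament K M (t + 1) T' rk' ord' := by
  obtain ⟨h1, h2, h3⟩ := h.root ht
  have hne : ∀ t' < t, ord t' ≠ T 1 := by
    intro t' ht' he
    have := (h.done t' ht').2.2
    rw [he, h2] at this
    omega
  refine ⟨hpull, ?_, ?_, ?_, ?_⟩
  · intro e he
    rw [hT e he]
    by_cases hr : e = T 1
    · rw [if_pos hr]
      exact .inr ⟨rfl, t, by omega, by rw [hord, if_pos rfl, hr]⟩
    · rw [if_neg hr]
      refine (h.leaf e he).imp_right ?_
      rintro ⟨h4, t', ht', h5⟩
      exact ⟨h4, t', by omega, by rw [hord, if_neg (by omega), h5]⟩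
  · intro t' ht'
    by_cases htt : t' = t
    · rw [hord, if_pos htt, hrk, if_pos rfl, hT _ h1, if_pos rfl]
      exact ⟨h1, htt.symm, rfl⟩
    · have h4 := h.done t' (by omega)
      have h5 := hne t' (by omega)
      rw [hord, if_neg htt, hrk, if_neg h5, hT _ h4.1, if_neg h5]
      exact h4
  · intro t₁ t₂ h4 h5
    rw [hord t₁, if_neg (by omega), hord t₂]
    split_ifs with h6
    · exact h.below t₁ (by omega) _ h1 h2
    · exact h.sorted t₁ t₂ h4 (by omega)
  · intro t' ht' e he he'
    rw [hT e he] at he'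
    have hr : e ≠ T 1 := by
      intro hr
      rw [if_pos hr] at he'
      omega
    rw [if_neg hr] at he'
    rw [hord]
    split_ifs with htt
    · refine lt_of_le_of_ne (h3 e he he') fun h4 => hr (rankValue_injOn h1 he h4).symm
    · exact h.below t' (by omega) e he he'

theorem Tournament.sorted_of_finished (h : Tournament K M M T rk ord) : Sorted K M rk ord := by
  have himage : (Finset.range M).image ord = Finset.range M := by
    refine Finset.eq_of_subset_of_card_le ?_ ?_
    · intro e he
      obtain ⟨t, ht, rfl⟩ := Finset.mem_image.1 he
      exact Finset.mem_range.2 (h.done t (Finset.mem_range.1 ht)).1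
    · rw [Finset.card_image_of_injOn]
      intro x hx y hy hxy
      rw [← (h.done x (by simpa using hx)).2.1, hxy, (h.done y (by simpa using hy)).2.1]
  have hsurj : ∀ e < M, ∃ t < M, ord t = e := by
    intro e he
    rw [← Finset.mem_range, ← himage] at he
    simpa using he
  have hlt : ∀ t₁ < M, ∀ t₂ < M, t₁ < t₂ ↔ rankValue K M (ord t₁) < rankValue K M (ord t₂) := by
    intro t₁ h1 t₂ h2
    refine ⟨fun h3 => h.sorted _ _ h3 h2, fun h3 => ?_⟩
    by_contra h4
    obtain h5 | rfl : t₂ < t₁ ∨ t₁ = t₂ := by omega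
    · exact lt_asymm h3 (h.sorted _ _ h5 h1)
    · exact lt_irrefl _ h3
  refine ⟨?_, fun t ht => (h.done t ht).1, ?_, fun t ht => (h.done t ht).2.1, ?_⟩
  · intro e he
    obtain ⟨t, ht, rfl⟩ := hsurj e he
    rwa [(h.done t ht).2.1]
  · intro e he
    obtain ⟨t, ht, rfl⟩ := hsurj e he
    rw [(h.done t ht).2.1]
  · intro e he f hf
    obtain ⟨t, ht, rfl⟩ := hsurj e he
    obtain ⟨t', ht', rfl⟩ := hsurj f hf
    rw [(h.done t ht).2.1, (h.done t' ht').2.1]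
    exact hlt t ht t' ht'

end

/-- Node `j` of the tree, where `j` is in register `22`, receives the winner of its children. -/
def pull (i : ℕ) : Prog :=
  .seq (.nset 23 (.get 8 (.mul (.const 2) (.reg 22))))
  (.seq (.nset 24 (.get 8 (.add (.mul (.const 2) (.reg 22)) (.const 1))))
  (.ite (.and (.nlt (.reg 24) (.reg 5)) (.or (.not (.nlt (.reg 23) (.reg 5)))
      (.or (.rlt (.get (12 + i) (.reg 24)) (.get (12 + i) (.reg 23)))
      (.and (.not (.rlt (.get (12 + i) (.reg 23)) (.get (12 + i) (.reg 24))))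
        (.nlt (.reg 24) (.reg 23))))))
    (.nstore 8 (.reg 22) (.reg 24)) (.nstore 8 (.reg 22) (.reg 23))))

/-- The tree of a tournament of all elements, with the elements `0, …, M - 1` at the leaves
`M, …, 2 * M - 1`. -/
def buildTree (i : ℕ) : Prog :=
  .seq (.for 21 (.const 0) (.reg 5) (.nstore 8 (.add (.reg 5) (.reg 21)) (.reg 21)))
    (.for 21 (.const 1) (.reg 5) (.seq (.nset 22 (.sub (.reg 5) (.reg 21))) (pull i)))

/-- The nodes on the way from register `22` to the root are recomputed. -/
def repairPath (i : ℕ) : Prog :=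
  .loop (.nlt (.const 0) (.reg 22)) (.seq (pull i) (.nset 22 (.div (.reg 22) (.const 2))))

/-- Sorting by the keys in real array `12 + i`: word array `i` receives the ranks, and word array
`4 + i` their inverse. -/
def sort (i : ℕ) : Prog :=
  .seq (buildTree i) (.for 21 (.const 0) (.reg 5)
    (.seq (.nset 25 (.get 8 (.const 1)))
    (.seq (.nstore (4 + i) (.reg 21) (.reg 25))
    (.seq (.nstore i (.reg 25) (.reg 21))
    (.seq (.nstore 8 (.add (.reg 5) (.reg 25)) (.reg 5))
    (.seq (.nset 22 (.div (.add (.reg 5) (.reg 25)) (.const 2))) (repairPath i)))))))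

section SortRules
variable {w M i : ℕ} {s : State} {K : ℕ → ℝ}

theorem runs_pull (hW : 8 * M + 64 ≤ 2 ^ w) (h5 : s.nreg 5 = M) (hK : s.rarr (12 + i) = K) {j : ℕ}
    (h22 : s.nreg 22 = j) (hj : 1 ≤ j) (hj' : j < M) :
    Runs w (pull i) s 50 fun s' => Pulled K M (s'.narr 8) j ∧
      ∀ x, x ≠ j → s'.narr 8 x = s.narr 8 x := by
  have h2W : 2 % 2 ^ w = 2 := Nat.mod_eq_of_lt (by omega)
  have h1W : 1 % 2 ^ w = 1 := Nat.mod_eq_of_lt (by omega)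
  have hjW : (2 * j) % 2 ^ w = 2 * j := Nat.mod_eq_of_lt (by omega)
  have hjW' : (2 * j + 1) % 2 ^ w = 2 * j + 1 := Nat.mod_eq_of_lt (by omega)
  refine Runs.nset_seq (v := s.narr 8 (2 * j)) (by simp [NExpr.eval, h22, h2W, hjW])
    (by simp [NExpr.cost]) ?_
  refine Runs.nset_seq (v := s.narr 8 (2 * j + 1)) ?_ (by simp [NExpr.cost]) ?_
  · simp [NExpr.eval, h22, h2W, hjW, h1W, hjW']
  generalize hx : s.narr 8 (2 * j) = x
  generalize hy : s.narr 8 (2 * j + 1) = y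
  have htest : BExpr.Holds w ((s.setReg 23 x).setReg 24 y)
      (.and (.nlt (.reg 24) (.reg 5)) (.or (.not (.nlt (.reg 23) (.reg 5)))
      (.or (.rlt (.get (12 + i) (.reg 24)) (.get (12 + i) (.reg 23)))
      (.and (.not (.rlt (.get (12 + i) (.reg 23)) (.get (12 + i) (.reg 24))))
        (.nlt (.reg 24) (.reg 23)))))) ↔ rankValue K M y < rankValue K M x := by
    have heq : (K y < K x ∨ ¬ K x < K y ∧ y < x) ↔ K y < K x ∨ K y = K x ∧ y < x := by
      constructor
      · rintro (h | ⟨h, h'⟩)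
        · exact .inl h
        · exact (lt_or_eq_of_le (not_lt.1 h)).imp_right fun h => ⟨h, h'⟩
      · rintro (h | ⟨h, h'⟩)
        · exact .inl h
        · exact .inr ⟨h.not_gt, h'⟩
    rw [rankValue_lt_iff, ← heq]
    simp [BExpr.Holds, NExpr.eval, RExpr.eval, h5, hK]
  have hpulled : ∀ v, (rankValue K M y < rankValue K M x ∧ v = y ∨
      ¬ rankValue K M y < rankValue K M x ∧ v = x) →
      Pulled K M (((s.setReg 23 x).setReg 24 y).store 8 j v |>.narr 8) j := by
    intro v hv
    have e1 : 2 * j ≠ j := by omega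
    have e2 : 2 * j + 1 ≠ j := by omega
    simpa [Pulled, e1, e2, hx, hy] using hv
  refine Runs.cond (by simp [BExpr.cost, NExpr.cost, RExpr.cost]) (fun h => ?_) fun h => ?_
  · rw [htest] at h
    refine Runs.nstore (k := j) (v := y) (by simp [NExpr.eval, h22]) (by simp [NExpr.eval]) ?_
      (by simp [BExpr.cost, NExpr.cost, RExpr.cost])
    exact ⟨hpulled y (.inl ⟨h, rfl⟩), fun z hz => by simp [hz]⟩
  · rw [htest] at h
    refine Runs.nstore (k := j) (v := x) (by simp [NExpr.eval, h22]) (by simp [NExpr.eval]) ?_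
      (by simp [BExpr.cost, NExpr.cost, RExpr.cost])
    exact ⟨hpulled x (.inr ⟨h, rfl⟩), fun z hz => by simp [hz]⟩

theorem Pulled.congr {T T' : ℕ → ℕ} {j : ℕ} (h : Pulled K M T j) (h0 : T' j = T j)
    (h1 : T' (2 * j) = T (2 * j)) (h2 : T' (2 * j + 1) = T (2 * j + 1)) : Pulled K M T' j := by
  rwa [Pulled, h0, h1, h2]

theorem runs_buildTree (hW : 8 * M + 64 ≤ 2 ^ w) (hM : 1 ≤ M) (h5 : s.nreg 5 = M)
    (hK : s.rarr (12 + i) = K) :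
    Runs w (buildTree i) s (100 * M + 20) fun s' =>
      (∀ j, 1 ≤ j → j < M → Pulled K M (s'.narr 8) j) ∧ ∀ e < M, s'.narr 8 (M + e) = e := by
  refine Runs.seq (T₁ := 20 * M + 10) (T₂ := 80 * M + 10)
    (R := fun s' => ∀ e < M, s'.narr 8 (M + e) = e) ?_ ?_ (by omega)
  · refine Runs.for_const (l := 0) (N := M) (T := 5) (fun k s' => ∀ e < k, s'.narr 8 (M + e) = e)
      (by simp [NExpr.eval]) (Nat.zero_le _) (by omega) (by simp [Prog.WritesReg])
      (fun s' hS => (hS.reg 5 (by simp [Prog.WritesReg, Prog.for])).trans h5) (by simp) ?_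
      (fun _ _ h => h) ?_
    · rintro k - hk s' hS h21 hI
      have e5 := (hS.reg 5 (by simp [Prog.WritesReg, Prog.for])).trans h5
      refine Runs.nstore (k := M + k) (v := k) ?_ (by simp [NExpr.eval, h21]) ?_
        (by simp [NExpr.cost])
      · simp only [NExpr.eval, e5, h21]
        exact Nat.mod_eq_of_lt (by omega)
      · intro e he
        by_cases hek : e = k
        · simp [hek]
        · simpa [hek] using hI e (by omega)
    · simp only [NExpr.cost]
      omega
  · intro s₁ hS₁ hleaf
    have h5₁ := (hS₁.reg 5 (by simp [Prog.WritesReg, Prog.for])).trans h5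
    have hK₁ := (hS₁.real (12 + i) (by simp [Prog.WritesReal, Prog.for])).trans hK
    have h1W : 1 % 2 ^ w = 1 := Nat.mod_eq_of_lt (by omega)
    refine Runs.for_const (l := 1) (N := M) (T := 60) (fun k s' =>
      (∀ j, 1 ≤ j → M < j + k → j < M → Pulled K M (s'.narr 8) j) ∧ ∀ e < M, s'.narr 8 (M + e) = e)
      h1W hM (by omega) (by simp [Prog.WritesReg, pull])
      (fun s' hS => (hS.reg 5 (by simp [Prog.WritesReg, Prog.for, pull])).trans h5₁)
      ⟨fun j _ _ _ => by omega, by simpa using hleaf⟩ ?_ ?_ ?_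
    · rintro k hk hk' s' hS h21 ⟨hI1, hI2⟩
      have e5 := (hS.reg 5 (by simp [Prog.WritesReg, Prog.for, pull])).trans h5₁
      have eK := (hS.real (12 + i) (by simp [Prog.WritesReal, Prog.for, pull])).trans hK₁
      refine Runs.nset_seq (v := M - k) (by simp [NExpr.eval, e5, h21]) (by simp [NExpr.cost]) ?_
      refine (runs_pull (s := s'.setReg 22 (M - k)) (K := K) hW (by simp [e5]) (by simp [eK])
          (j := M - k)
        (by simp) (by omega) (by omega)).mono (by simp [NExpr.cost]) ?_
      rintro s'' - ⟨h1, h2⟩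
      simp only [State.setReg_narr] at h2 ⊢
      refine ⟨fun j hj hj' hj'' => ?_, fun e he => ?_⟩
      · by_cases hjk : j = M - k
        · rwa [hjk]
        · exact (hI1 j hj (by omega) hj'').congr (h2 _ (by omega)) (h2 _ (by omega))
            (h2 _ (by omega))
      · rw [h2 _ (by omega), hI2 e he]
    · rintro s' - ⟨h1, h2⟩
      exact ⟨fun j hj hj' => h1 j hj (by omega) hj', h2⟩
    · simp only [NExpr.cost]
      omega

theorem runs_repairPath (hW : 8 * M + 64 ≤ 2 ^ w) {L : ℕ} (hL : M ≤ 2 ^ L) (h5 : s.nreg 5 = M)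
    (hK : s.rarr (12 + i) = K) {j : ℕ} (h22 : s.nreg 22 = j) (hj : j < M)
    (hT : ∀ x, 1 ≤ x → x < M → x ≠ j → Pulled K M (s.narr 8) x) :
    Runs w (repairPath i) s (70 * L + 10) fun s' =>
      (∀ x, 1 ≤ x → x < M → Pulled K M (s'.narr 8) x) ∧
        ∀ e, s'.narr 8 (M + e) = s.narr 8 (M + e) := by
  have h2W : 2 % 2 ^ w = 2 := Nat.mod_eq_of_lt (by omega)
  refine Runs.loop (N := L) (T := 60) (fun k s' => s'.nreg 22 < M ∧ s'.nreg 22 < 2 ^ k ∧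
      (∀ x, 1 ≤ x → x < M → x ≠ s'.nreg 22 → Pulled K M (s'.narr 8) x) ∧
        ∀ e, s'.narr 8 (M + e) = s.narr 8 (M + e))
    ⟨by omega, by omega, by rwa [h22], fun _ => rfl⟩ ?_ ?_ ?_ ?_
  · rintro k s' hS ⟨hI1, hI2, hI3, hI4⟩ hb
    have e5 := (hS.reg 5 (by simp [Prog.WritesReg, pull])).trans h5
    have eK := (hS.real (12 + i) (by simp [Prog.WritesReal, pull])).trans hK
    simp only [BExpr.Holds, NExpr.eval, Nat.zero_mod] at hb
    refine Runs.seq (runs_pull hW e5 eK rfl (by omega) hI1) (T₂ := 4) ?_ (by norm_num)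
    rintro s'' hS' ⟨h1, h2⟩
    have e22 := hS'.reg 22 (by simp [Prog.WritesReg, pull])
    refine Runs.nset (v := s'.nreg 22 / 2) (by simp [NExpr.eval, e22, h2W]) ?_
        (by simp [NExpr.cost])
    simp only [State.setReg_nreg, if_true, State.setReg_narr]
    refine ⟨by omega, ?_, fun x hx hx' hne => ?_, fun e => ?_⟩
    · rw [pow_succ] at hI2
      omega
    · by_cases hxj : x = s'.nreg 22
      · rwa [hxj]
      · exact (hI3 x hx hx' hxj).congr (h2 _ hxj) (h2 _ (by omega)) (h2 _ (by omega))
    · rw [h2 _ (by omega), hI4]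
  · rintro s' - ⟨-, h1, -⟩ hb
    simp only [BExpr.Holds, NExpr.eval, Nat.zero_mod] at hb
    omega
  · rintro k s' - ⟨-, -, h1, h2⟩ hb
    simp only [BExpr.Holds, NExpr.eval, Nat.zero_mod] at hb
    exact ⟨fun x hx hx' => h1 x hx hx' (by omega), h2⟩
  · simp only [BExpr.cost, NExpr.cost]
    omega

theorem runs_sort (hW : 8 * M + 64 ≤ 2 ^ w) (hM : 1 ≤ M) {L : ℕ} (hL : M ≤ 2 ^ L) (hi4 : i < 4)
    (h5 : s.nreg 5 = M) (hK : s.rarr (12 + i) = K) :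
    Runs w (sort i) s (M * (70 * L + 200) + 50) fun s' =>
      Sorted K M (s'.narr i) (s'.narr (4 + i)) := by
  refine Runs.seq (runs_buildTree hW hM h5 hK) (T₂ := M * (70 * L + 100) + 30) ?_
    (by ring_nf; omega)
  rintro s₁ hS₁ ⟨hpull, hleaf⟩
  have h5₁ := (hS₁.reg 5 (by simp [Prog.WritesReg, Prog.for, buildTree, pull])).trans h5
  have hK₁ := (hS₁.real (12 + i) (by simp [Prog.WritesReal, Prog.for, buildTree, pull])).trans hK
  have h1W : 1 % 2 ^ w = 1 := Nat.mod_eq_of_lt (by omega)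
  have h2W : 2 % 2 ^ w = 2 := Nat.mod_eq_of_lt (by omega)
  refine Runs.for_const (l := 0) (N := M) (T := 70 * L + 60) (fun k s' =>
      Tournament K M k (s'.narr 8) (s'.narr i) (s'.narr (4 + i)))
    (by simp [NExpr.eval]) (Nat.zero_le _) (by omega)
    (by simp [Prog.WritesReg, pull, repairPath])
    (fun s' hS => (hS.reg 5 (by simp [Prog.WritesReg, Prog.for, pull, repairPath])).trans h5₁)
    ⟨hpull, fun e he => .inl (hleaf e he), by simp, by simp, by simp⟩ ?_
    (fun s' _ h => h.sorted_of_finished) ?_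
  · rintro k - hk s' hS h21 hI
    have e5 := (hS.reg 5 (by simp [Prog.WritesReg, Prog.for, pull, repairPath])).trans h5₁
    have eK := (hS.real (12 + i) (by simp [Prog.WritesReal, Prog.for, pull, repairPath])).trans hK₁
    obtain ⟨hr1, hr2, hr3⟩ := hI.root hk
    refine Runs.nset_seq (v := s'.narr 8 1) (by simp [NExpr.eval, h1W]) (by simp [NExpr.cost])
      ?_
    generalize he : s'.narr 8 1 = e at *
    refine Runs.nstore_seq (k := k) (v := e) (by simp [NExpr.eval, h21]) (by simp [NExpr.eval])
      (by simp [NExpr.cost]) ?_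
    refine Runs.nstore_seq (k := e) (v := k) (by simp [NExpr.eval]) (by simp [NExpr.eval, h21])
      (by simp [NExpr.cost]) ?_
    refine Runs.nstore_seq (k := M + e) (v := M) ?_ (by simp [NExpr.eval, e5])
      (by simp [NExpr.cost]) ?_
    · simpa [NExpr.eval, e5] using Nat.mod_eq_of_lt (by omega)
    refine Runs.nset_seq (v := (M + e) / 2) ?_ (by simp [NExpr.cost]) ?_
    · have : (M + e) % 2 ^ w = M + e := Nat.mod_eq_of_lt (by omega)
      simp [NExpr.eval, e5, h2W, this]
    generalize hs₂ : ((((s'.setReg 25 e).store (4 + i) k e).store i e k).store 8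
        (M + e) M).setReg 22
      ((M + e) / 2) = s₂
    have a8 : ∀ x, s₂.narr 8 x = if x = M + e then M else s'.narr 8 x := by
      intro x
      simp [← hs₂, show (8 : ℕ) ≠ 4 + i by omega, show (8 : ℕ) ≠ i by omega]
    have ai : ∀ x, s₂.narr i x = if x = e then k else s'.narr i x := by
      intro x
      simp [← hs₂, show i ≠ 8 by omega]
    have ao : ∀ x, s₂.narr (4 + i) x = if x = k then e else s'.narr (4 + i) x := by
      intro x
      simp [← hs₂, show 4 + i ≠ 8 by omega]
    refine (runs_repairPath (K := K) hW hL (j := (M + e) / 2) (by simp [← hs₂, e5])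
        (by simp [← hs₂, eK])
      (by simp [← hs₂]) (by omega) ?_).mono (by simp [NExpr.cost]) ?_
    · intro x hx hx' hne
      refine (hI.pulled x hx hx').congr ?_ ?_ ?_ <;> rw [a8, if_neg (by omega)]
    · rintro s₃ hS₃ ⟨h1, h2⟩
      have b1 : s₃.narr i = s₂.narr i :=
        hS₃.arr i (by simp [Prog.WritesArr, pull, repairPath]; omega)
      have b2 : s₃.narr (4 + i) = s₂.narr (4 + i) :=
        hS₃.arr (4 + i) (by simp [Prog.WritesArr, pull, repairPath]; omega)
      simp only [State.setReg_narr, b1, b2]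
      refine hI.step hk h1 (fun x hx => ?_) (fun x => by rw [ai, he]) fun x => by rw [ao, he]
      rw [h2, a8, he]
      simp only [Nat.add_left_cancel_iff]
  · simp only [NExpr.cost, Nat.sub_zero]
    ring_nf
    omega

end SortRules

/-! ### The algorithm -/

/-- Register `6` receives the least `g` with `M ≤ g ^ 4`, and register `7` receives `g ^ 3`. -/
def blockSize : Prog :=
  .seq (.nset 6 (.const 0)) (.seq (.loop
    (.nlt (.mul (.mul (.reg 6) (.reg 6)) (.mul (.reg 6) (.reg 6))) (.reg 5))
    (.nset 6 (.add (.reg 6) (.const 1))))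
    (.nset 7 (.mul (.mul (.reg 6) (.reg 6)) (.reg 6))))

/-- The keys of one family: the elements are numbered from register `o` on, their number is in
register `n`, and the real arrays `u₀`, `u₁`, `u₂`, `u₃` hold the four coordinates to be used, of
which `u₁` and `u₃` change their sign. -/
def fillKeys (o n u₀ u₁ u₂ u₃ : ℕ) : Prog :=
  .for 21 (.const 0) (.reg n)
    (.seq (.rstore 12 (.add (.reg o) (.reg 21)) (.get u₀ (.reg 21)))
    (.seq (.rstore 13 (.add (.reg o) (.reg 21)) (.sub (.ofWord (.const 0)) (.get u₁ (.reg 21))))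
    (.seq (.rstore 14 (.add (.reg o) (.reg 21)) (.get u₂ (.reg 21)))
      (.rstore 15 (.add (.reg o) (.reg 21)) (.sub (.ofWord (.const 0)) (.get u₃ (.reg 21)))))))

/-- The elements are numbered, first the members of `Q`, then those of `P` and of `R`, and ranked in
all four coordinates. -/
def setup : Prog :=
  .seq (.nset 4 (.add (.reg 1) (.reg 0))) (.seq (.nset 5 (.add (.reg 4) (.reg 2)))
    (.seq (.nset 3 (.const 0)) (.seq blockSize
    (.seq (fillKeys 3 1 4 5 6 7) (.seq (fillKeys 1 0 1 0 3 2) (.seq (fillKeys 4 2 9 8 11 10)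
    (.seq (sort 0) (.seq (sort 1) (.seq (sort 2) (sort 3))))))))))

/-- The intervals `[lo, hi)` and `[lo', hi')` are given by the registers `l`, `h`, `l'`, `h'`. -/
def setSides (l h l' h' : ℕ) : Prog :=
  .seq (.nset 12 (.reg l)) (.seq (.nset 13 (.reg h)) (.seq (.nset 14 (.reg l')) (.nset 15
      (.reg h'))))

/-- The tests for the mixtures with at least three coordinates from an element of `[lo, hi)`. -/
def domTests : Prog := .seq (domTest 0) (.seq (domTest 1) (.seq (domTest 2) (domTest 3)))

/-- The tests for the mixtures with two coordinates from each side. -/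
def pairTests : Prog :=
  .seq (pairTest 0 1 2 3) (.seq (pairTest 2 3 0 1) (.seq (pairTest 0 2 1 3) (.seq (pairTest 1 3 0 2)
    (.seq (pairTest 0 3 1 2) (pairTest 1 2 0 3)))))

/-- The algorithm: if `P` or `R` is empty the answer is positive, otherwise it is the conjunction of
the tests for all mixtures. -/
def algorithm : Prog :=
  .ite (.or (.neq (.reg 0) (.const 0)) (.neq (.reg 2) (.const 0))) (.nset 0 (.const 1))
    (.seq setup (.seq (.nset 20 (.const 1)) (.seq (setSides 1 4 4 5) (.seq (.seq domTests pairTests)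
      (.seq (setSides 4 5 1 4) (.seq domTests (.nset 0 (.reg 20))))))))

/-- The number `g` of blocks: the least fourth root from above, which is at most twice too large. -/
theorem exists_root {M : ℕ} (hM : 1 ≤ M) :
    ∃ g, 1 ≤ g ∧ M ≤ g ^ 4 ∧ g ^ 4 ≤ 16 * M ∧ ∀ c < g, c ^ 4 < M := by
  have hex : ∃ g, M ≤ g ^ 4 := ⟨M, Nat.le_self_pow (by norm_num) M⟩
  classical
  have hlt : ∀ c < Nat.find hex, c ^ 4 < M := fun c hc => not_le.1 (Nat.find_min hex hc)
  have hpos : 1 ≤ Nat.find hex := by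
    by_contra h
    have h0 : Nat.find hex = 0 := by omega
    have := Nat.find_spec hex
    rw [h0] at this
    omega
  refine ⟨Nat.find hex, hpos, Nat.find_spec hex, ?_, hlt⟩
  have h1 := hlt (Nat.find hex - 1) (by omega)
  obtain ⟨m, hm⟩ : ∃ m, Nat.find hex = m + 1 := ⟨Nat.find hex - 1, by omega⟩
  rw [hm] at h1 ⊢
  rw [Nat.add_sub_cancel] at h1
  obtain rfl | hm0 := Nat.eq_zero_or_pos m
  · omega
  · have h2 : (m + 1) ^ 4 ≤ (2 * m) ^ 4 := Nat.pow_le_pow_left (by omega) 4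
    rw [mul_pow] at h2
    omega

section Setup
variable {w M g : ℕ} {s : State}

theorem runs_blockSize (hW : 128 * M + 64 ≤ 2 ^ w) (h5 : s.nreg 5 = M) (hM : M ≤ g ^ 4)
    (hg : g ^ 4 ≤ 16 * M) (hg1 : 1 ≤ g) (hlt : ∀ c < g, c ^ 4 < M) :
    Runs w blockSize s (30 * g + 40) fun s' => s'.nreg 6 = g ∧ s'.nreg 7 = g * g * g := by
  have h1W : 1 % 2 ^ w = 1 := Nat.mod_eq_of_lt (by omega)
  have hgpow : g ≤ g ^ 4 := Nat.le_self_pow (by norm_num) g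
  have hsmall : ∀ c ≤ g, c * c < 2 ^ w ∧ c * c * c < 2 ^ w ∧ c * c * (c * c) < 2 ^ w := by
    intro c hc
    have h1 : c ^ 2 ≤ g ^ 4 := (Nat.pow_le_pow_left hc 2).trans (Nat.pow_le_pow_right hg1
        (by norm_num))
    have h2 : c ^ 3 ≤ g ^ 4 := (Nat.pow_le_pow_left hc 3).trans (Nat.pow_le_pow_right hg1
        (by norm_num))
    have h3 : c ^ 4 ≤ g ^ 4 := Nat.pow_le_pow_left hc 4
    have e1 : c * c = c ^ 2 := by ring
    have e2 : c * c * c = c ^ 3 := by ring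
    have e3 : c * c * (c * c) = c ^ 4 := by ring
    rw [e3, e2, e1]
    omega
  refine Runs.nset_seq (v := 0) (by simp [NExpr.eval]) (by simp [NExpr.cost]) ?_
  refine Runs.seq (T₁ := 20 * g + 20) (T₂ := 10) (R := fun s' => s'.nreg 6 = g) ?_ ?_
    (by simp [NExpr.cost]; omega)
  · have hcond : ∀ s' : State, s'.nreg 5 = M → s'.nreg 6 ≤ g →
        (BExpr.Holds w s' (.nlt (.mul (.mul (.reg 6) (.reg 6)) (.mul (.reg 6) (.reg 6))) (.reg 5)) ↔
          s'.nreg 6 < g) := by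
      intro s' h5' h6
      obtain ⟨h1, -, h3⟩ := hsmall _ h6
      simp only [BExpr.Holds, NExpr.eval, h5', Nat.mod_eq_of_lt h1, Nat.mod_eq_of_lt h3]
      have e3 : s'.nreg 6 * s'.nreg 6 * (s'.nreg 6 * s'.nreg 6) = s'.nreg 6 ^ 4 := by ring
      rw [e3]
      refine ⟨fun h => ?_, hlt _⟩
      by_contra h'
      obtain h'' : s'.nreg 6 = g := by omega
      rw [h''] at h
      omega
    have h5' : ∀ s', Same (.nset 6 (.add (.reg 6) (.const 1))) (s.setReg 6 0) s' → s'.nreg 5 = M :=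
      fun s' hS => (hS.reg 5 (by simp [Prog.WritesReg])).trans (by simp [h5])
    refine Runs.loop (N := g) (T := 4) (fun k s' => s'.nreg 6 + k = g) (by simp) ?_ ?_ ?_ ?_
    · intro k s' hS hI _
      refine Runs.nset (v := s'.nreg 6 + 1) ?_ (by simp; omega) (by simp [NExpr.cost])
      simp only [NExpr.eval, h1W]
      exact Nat.mod_eq_of_lt (by omega)
    · intro s' hS hI
      rw [hcond s' (h5' s' hS) (by omega)]
      omega
    · intro k s' hS hI hb
      rw [hcond s' (h5' s' hS) (by omega)] at hb
      omega
    · simp only [BExpr.cost, NExpr.cost]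
      omega
  · intro s' _ h6
    obtain ⟨h1, h2, -⟩ := hsmall g le_rfl
    refine Runs.nset (v := g * g * g) ?_ (by simp [h6]) (by simp [NExpr.cost])
    simp only [NExpr.eval, h6, Nat.mod_eq_of_lt h1, Nat.mod_eq_of_lt h2]

/-- The keys that `fillKeys` computes for the member `e` of a family. -/
def familyKey (s : State) (u₀ u₁ u₂ u₃ : ℕ) : ℕ → ℕ → ℝ
  | 0, e => s.rarr u₀ e
  | 1, e => -s.rarr u₁ e
  | 2, e => s.rarr u₂ e
  | _, e => -s.rarr u₃ e

theorem runs_fillKeys {o n u₀ u₁ u₂ u₃ off N : ℕ} (ho : s.nreg o = off) (hn : s.nreg n = N)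
    (hW : off + N < 2 ^ w) (ho' : o < 20) (hn' : n < 20) (h₀ : u₀ < 12) (h₁ : u₁ < 12)
    (h₂ : u₂ < 12) (h₃ : u₃ < 12) :
    Runs w (fillKeys o n u₀ u₁ u₂ u₃) s (60 * N + 10) fun s' =>
      ∀ i < 4, ∀ x, s'.rarr (12 + i) x =
        if off ≤ x ∧ x < off + N then familyKey s u₀ u₁ u₂ u₃ i (x - off) else s.rarr
            (12 + i) x := by
  refine Runs.for_const (l := 0) (N := N) (T := 40) (fun k s' => ∀ i < 4, ∀ x, s'.rarr (12 + i) x =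
      if off ≤ x ∧ x < off + k then familyKey s u₀ u₁ u₂ u₃ i (x - off) else s.rarr (12 + i) x)
    (by simp [NExpr.eval]) (Nat.zero_le _) (by omega) (by simp [Prog.WritesReg])
    (fun s' hS => (hS.reg n (by simp [Prog.WritesReg, Prog.for]; omega)).trans hn) ?_ ?_
    (fun _ _ h => h) ?_
  · intro i _ x
    rw [if_neg (by omega)]
    rfl
  · rintro k - hk s' hS h21 hI
    have eo := (hS.reg o (by simp [Prog.WritesReg, Prog.for]; omega)).trans ho
    have hu : ∀ u < 12, s'.rarr u = s.rarr u := fun u hu =>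
      hS.real u (by simp [Prog.WritesReal, Prog.for]; omega)
    have hidx : ∀ s'' : State, s''.nreg = s'.nreg →
        (NExpr.add (.reg o) (.reg 21)).eval w s'' = off + k := by
      intro s'' h
      simp only [NExpr.eval, h, eo, h21]
      exact Nat.mod_eq_of_lt (by omega)
    refine Runs.rstore_seq (z := familyKey s u₀ u₁ u₂ u₃ 0 k) (hidx _ rfl) ?_
      (by simp [NExpr.cost, RExpr.cost]) ?_
    · simp [RExpr.eval, NExpr.eval, h21, hu u₀ h₀, familyKey]
    refine Runs.rstore_seq (z := familyKey s u₀ u₁ u₂ u₃ 1 k) (hidx _ rfl) ?_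
      (by simp [NExpr.cost, RExpr.cost]) ?_
    · simp [RExpr.eval, NExpr.eval, h21, hu u₁ h₁, familyKey, h₁.ne]
    refine Runs.rstore_seq (z := familyKey s u₀ u₁ u₂ u₃ 2 k) (hidx _ rfl) ?_
      (by simp [NExpr.cost, RExpr.cost]) ?_
    · simp [RExpr.eval, NExpr.eval, h21, hu u₂ h₂, familyKey, h₂.ne, show u₂ ≠ 13 by omega]
    refine Runs.rstore (z := familyKey s u₀ u₁ u₂ u₃ 3 k) (hidx _ rfl) ?_ ?_
      (by simp [NExpr.cost, RExpr.cost])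
    · simp [RExpr.eval, NExpr.eval, h21, hu u₃ h₃, familyKey, h₃.ne, show u₃ ≠ 13 by omega,
        show u₃ ≠ 14 by omega]
    · intro i hi x
      have key : ∀ v z : ℝ, (z = if off ≤ x ∧ x < off + k then familyKey s u₀ u₁ u₂ u₃ i (x - off)
          else s.rarr (12 + i) x) → v = familyKey s u₀ u₁ u₂ u₃ i k →
          (if x = off + k then v else z) = if off ≤ x ∧ x < off + (k + 1) then
            familyKey s u₀ u₁ u₂ u₃ i (x - off) else s.rarr (12 + i) x := by
        rintro v z rfl rfl
        by_cases hx : x = off + k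
        · rw [if_pos hx, if_pos (by omega), hx, Nat.add_sub_cancel_left]
        · rw [if_neg hx]
          exact if_congr (by omega) rfl rfl
      have hIi := hI i hi x
      rw [← key _ _ hIi rfl]
      interval_cases i <;> simp
  · simp only [NExpr.cost]
    omega

end Setup

theorem runs_setSides {w l h l' h' : ℕ} {s : State} (hl' : l' < 12) (hh : h < 12) (hh' : h' < 12) :
    Runs w (setSides l h l' h') s 8 fun s' => s'.nreg 12 = s.nreg l ∧ s'.nreg 13 = s.nreg h ∧
      s'.nreg 14 = s.nreg l' ∧ s'.nreg 15 = s.nreg h' := by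
  refine Runs.of_loopFree (by simp [setSides, Prog.LoopFree]) ?_
    (by simp [setSides, Prog.time, NExpr.cost])
  simp only [setSides, Prog.run, NExpr.eval, State.setReg_nreg]
  refine ⟨by simp, ?_, ?_, ?_⟩
  · simp [hh.ne]
  · simp [show l' ≠ 12 by omega, show l' ≠ 13 by omega]
  · simp [show h' ≠ 12 by omega, show h' ≠ 13 by omega, show h' ≠ 14 by omega]

/-- The program `p` tests `A` on the ranking `D` within time `T`. -/
def Tests {w : ℕ} (D : Ranking w) (p : Prog) (T : ℕ) (A : Prop) : Prop :=
  p.Local ∧ ∀ s, D.Stored s → Runs w p s T (Verdict A s)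

theorem Tests.seq {w : ℕ} {D : Ranking w} {p q : Prog} {T T' : ℕ} {A B : Prop} (h : Tests D p T A)
    (h' : Tests D q T' B) : Tests D (.seq p q) (T + T') (A ∧ B) :=
  ⟨⟨h.1, h'.1⟩, fun s hs => Runs.seq (h.2 s hs)
    (fun _ hS hv => (h'.2 _ (hs.of_same hS h.1)).mono le_rfl fun _ _ hv' => hv.and hv') le_rfl⟩

theorem tests_domTest {w : ℕ} (D : Ranking w) {i : ℕ} (hi : i < 4) :
    Tests D (domTest i) (700 * D.cost) (DomCond D.rk D.b i D.lo D.hi D.lo' D.hi') :=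
  ⟨by simp [domTest, leastRank, scanBlocks, scanBlock, sweepCells, sweepCell, conclude, Prog.for,
    Prog.Local], fun _ hs => runs_domTest hs hi⟩

theorem tests_pairTest {w : ℕ} (D : Ranking w) {i j i' j' : ℕ} (hi : i < 4) (hj : j < 4)
    (hi' : i' < 4) (hj' : j' < 4) :
    Tests D (pairTest i j i' j') (1000 * D.cost)
      (PairCond D.rk D.b i j i' j' D.lo D.hi D.lo' D.hi') :=
  ⟨by simp [pairTest, exits, initColumns, coverBlock, coverRow, addRectangle, refresh, Prog.for,
    Prog.Local], fun _ hs => runs_pairTest hs hi hj hi' hj'⟩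

theorem tests_domTests {w : ℕ} (D : Ranking w) : Tests D domTests (2800 * D.cost)
    (∀ i < 4, DomCond D.rk D.b i D.lo D.hi D.lo' D.hi') := by
  rw [forall_lt_four]
  have h := (tests_domTest D (i := 0) (by norm_num)).seq ((tests_domTest D (i := 1)
      (by norm_num)).seq
    ((tests_domTest D (i := 2) (by norm_num)).seq (tests_domTest D (i := 3) (by norm_num))))
  exact ⟨h.1, fun s hs => (h.2 s hs).mono (by omega) fun _ _ h => h⟩

theorem tests_pairTests {w : ℕ} (D : Ranking w) : Tests D pairTests (6000 * D.cost)
    (PairCond D.rk D.b 0 1 2 3 D.lo D.hi D.lo' D.hi' ∧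
      PairCond D.rk D.b 2 3 0 1 D.lo D.hi D.lo' D.hi' ∧
      PairCond D.rk D.b 0 2 1 3 D.lo D.hi D.lo' D.hi' ∧
      PairCond D.rk D.b 1 3 0 2 D.lo D.hi D.lo' D.hi' ∧
      PairCond D.rk D.b 0 3 1 2 D.lo D.hi D.lo' D.hi' ∧
      PairCond D.rk D.b 1 2 0 3 D.lo D.hi D.lo' D.hi') := by
  have h := (tests_pairTest D (i := 0) (j := 1) (i' := 2) (j' := 3) (by norm_num) (by norm_num)
      (by norm_num) (by norm_num)).seq <|
    (tests_pairTest D (i := 2) (j := 3) (i' := 0) (j' := 1) (by norm_num) (by norm_num)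
      (by norm_num) (by norm_num)).seq <|
    (tests_pairTest D (i := 0) (j := 2) (i' := 1) (j' := 3) (by norm_num) (by norm_num)
      (by norm_num) (by norm_num)).seq <|
    (tests_pairTest D (i := 1) (j := 3) (i' := 0) (j' := 2) (by norm_num) (by norm_num)
      (by norm_num) (by norm_num)).seq <|
    (tests_pairTest D (i := 0) (j := 3) (i' := 1) (j' := 2) (by norm_num) (by norm_num)
      (by norm_num) (by norm_num)).seq <|
    tests_pairTest D (i := 1) (j := 2) (i' := 0) (j' := 3) (by norm_num) (by norm_num)
      (by norm_num) (by norm_num)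
  exact ⟨h.1, fun s hs => (h.2 s hs).mono (by omega) fun _ _ h => h⟩

section Elements
variable {a b c : ℕ} (P : Fin a → Rect) (Q : Fin b → Rect) (R : Fin c → Rect)

/-- The key in coordinate `i` of the element `x`; the members of `Q` are lower elements, those of
`P` and `R` are upper ones. -/
noncomputable def elementKey (i x : ℕ) : ℝ :=
  if h : x < b then (Q ⟨x, h⟩).lowerKey i
  else if h : x - b < a then (P ⟨x - b, h⟩).upperKey i
  else if h : x - (b + a) < c then (R ⟨x - (b + a), h⟩).upperKey i
  else 0

variable {P Q R}

theorem familyKey_input_Q {i e : ℕ} (he : e < b) :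
    familyKey (input P Q R) 4 5 6 7 i e = (Q ⟨e, he⟩).lowerKey i := by
  match i with
  | 0 | 1 | 2 | n + 3 => simp [familyKey, input, he, Rect.coord, Rect.lowerKey]

theorem familyKey_input_P {i e : ℕ} (he : e < a) :
    familyKey (input P Q R) 1 0 3 2 i e = (P ⟨e, he⟩).upperKey i := by
  match i with
  | 0 | 1 | 2 | n + 3 => simp [familyKey, input, he, Rect.coord, Rect.upperKey]

theorem familyKey_input_R {i e : ℕ} (he : e < c) :
    familyKey (input P Q R) 9 8 11 10 i e = (R ⟨e, he⟩).upperKey i := by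
  match i with
  | 0 | 1 | 2 | n + 3 => simp [familyKey, input, he, Rect.coord, Rect.upperKey]

/-- Since `M ≤ g ^ 4 ≤ 2 ^ (4 * g)`, the height of the tournament trees is at most `4 * g`, a bound
that is sufficient here. -/
theorem runs_setup {w g : ℕ} (hW : 128 * (b + a + c) + 64 ≤ 2 ^ w) (hM : b + a + c ≤ g ^ 4)
    (hg : g ^ 4 ≤ 16 * (b + a + c)) (hg1 : 1 ≤ g) (hlt : ∀ c' < g, c' ^ 4 < b + a + c)
    (hpos : 1 ≤ b + a + c) :
    Runs w setup (input P Q R)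
      (4 * ((b + a + c) * (280 * g + 200) + 50) + 60 * (b + a + c) + 30 * g + 90) fun s' =>
      s'.nreg 1 = b ∧ s'.nreg 4 = b + a ∧ s'.nreg 5 = b + a + c ∧ s'.nreg 6 = g ∧
      s'.nreg 7 = g * g * g ∧
      ∀ i < 4, Sorted (elementKey P Q R i) (b + a + c) (s'.narr i) (s'.narr (4 + i)) := by
  have hL : b + a + c ≤ 2 ^ (4 * g) := by
    refine hM.trans ?_
    rw [mul_comm, pow_mul]
    exact Nat.pow_le_pow_left Nat.lt_two_pow_self.le 4
  have hsortT : (b + a + c) * (70 * (4 * g) + 200) + 50 = (b + a + c) * (280 * g + 200) + 50 := by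
    ring
  refine Runs.nset_seq (v := b + a) ?_ (by simp [NExpr.cost]) ?_
  · simpa [NExpr.eval, input] using Nat.mod_eq_of_lt (by omega)
  refine Runs.nset_seq (v := b + a + c) ?_ (by simp [NExpr.cost]) ?_
  · simpa [NExpr.eval, input] using Nat.mod_eq_of_lt (by omega)
  refine Runs.nset_seq (v := 0) (by simp [NExpr.eval]) (by simp [NExpr.cost]) ?_
  generalize hs₀ : ((((input P Q R).setReg 4 (b + a)).setReg 5 (b + a + c)).setReg 3 0) = s₀
  have r0 : s₀.nreg 0 = a := by simp [← hs₀, input]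
  have r1 : s₀.nreg 1 = b := by simp [← hs₀, input]
  have r2 : s₀.nreg 2 = c := by simp [← hs₀, input]
  have r3 : s₀.nreg 3 = 0 := by simp [← hs₀]
  have r4 : s₀.nreg 4 = b + a := by simp [← hs₀]
  have r5 : s₀.nreg 5 = b + a + c := by simp [← hs₀]
  have rr : s₀.rarr = (input P Q R).rarr := by simp [← hs₀]
  refine Runs.seq (runs_blockSize hW r5 hM hg hg1 hlt)
    (T₂ := 4 * ((b + a + c) * (280 * g + 200) + 50) + 60 * (b + a + c) + 30) ?_
    (by simp [NExpr.cost]; omega)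
  rintro s₁ hS₁ ⟨h6, h7⟩
  have k1 : ∀ x < 6, s₁.nreg x = s₀.nreg x := fun x hx =>
    hS₁.reg x (by simp [Prog.WritesReg, blockSize]; omega)
  have rr1 : s₁.rarr = (input P Q R).rarr := by
    funext x
    rw [hS₁.real x (by simp [Prog.WritesReal, blockSize]), rr]
  refine Runs.seq (runs_fillKeys (off := 0) (N := b) ((k1 3 (by norm_num)).trans r3)
    ((k1 1 (by norm_num)).trans r1) (by omega) (by norm_num) (by norm_num) (by norm_num)
        (by norm_num)
    (by norm_num) (by norm_num))
    (T₂ := 4 * ((b + a + c) * (280 * g + 200) + 50) + 60 * (a + c) + 20) ?_ (by omega)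
  intro s₂ hS₂ hf₂
  have k2 : ∀ x < 8, s₂.nreg x = s₁.nreg x := fun x hx =>
    hS₂.reg x (by simp [Prog.WritesReg, fillKeys, Prog.for]; omega)
  have rr2 : ∀ x < 12, s₂.rarr x = (input P Q R).rarr x := fun x hx => by
    rw [hS₂.real x (by simp [Prog.WritesReal, fillKeys, Prog.for]; omega), rr1]
  refine Runs.seq (runs_fillKeys (off := b) (N := a)
    (((k2 1 (by norm_num)).trans (k1 1 (by norm_num))).trans r1)
    (((k2 0 (by norm_num)).trans (k1 0 (by norm_num))).trans r0)
    (by omega) (by norm_num) (by norm_num) (by norm_num) (by norm_num)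
    (by norm_num) (by norm_num))
    (T₂ := 4 * ((b + a + c) * (280 * g + 200) + 50) + 60 * c + 10) ?_ (by omega)
  intro s₃ hS₃ hf₃
  have k3 : ∀ x < 8, s₃.nreg x = s₂.nreg x := fun x hx =>
    hS₃.reg x (by simp [Prog.WritesReg, fillKeys, Prog.for]; omega)
  have rr3 : ∀ x < 12, s₃.rarr x = (input P Q R).rarr x := fun x hx => by
    rw [hS₃.real x (by simp [Prog.WritesReal, fillKeys, Prog.for]; omega), rr2 x hx]
  refine Runs.seq (runs_fillKeys (off := b + a) (N := c)
    (by rw [k3 4 (by norm_num), k2 4 (by norm_num), k1 4 (by norm_num), r4])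
    (by rw [k3 2 (by norm_num), k2 2 (by norm_num), k1 2 (by norm_num), r2])
    (by omega) (by norm_num) (by norm_num) (by norm_num) (by norm_num)
    (by norm_num) (by norm_num))
    (T₂ := 4 * ((b + a + c) * (280 * g + 200) + 50)) ?_ (by omega)
  intro s₄ hS₄ hf₄
  have k4 : ∀ x < 8, s₄.nreg x = s₃.nreg x := fun x hx =>
    hS₄.reg x (by simp [Prog.WritesReg, fillKeys, Prog.for]; omega)
  have k : ∀ x < 8, s₄.nreg x = s₁.nreg x := fun x hx => by rw [k4 x hx, k3 x hx, k2 x hx]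
  have hkey : ∀ i < 4, s₄.rarr (12 + i) = elementKey P Q R i := by
    intro i hi
    have hfam : ∀ s : State, (∀ x < 12, s.rarr x = (input P Q R).rarr x) → ∀ u₀ < 12, ∀ u₁ < 12,
        ∀ u₂ < 12, ∀ u₃ < 12, ∀ e, familyKey s u₀ u₁ u₂ u₃ i e =
          familyKey (input P Q R) u₀ u₁ u₂ u₃ i e := by
      intro s hs u₀ h₀ u₁ h₁ u₂ h₂ u₃ h₃ e
      interval_cases i <;> simp [familyKey, hs _ h₀, hs _ h₁, hs _ h₂, hs _ h₃]
    funext x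
    rw [hf₄ i hi, hfam s₃ rr3 _ (by norm_num) _ (by norm_num) _ (by norm_num) _ (by norm_num),
      hf₃ i hi, hfam s₂ rr2 _ (by norm_num) _ (by norm_num) _ (by norm_num) _ (by norm_num),
      hf₂ i hi, hfam s₁ (fun x _ => by rw [rr1]) _ (by norm_num) _ (by norm_num) _ (by norm_num) _
      (by norm_num), rr1, elementKey]
    by_cases hx : x < b
    · rw [if_neg (by omega), if_neg (by omega), if_pos (by omega), dif_pos hx]
      exact familyKey_input_Q hx
    · rw [dif_neg hx]
      by_cases hx' : x - b < a
      · rw [if_neg (by omega), if_pos (by omega), dif_pos hx']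
        exact familyKey_input_P hx'
      · rw [dif_neg hx']
        by_cases hx'' : x - (b + a) < c
        · rw [if_pos (by omega), dif_pos hx'']
          exact familyKey_input_R hx''
        · rw [if_neg (by omega), if_neg (by omega), if_neg (by omega), dif_neg hx'']
          simp [input, show ¬ 12 + i < 4 by omega, show ¬ 12 + i < 8 by omega]
  have q5 : s₄.nreg 5 = b + a + c := by rw [k 5 (by norm_num), k1 5 (by norm_num), r5]
  have hW' : 8 * (b + a + c) + 64 ≤ 2 ^ w := by omega
  refine Runs.seq (runs_sort hW' hpos hL (by norm_num : 0 < 4) q5 (hkey 0 (by norm_num)))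
    (T₂ := 3 * ((b + a + c) * (280 * g + 200) + 50)) ?_ (by rw [hsortT]; omega)
  intro s₅ hS₅ hsort₀
  have t5 : ∀ x < 8, s₅.nreg x = s₄.nreg x := fun x hx =>
    hS₅.reg x (by simp [Prog.WritesReg, sort, buildTree, repairPath, pull, Prog.for]; omega)
  have u5 : s₅.rarr = s₄.rarr := funext fun x =>
    hS₅.real x (by simp [Prog.WritesReal, sort, buildTree, repairPath, pull, Prog.for])
  refine Runs.seq (runs_sort hW' hpos hL (by norm_num : 1 < 4) ((t5 5 (by norm_num)).trans q5)
    ((congrFun u5 _).trans (hkey 1 (by norm_num))))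
    (T₂ := 2 * ((b + a + c) * (280 * g + 200) + 50)) ?_ (by rw [hsortT]; omega)
  intro s₆ hS₆ hsort₁
  have t6 : ∀ x < 8, s₆.nreg x = s₄.nreg x := fun x hx =>
    (hS₆.reg x (by simp [Prog.WritesReg, sort, buildTree, repairPath, pull, Prog.for]; omega)).trans
      (t5 x hx)
  have u6 : s₆.rarr = s₄.rarr := by
    rw [← u5]
    exact funext fun x =>
      hS₆.real x (by simp [Prog.WritesReal, sort, buildTree, repairPath, pull, Prog.for])
  have v6 : ∀ x, ¬ (x = 1 ∨ x = 5 ∨ x = 8) → s₆.narr x = s₅.narr x := fun x hx =>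
    hS₆.arr x (by simp [Prog.WritesArr, sort, buildTree, repairPath, pull, Prog.for]; omega)
  refine Runs.seq (runs_sort hW' hpos hL (by norm_num : 2 < 4) ((t6 5 (by norm_num)).trans q5)
    ((congrFun u6 _).trans (hkey 2 (by norm_num))))
    (T₂ := (b + a + c) * (280 * g + 200) + 50) ?_ (by rw [hsortT]; omega)
  intro s₇ hS₇ hsort₂
  have t7 : ∀ x < 8, s₇.nreg x = s₄.nreg x := fun x hx =>
    (hS₇.reg x (by simp [Prog.WritesReg, sort, buildTree, repairPath, pull, Prog.for]; omega)).trans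
      (t6 x hx)
  have u7 : s₇.rarr = s₄.rarr := by
    rw [← u6]
    exact funext fun x =>
      hS₇.real x (by simp [Prog.WritesReal, sort, buildTree, repairPath, pull, Prog.for])
  have v7 : ∀ x, ¬ (x = 2 ∨ x = 6 ∨ x = 8) → s₇.narr x = s₆.narr x := fun x hx =>
    hS₇.arr x (by simp [Prog.WritesArr, sort, buildTree, repairPath, pull, Prog.for]; omega)
  refine (runs_sort hW' hpos hL (by norm_num : 3 < 4) ((t7 5 (by norm_num)).trans q5)
    ((congrFun u7 _).trans (hkey 3 (by norm_num)))).mono (by rw [hsortT]) ?_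
  intro s₈ hS₈ hsort₃
  have t8 : ∀ x < 8, s₈.nreg x = s₁.nreg x := fun x hx => by
    rw [hS₈.reg x (by simp [Prog.WritesReg, sort, buildTree, repairPath, pull, Prog.for]; omega),
      t7 x hx, k x hx]
  have v8 : ∀ x, ¬ (x = 3 ∨ x = 7 ∨ x = 8) → s₈.narr x = s₇.narr x := fun x hx =>
    hS₈.arr x (by simp [Prog.WritesArr, sort, buildTree, repairPath, pull, Prog.for]; omega)
  refine ⟨?_, ?_, ?_, ?_, ?_, forall_lt_four.2 ⟨?_, ?_, ?_, hsort₃⟩⟩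
  · rw [t8 1 (by norm_num), k1 1 (by norm_num), r1]
  · rw [t8 4 (by norm_num), k1 4 (by norm_num), r4]
  · rw [t8 5 (by norm_num), k1 5 (by norm_num), r5]
  · rw [t8 6 (by norm_num), h6]
  · rw [t8 7 (by norm_num), h7]
  · rw [v8 0 (by norm_num), v7 0 (by norm_num), v6 0 (by norm_num), v8 4 (by norm_num),
      v7 4 (by norm_num), v6 4 (by norm_num)]
    exact hsort₀
  · rw [v8 1 (by norm_num), v7 1 (by norm_num), v8 (4 + 1) (by norm_num), v7 (4 + 1) (by norm_num)]
    exact hsort₁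
  · rw [v8 2 (by norm_num), v8 (4 + 2) (by norm_num)]
    exact hsort₂

/-- The question about the three families in terms of ranks. -/
theorem exists_intersects_iff {rk ord : ℕ → ℕ → ℕ}
    (h : ∀ i < 4, Sorted (elementKey P Q R i) (b + a + c) (rk i) (ord i)) :
    (∀ (i : Fin a) (j : Fin c), ∃ l : Fin b, (Q l).Intersects (P i) ∧ (Q l).Intersects (R j)) ↔
    ∀ p, b ≤ p → p < b + a → ∀ r, b + a ≤ r → r < b + a + c →
      ∃ q < b, ∀ j < 4, rk j q < rk j p ∧ rk j q < rk j r := by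
  have hlt : ∀ j < 4, ∀ q < b, ∀ x, b ≤ x → x < b + a + c →
      (rk j q < rk j x ↔ elementKey P Q R j q ≤ elementKey P Q R j x) := by
    intro j hj q hq x hx hx'
    rw [(h j hj).lt_iff q (by omega) x hx', rankValue_lt_iff, le_iff_lt_or_eq]
    have h1 : q < b + a + c := by omega
    have h2 : q < x := by omega
    simp [h1, h2, hx']
  have hQP : ∀ (l : Fin b) (i : Fin a), (Q l).Intersects (P i) ↔
      ∀ j < 4, rk j l < rk j (b + i) := by
    intro l i
    rw [Rect.intersects_iff_key]
    refine forall_congr' fun j => forall_congr' fun hj => ?_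
    rw [hlt j hj l l.2 _ (by omega) (by omega)]
    simp [elementKey]
  have hQR : ∀ (l : Fin b) (i : Fin c), (Q l).Intersects (R i) ↔
      ∀ j < 4, rk j l < rk j (b + a + i) := by
    intro l i
    rw [Rect.intersects_iff_key]
    refine forall_congr' fun j => forall_congr' fun hj => ?_
    rw [hlt j hj l l.2 _ (by omega) (by omega)]
    have h1 : ¬ b + a + (i : ℕ) < b := by omega
    have h2 : ¬ b + a + (i : ℕ) - b < a := by omega
    simp [elementKey, h1, h2]
  constructor
  · intro H p hp hp' r hr hr'
    obtain ⟨l, h1, h2⟩ := H ⟨p - b, by omega⟩ ⟨r - (b + a), by omega⟩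
    rw [hQP] at h1
    rw [hQR] at h2
    simp only [Nat.add_sub_cancel' hp] at h1
    simp only [Nat.add_sub_cancel' hr] at h2
    exact ⟨l, l.2, fun j hj => ⟨h1 j hj, h2 j hj⟩⟩
  · intro H i j
    obtain ⟨q, hq, h1⟩ := H (b + i) (by omega) (by omega) (b + a + j) (by omega) (by omega)
    exact ⟨⟨q, hq⟩, (hQP _ _).2 fun j hj => (h1 j hj).1, (hQR _ _).2 fun j hj => (h1 j hj).2⟩

theorem runs_algorithm {w : ℕ} (hW : 128 * (b + a + c) + 64 ≤ 2 ^ w) :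
    ∃ g, g ^ 4 ≤ 16 * (b + a + c) ∧ Runs w algorithm (input P Q R) (20000 * g ^ 7 + 20) fun s' =>
      ((∀ (i : Fin a) (j : Fin c), ∃ l : Fin b, (Q l).Intersects (P i) ∧ (Q l).Intersects (R j)) →
        s'.nreg 0 = 1) ∧
      (¬ (∀ (i : Fin a) (j : Fin c), ∃ l : Fin b, (Q l).Intersects (P i) ∧ (Q l).Intersects (R j)) →
        s'.nreg 0 = 0) := by
  have h1W : 1 % 2 ^ w = 1 := Nat.mod_eq_of_lt (by omega)
  have htest : BExpr.Holds w (input P Q R) (.or (.neq (.reg 0) (.const 0)) (.neq (.reg 2)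
      (.const 0))) ↔
      a = 0 ∨ c = 0 := by simp [BExpr.Holds, NExpr.eval, input]
  by_cases h0 : a = 0 ∨ c = 0
  · refine ⟨0, by simp, Runs.cond (by simp [BExpr.cost, NExpr.cost]) (fun _ => ?_)
      fun h => absurd (htest.2 h0) h⟩
    refine Runs.nset (v := 1) h1W ⟨fun _ => by simp, fun h => absurd (fun i j => ?_) h⟩
      (by simp [BExpr.cost, NExpr.cost])
    rcases h0 with rfl | rfl
    · exact i.elim0
    · exact j.elim0
  rw [not_or] at h0
  obtain ⟨g, hg1, hM, hg, hlt⟩ := exists_root (M := b + a + c) (by omega)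
  have hB : 0 < g * g * g := by positivity
  have e4 : g * (g * g * g) = g ^ 4 := by ring
  refine ⟨g, hg, Runs.cond (by simp [BExpr.cost, NExpr.cost])
    (fun h => absurd (htest.1 h) (by omega)) fun _ => ?_⟩
  have e7 : g * (g * g * g) * (g * g * g) = g ^ 7 := by ring
  have hg4 : g ^ 4 ≤ g ^ 7 := Nat.pow_le_pow_right hg1 (by norm_num)
  have hgg : g ≤ g ^ 7 := Nat.le_self_pow (by norm_num) g
  have hMg : (b + a + c) * g ≤ g ^ 7 :=
    (Nat.mul_le_mul_right g hM).trans (by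
      rw [← pow_succ]
      exact Nat.pow_le_pow_right hg1 (by norm_num))
  refine Runs.seq (runs_setup hW hM hg hg1 hlt (by omega)) (T₂ := 15000 * g ^ 7) ?_
    (by
      simp only [BExpr.cost, NExpr.cost]
      have : (b + a + c) * (280 * g + 200) = 280 * ((b + a + c) * g) + 200 * (b + a + c) := by ring
      rw [this]
      omega)
  rintro s₁ - ⟨r1, r4, r5, r6, r7, hsorted⟩
  rw [exists_intersects_iff hsorted]
  -- the ranking with the two possible choices of the sides
  have mk : ∀ lo hi lo' hi', b ≤ lo → b ≤ lo' → lo ≤ hi → lo' ≤ hi' → hi ≤ b + a + c →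
      hi' ≤ b + a + c → ∃ D : Ranking w, D.cost = g ^ 7 ∧ D.b = b ∧ D.M = b + a + c ∧ D.g = g ∧
        D.B = g * g * g ∧ D.lo = lo ∧ D.hi = hi ∧ D.lo' = lo' ∧ D.hi' = hi' ∧ D.rk = s₁.narr ∧
        D.ord = fun i => s₁.narr (4 + i) := fun lo hi lo' hi' h1 h2 h3 h4 h5 h6 =>
    ⟨{  M := b + a + c
        b := b
        g := g
        B := g * g * g
        lo := lo
        hi := hi
        lo' := lo'
        hi' := hi'
        rk := s₁.narr
        ord := fun i => s₁.narr (4 + i)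
        B_pos := hB
        g_pos := hg1
        sq_le := Nat.le_mul_of_pos_right _ hg1
        M_le := by rwa [e4]
        word := by omega
        b_le := h1
        b_le' := h2
        lo_le := h3
        lo_le' := h4
        hi_le := h5
        hi_le' := h6
        rk_lt := fun j hj => (hsorted j hj).rk_lt
        ord_lt := fun j hj => (hsorted j hj).ord_lt
        ord_rk := fun j hj => (hsorted j hj).ord_rk
        rk_ord := fun j hj => (hsorted j hj).rk_ord },
      e7, rfl, rfl, rfl, rfl, rfl, rfl, rfl, rfl, rfl, rfl⟩
  obtain ⟨D, hDc, hDb, hDM, hDg, hDB, hDlo, hDhi, hDlo', hDhi', hDrk, hDord⟩ :=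
    mk b (b + a) (b + a) (b + a + c) le_rfl (by omega) (by omega) (by omega) (by omega) le_rfl
  obtain ⟨D', hDc', hDb', hDM', hDg', hDB', hDlo₂, hDhi₂, hDlo₂', hDhi₂', hDrk', hDord'⟩ :=
    mk (b + a) (b + a + c) b (b + a) (by omega) le_rfl (by omega) (by omega) le_rfl (by omega)
  rw [forall_exists_below_iff (rk := s₁.narr) (lo := b) (hi := b + a) (lo' := b + a)
    (hi' := b + a + c) (by omega) (by omega)]
  refine Runs.nset_seq (v := 1) h1W (by simp [NExpr.cost]; omega) ?_
  have hone : (s₁.setReg 20 1).nreg 20 = 1 := by simp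
  refine Runs.seq (runs_setSides (w := w) (s := s₁.setReg 20 1) (l := 1) (h := 4) (l' := 4)
      (h' := 5)
    (by norm_num) (by norm_num) (by norm_num)) (T₂ := 14000 * g ^ 7) ?_
        (by simp [NExpr.cost]; omega)
  rintro s₂ hS₂ ⟨q12, q13, q14, q15⟩
  have k2 : ∀ x, x < 12 ∨ x = 20 → s₂.nreg x = (s₁.setReg 20 1).nreg x := fun x hx =>
    hS₂.reg x (by simp [Prog.WritesReg, setSides]; omega)
  have m2 : ∀ x, s₂.narr x = s₁.narr x := fun x => hS₂.arr x (by simp [Prog.WritesArr, setSides])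
  have hst₂ : D.Stored s₂ := by
    constructor <;> simp [*]
  have hT := (tests_domTests D).seq (tests_pairTests D)
  refine Runs.seq (hT.2 s₂ hst₂) (T₂ := 5000 * g ^ 7) ?_ (by omega)
  intro s₃ hS₃ hv₃
  have hst₃ := hst₂.of_same hS₃ hT.1
  have p1 := hst₃.reg_b
  have p4 : s₃.nreg 4 = b + a := by
    rw [hS₃.reg 4 (hT.1.reg (by norm_num)), k2 4 (by norm_num)]
    simp [r4]
  have p5 := hst₃.reg_M
  refine Runs.seq (runs_setSides (w := w) (s := s₃) (l := 4) (h := 5) (l' := 1) (h' := 4)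
    (by norm_num) (by norm_num) (by norm_num)) (T₂ := 4000 * g ^ 7) ?_ (by omega)
  rintro s₄ hS₄ ⟨q12', q13', q14', q15'⟩
  have k4 : ∀ x, x < 12 ∨ x = 20 → s₄.nreg x = s₃.nreg x := fun x hx =>
    hS₄.reg x (by simp [Prog.WritesReg, setSides]; omega)
  have m4 : ∀ x, s₄.narr x = s₃.narr x := fun x => hS₄.arr x (by simp [Prog.WritesArr, setSides])
  have hst₄ : D'.Stored s₄ := by
    refine ⟨?_, ?_, ?_, ?_, ?_, ?_, ?_, ?_, ?_, ?_⟩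
    · rw [k4 1 (by norm_num), p1, hDb, hDb']
    · rw [k4 5 (by norm_num), p5, hDM, hDM']
    · rw [k4 6 (by norm_num), hst₃.reg_g, hDg, hDg']
    · rw [k4 7 (by norm_num), hst₃.reg_B, hDB, hDB']
    · rw [q12', p4, hDlo₂]
    · rw [q13', p5, hDhi₂, hDM]
    · rw [q14', p1, hDlo₂', hDb]
    · rw [q15', p4, hDhi₂']
    · intro j hj
      rw [m4, hst₃.arr_rk j hj, hDrk, hDrk']
    · intro j hj
      rw [m4, hst₃.arr_ord j hj, hDord, hDord']
  refine Runs.seq ((tests_domTests D').2 s₄ hst₄) (T₂ := 10) ?_ (by omega)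
  intro s₅ _ hv₅
  refine Runs.nset (v := s₅.nreg 20) rfl ?_ (by simp [NExpr.cost])
  have e20 : s₂.nreg 20 = 1 := (k2 20 (by norm_num)).trans hone
  have e20' : s₄.nreg 20 = s₃.nreg 20 := k4 20 (by norm_num)
  rw [Verdict, e20'] at hv₅
  have hv := (hv₃.and hv₅)
  rw [Verdict, e20] at hv
  simp only [hDrk, hDrk', hDb, hDb', hDlo, hDhi, hDlo', hDhi', hDlo₂, hDhi₂, hDlo₂', hDhi₂'] at hv
  have hcomm : ∀ A B C : Prop, (A ∧ B) ∧ C ↔ A ∧ C ∧ B := fun A B C => by tauto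
  rw [hcomm] at hv
  simpa using hv

/-- As `g ^ 4 ≤ 16 * (3 * n)`, the time of order `g ^ 7` is of order `n ^ (7 / 4)`. -/
theorem decidesWithin_algorithm {n w : ℕ} (hn : 2 ≤ n) (hw : 11 * Nat.log 2 n ≤ w) (ha : a ≤ n)
    (hb : b ≤ n) (hc : c ≤ n) :
    DecidesWithin w algorithm (input P Q R)
      ((20000 * 48 ^ (7 / 4 : ℝ) + 20) * (n : ℝ) ^ (7 / 4 : ℝ) * Real.log n ^ 0)
      (∀ (i : Fin a) (j : Fin c), ∃ l : Fin b, (Q l).Intersects (P i) ∧ (Q l).Intersects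
          (R j)) := by
  -- the words have to hold numbers up to `128 * (3 * n) + 64`, and `n < 2 ^ (log n + 1)`
  have hlog : 1 ≤ Nat.log 2 n := Nat.log_pos (by norm_num) hn
  have hlt : n < 2 ^ (Nat.log 2 n + 1) := Nat.lt_pow_succ_log_self (by norm_num) n
  have hpow : 2 ^ (Nat.log 2 n + 10) ≤ 2 ^ w := Nat.pow_le_pow_right (by norm_num) (by omega)
  have hW : 128 * (b + a + c) + 64 ≤ 2 ^ w := by
    rw [pow_succ] at hlt
    rw [pow_add] at hpow
    omega
  obtain ⟨g, hg, s', t, h1, h2, h3⟩ := runs_algorithm (P := P) (Q := Q) (R := R) hW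
  refine ⟨s', t, h1, ?_, h3⟩
  have hg' : (g : ℝ) ^ 4 ≤ 48 * n := by
    have : g ^ 4 ≤ 48 * n := by omega
    exact_mod_cast this
  have hg0 : (0 : ℝ) ≤ g := Nat.cast_nonneg g
  have h7 : (g : ℝ) ^ 7 ≤ 48 ^ (7 / 4 : ℝ) * (n : ℝ) ^ (7 / 4 : ℝ) := by
    have e : (g : ℝ) ^ 7 = ((g : ℝ) ^ 4) ^ (7 / 4 : ℝ) := by
      rw [← Real.rpow_natCast, ← Real.rpow_natCast, ← Real.rpow_mul hg0]
      norm_num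
    rw [e, ← Real.mul_rpow (by norm_num) (Nat.cast_nonneg n)]
    exact Real.rpow_le_rpow (by positivity) hg' (by norm_num)
  have hn1 : (1 : ℝ) ≤ (n : ℝ) ^ (7 / 4 : ℝ) :=
    Real.one_le_rpow (by exact_mod_cast (by omega : 1 ≤ n)) (by norm_num)
  have ht : (t : ℝ) ≤ 20000 * (g : ℝ) ^ 7 + 20 := by exact_mod_cast h2
  rw [pow_zero, mul_one]
  nlinarith

end Elements

end RealRAM

theorem mainTheorem12 :
    -- an algorithm with running time `O(n ^ (7/4) * (log n) ^ k)`, for all word sizes that are at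
    -- least a constant times `log n`
    (∃ (prog : RealRAM.Prog) (κ k : ℕ) (C : ℝ), ∀ n : ℕ, 2 ≤ n → ∀ w : ℕ, κ * Nat.log 2 n ≤ w →
      (∀ (a b c : ℕ), a ≤ n → b ≤ n → c ≤ n →
        ∀ (P : Fin a → Rect) (Q : Fin b → Rect) (R : Fin c → Rect),
          RealRAM.DecidesWithin w prog (RealRAM.input P Q R)
            (C * (n : ℝ) ^ (7 / 4 : ℝ) * Real.log n ^ k)
            (∀ (i : Fin a) (j : Fin c), ∃ l : Fin b,
              (Q l).Intersects (P i) ∧ (Q l).Intersects (R j))) ∧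
      -- the same algorithm, applied to three copies of one family, solves Diameter-2
      (∀ (m : ℕ), m ≤ n → ∀ S : Fin m → Rect,
          RealRAM.DecidesWithin w prog (RealRAM.input S S S)
            (C * (n : ℝ) ^ (7 / 4 : ℝ) * Real.log n ^ k)
            ((intersectionGraph S).ediam ≤ 2))) ∧
    -- diameter-2 neighborhoods of rectangles have unbounded VC-dimension
    (∀ d : ℕ, ∃ (m : ℕ) (S : Fin m → Rect),
      d ≤ (neighborhoodBalls (intersectionGraph S) 2).vcDim) := by
  refine ⟨⟨RealRAM.algorithm, 11, 0, 20000 * 48 ^ (7 / 4 : ℝ) + 20, fun n hn w hw =>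
    ⟨fun a b c ha hb hc P Q R => RealRAM.decidesWithin_algorithm hn hw ha hb hc,
      fun m hm S => ?_⟩⟩, exists_le_vcDim_neighborhoodBalls⟩
  rw [ediam_intersectionGraph_le_two]
  exact RealRAM.decidesWithin_algorithm hn hw hm hm hm
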